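/- Let $\mathbb{TP}^{n}=\mathbb{R}^{n+1}/\mathbb{R}(1,\dots,1)$ be tropical projective space, with the min-plus convention. For $a=(a_1,\dots,a_6)\in\mathbb{TP}^5$ let the tropical conic $\mathcal{T}(a)\subset\mathbb{TP}^2$ be the set of points $(x,y,z)$ at which the minimum of the six terms $$a_1+2x,\quad a_2+x+y,\quad a_3+2y,\quad a_4+y+z,\quad a_5+2z,\quad a_6+x+z$$ is attained at least twice; the six coordinates of $\mathbb{TP}^5$ are thus labelled by $x^2,xy,y^2,yz,z^2,xz$, in this order. The pencil of conics through $P_1,\dots,P_4\in\mathbb{TP}^2$ is the set of all $a\in\mathbb{TP}^5$ with $P_1,\dots,P_4\in\mathcal{T}(a)$. Call $P_i=(x_i,y_i,z_i)$, $1\le i\le 4$, generic if no $4\times4$ submatrix of the $4\times 6$ matrix with rows $(2x_i,\,x_i+y_i,\,2y_i,\,y_i+z_i,\,2z_i,\,x_i+z_i)$ is tropically singular, where a $4\times 4$ matrix $(c_{ij})$ is tropically singular if the minimum of $\sum_i c_{i\sigma(i)}$ over permutations $\sigma$ is attained more than once. In what follows $\Gamma$ denotes a tree with six leaves labelled $x^2,xy,y^2,yz,z^2,xz$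 and four unlabelled trivalent internal vertices. A subset of $\mathbb{TP}^5$ is a tropical line with tree $\Gamma$ if it is an embedded copy of $\Gamma$ in which the edge at the leaf with label $m$ is a half ray in the coordinate direction $e_m$, all other edges are line segments of positive length spanned by integer vectors, and at each internal vertex the primitive vectors in $\mathbb{Z}^6/\mathbb{Z}(1,\dots,1)$ of the outgoing edges sum to zero. **Theorem.** 1. For every generic configuration of four points in $\mathbb{TP}^2$, the pencil of conics through them is a tropical line in $\mathbb{TP}^5$ with tree $\Gamma$, for some such trivalent tree $\Gamma$. 2. A tree $\Gamma$ as above is realizable, that is, there are four generic points in $\mathbb{TP}^2$ whose pencil of conics is a tropical line with tree $\Gamma$, if and only if $\Gamma$ can be embedded as a planar graph into the unit disc such that its six leaves lie on the boundary circle in the cyclic order $x^2,xy,y^2,yz,z^2,xz$. -/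

import Mathlib

/-- The minimum of the family `f` is attained at least twice. -/
def MinAttainedTwice {ι : Type*} (f : ι → ℝ) : Prop :=
  ∃ i j, i ≠ j ∧ f i = f j ∧ ∀ k, f i ≤ f k

/-- A square matrix is tropically singular if the minimum `min_σ ∑ i, A i (σ i)` defining its
tropical determinant is attained by at least two permutations. -/
def TropicallySingular {k : ℕ} (A : Matrix (Fin k) (Fin k) ℝ) : Prop :=
  MinAttainedTwice fun σ : Equiv.Perm (Fin k) => ∑ i, A i (σ i)

/-- Tropical projective space `𝕋ℙⁿ = ℝⁿ⁺¹ / ℝ(1, …, 1)`. -/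
abbrev TropProj (n : ℕ) : Type :=
  (Fin (n + 1) → ℝ) ⧸ Submodule.span ℝ {(1 : Fin (n + 1) → ℝ)}

/-- The class in `𝕋ℙⁿ` of a vector of homogeneous coordinates. -/
def TropProj.mk {n : ℕ} (x : Fin (n + 1) → ℝ) : TropProj n :=
  Submodule.Quotient.mk x

/-- The exponents of the six quadratic monomials, in the order `x², xy, y², yz, z², xz`. -/
def conicExponent : Fin 6 → Fin 3 → ℕ :=
  ![![2, 0, 0], ![1, 1, 0], ![0, 2, 0], ![0, 1, 1], ![0, 0, 2], ![1, 0, 1]]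

/-- The `m`-th quadratic monomial evaluated tropically at `x`. -/
def conicMonomial (x : Fin 3 → ℝ) (m : Fin 6) : ℝ :=
  ∑ i, (conicExponent m i : ℝ) * x i

/-- The tropical conic with coefficient vector `a ∈ 𝕋ℙ⁵`: the points of `𝕋ℙ²` at which the minimum
of the six terms `aₘ ⊙ (m-th monomial)` is attained at least twice. The condition does not depend
on the homogeneous coordinates. -/
def tropicalConic (a : TropProj 5) : Set (TropProj 2) :=
  {p | ∃ (c : Fin 6 → ℝ) (x : Fin 3 → ℝ), TropProj.mk c = a ∧ TropProj.mk x = p ∧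
    MinAttainedTwice fun m => c m + conicMonomial x m}

/-- The pencil of the tropical conics passing through four given points. -/
def conicPencil (P : Fin 4 → TropProj 2) : Set (TropProj 5) :=
  {a | ∀ i, P i ∈ tropicalConic a}

/-- The `4 × 6` matrix with rows `(2xᵢ, xᵢ + yᵢ, 2yᵢ, yᵢ + zᵢ, 2zᵢ, xᵢ + zᵢ)`. -/
def conicMatrix (x : Fin 4 → Fin 3 → ℝ) : Matrix (Fin 4) (Fin 6) ℝ :=
  Matrix.of fun i m => conicMonomial (x i) m

/-- Four points are generic if no maximal square submatrix of the `4 × 6` matrix of their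
coordinates is tropically singular. The condition does not depend on the homogeneous coordinates. -/
def GenericPoints (P : Fin 4 → TropProj 2) : Prop :=
  ∀ x : Fin 4 → Fin 3 → ℝ, (∀ i, TropProj.mk (x i) = P i) →
    ∀ I : Fin 4 ↪o Fin 6, ¬ TropicallySingular ((conicMatrix x).submatrix id I)

/-- A trivalent tree with six leaves `Sum.inl m`, labelled by the monomials
`x², xy, y², yz, z², xz`, and four trivalent internal vertices `Sum.inr v`. -/
structure PencilTree where
  graph : SimpleGraph (Fin 6 ⊕ Fin 4)
  isTree : graph.IsTree
  leaf_degree : ∀ m : Fin 6, (graph.neighborSet (Sum.inl m)).ncard = 1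
  internal_degree : ∀ v : Fin 4, (graph.neighborSet (Sum.inr v)).ncard = 3

/-- An integer vector is primitive in the lattice `ℤⁿ / ℤ(1, …, 1)`. -/
def IsPrimitiveVector {n : ℕ} (u : Fin n → ℤ) : Prop :=
  ∀ d : ℤ, (∀ i j, d ∣ u i - u j) → IsUnit d

/-- The piece of a tree in `𝕋ℙ⁵` belonging to a pair of adjacent vertices, if the internal
vertices are placed at `p`: a bounded edge is a segment, and the edge at the `m`-th leaf is a half
ray in the `m`-th coordinate direction. -/
def treePiece (p : Fin 4 → TropProj 5) : Fin 6 ⊕ Fin 4 → Fin 6 ⊕ Fin 4 → Set (TropProj 5)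
  | Sum.inr v, Sum.inr w => segment ℝ (p v) (p w)
  | Sum.inr v, Sum.inl m => {a | ∃ t : ℝ, 0 ≤ t ∧ a = p v + t • TropProj.mk (Pi.single m 1)}
  | Sum.inl m, Sum.inr v => {a | ∃ t : ℝ, 0 ≤ t ∧ a = p v + t • TropProj.mk (Pi.single m 1)}
  | Sum.inl _, Sum.inl _ => ∅

open Classical in
/-- `L ⊆ 𝕋ℙ⁵` is a tropical line whose tree is `Γ`: it is the tree `Γ` embedded in `𝕋ℙ⁵`, with
internal vertices at `p`, such that
* each bounded edge has positive length and is spanned by a primitive integer vector;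
* the unbounded edges are six half rays, the one of the `m`-th leaf in direction `eₘ`;
* at each vertex the primitive integer vectors of the outgoing edges (`u v y` is the one at the
  vertex `v` along the edge towards `y`) sum to zero in `𝕋ℙ⁵`. -/
def IsTropicalLineOfType (Γ : PencilTree) (L : Set (TropProj 5)) : Prop :=
  ∃ (p : Fin 4 → TropProj 5) (u : Fin 4 → Fin 6 ⊕ Fin 4 → Fin 6 → ℤ),
    (∀ v m, Γ.graph.Adj (Sum.inr v) (Sum.inl m) → u v (Sum.inl m) = Pi.single m 1) ∧
    (∀ v w, Γ.graph.Adj (Sum.inr v) (Sum.inr w) →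
      IsPrimitiveVector (u v (Sum.inr w)) ∧
      ∃ ℓ : ℝ, 0 < ℓ ∧ p w = p v + ℓ • TropProj.mk (fun i => (u v (Sum.inr w) i : ℝ))) ∧
    (∀ v, ∑ y with Γ.graph.Adj (Sum.inr v) y, TropProj.mk (fun i => (u v y i : ℝ)) = 0) ∧
    Function.Injective p ∧
    (∀ y z y' z', Γ.graph.Adj y z → Γ.graph.Adj y' z' → s(y, z) ≠ s(y', z') →
      ∀ a ∈ treePiece p y z ∩ treePiece p y' z',
        ∃ v, Sum.inr v ∈ s(y, z) ∧ Sum.inr v ∈ s(y', z') ∧ a = p v) ∧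
    L = {a | ∃ y z, Γ.graph.Adj y z ∧ a ∈ treePiece p y z}

/-- The tree `Γ` is realizable by a pencil of conics. -/
def RealizableByPencil (Γ : PencilTree) : Prop :=
  ∃ P : Fin 4 → TropProj 2, GenericPoints P ∧ IsTropicalLineOfType Γ (conicPencil P)

/-- The graph `G` can be embedded as a planar graph into the closed unit disc of `ℂ` such that the
vertices `b 0, b 1, …, b (n - 1)` lie in this cyclic order on the boundary circle. Edges are drawn
as arcs (injective paths), which meet only in common end vertices. -/
def EmbedsInDisc {V : Type*} (G : SimpleGraph V) {n : ℕ} (b : Fin n → V) : Prop :=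
  ∃ (pos : V → ℂ) (arc : ∀ d : G.Dart, Path (pos d.fst) (pos d.snd)),
    Function.Injective pos ∧
    (∀ v, ‖pos v‖ ≤ 1) ∧
    (∀ d, Function.Injective (arc d)) ∧
    (∀ d t, ‖arc d t‖ ≤ 1) ∧
    (∀ d, Set.range (arc d.symm) = Set.range (arc d)) ∧
    (∀ d v, pos v ∈ Set.range (arc d) → v ∈ d.edge) ∧
    (∀ d d', d.edge ≠ d'.edge → ∀ z ∈ Set.range (arc d) ∩ Set.range (arc d'),
      ∃ v, v ∈ d.edge ∧ v ∈ d'.edge ∧ z = pos v) ∧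
    ∃ θ : Fin n → ℝ, StrictMono θ ∧ (∀ i j, θ i < θ j + 2 * Real.pi) ∧
      ∀ i, pos (b i) = Complex.exp (θ i * Complex.I)

/-!
The coefficient vectors of the conics through four points form the tropical kernel of the `4 × 6`
matrix `C` of the monomials at the points: the vectors `a` for which, in every row of the matrix
with entries `a m + C r m`, the minimum is attained twice. The argument describes this set by the
tropical maximal minors of `C`, which are costs of optimal matchings of the four rows with four of
the six columns.

*The pencil as a tropical line.* Genericity says that each optimal matching is unique. Exchanging
columns along cycles and along augmenting paths towards tight alternatives
(`exists_iterate_notMem_range`, `exists_pathExchange`) shows that the points of the pencil satisfy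
the circuit equations of the line with Plücker coordinates `plucker C i j`, the minor omitting the
columns `i` and `j` (`GenericMatrix.circuit`). Conversely, tropical combinations of two columns of
Plücker coordinates lie in the pencil (`IsCombination.inPencil`). Together these give the three-term
Plücker relations. The three terms are never all equal: otherwise, at a suitable point of the
pencil, six minors of the `0/1`-matrix of tight entries would be odd, against the classical relation
mod 2 (`GenericMatrix.not_all_equal`). Hence the tree is trivalent.

*Planarity.* Moving a point of the pencil along an edge colours the six monomials in two colours,
such that in every row tight monomials of a given colour come at least in pairs. By the exchange
argument, the chords of the Newton polygon between a matched column and a tight alternative form one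
spanning tree for each colour, and chords of different colours do not cross, since they belong to a
regular subdivision of the polygon. So the colours do not alternate in the cyclic order of the
monomials (`noncrossing_of_colouring`). This forces the planar form of the Plücker relations
(`plucker_quartet`), and the split decomposition of a function on the pairs of sides of a hexagon
shows that the Plücker coordinates are the path metric of one of fourteen planar trees. A pencil
with such Plücker coordinates is the corresponding tropical line
(`HasTreeMetric.isTropicalLineOfType`). Each of the fourteen trees occurs for explicit integer
points (`planarTree_realizable`).

*Trees and drawings.* Every admissible tree is a star or a path of internal vertices with leaves
attached (`PencilTree.exists_presentation`), and it is one of the fourteen trees exactly if no inner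
edge separates the leaves in an alternating way. A realizable tree has this property by
`noncrossing_of_colouring`, applied at the midpoint of an edge. A tree drawn in the disc has it,
because the two sides of an edge are drawn as disjoint connected sets, whereas two paths in the disc
with alternating ends on the boundary circle meet (`exists_eq_of_crossing`, proved with a continuous
logarithm of the difference of the paths). Conversely the fourteen trees have straight-line drawings
whose leaves are the vertices of a regular hexagon.
-/

/-! ### Exchanging columns of a matching -/

open Function in
/-- The exchange map of an injection `σ` and alternative values `g`: it sends `σ r` to `g r` and
fixes every column which is not a value of `σ`. -/
noncomputable def exchangeMap {R M : Type*} (σ g : R → M) : M → M :=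
  Function.extend σ g id

section Exchange

open Function

variable {R M : Type*} {σ g : R → M}

theorem exchangeMap_apply (hσ : Injective σ) (r : R) : exchangeMap σ g (σ r) = g r :=
  hσ.extend_apply _ _ _

theorem exchangeMap_of_notMem {m : M} (hm : m ∉ Set.range σ) : exchangeMap σ g m = m :=
  extend_apply' _ _ _ (by simpa using hm)

open Classical in
/-- The matching obtained from `σ` by passing to the alternative value along all cycles of the
exchange map. -/
noncomputable def cycleExchange (σ g : R → M) (r : R) : M :=
  if σ r ∈ periodicPts (exchangeMap σ g) then g r else σ r

theorem cycleExchange_eq_or (r : R) :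
    cycleExchange σ g r = σ r ∨ cycleExchange σ g r = g r := by
  unfold cycleExchange; split_ifs <;> simp

theorem cycleExchange_of_mem {r : R} (h : σ r ∈ periodicPts (exchangeMap σ g)) :
    cycleExchange σ g r = g r := if_pos h

theorem exchangeMap_mem_periodicPts {m : M} (h : m ∈ periodicPts (exchangeMap σ g)) :
    exchangeMap σ g m ∈ periodicPts (exchangeMap σ g) :=
  (bijOn_periodicPts _).mapsTo h

theorem mem_range_of_mem_periodicPts (hσ : Injective σ) (hg : ∀ r, g r ≠ σ r) {r : R}
    (h : σ r ∈ periodicPts (exchangeMap σ g)) : g r ∈ Set.range σ := by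
  by_contra hr
  have h1 := exchangeMap_mem_periodicPts h
  have h2 := (bijOn_periodicPts (exchangeMap σ g)).injOn h h1
    (by rw [exchangeMap_apply hσ, exchangeMap_of_notMem hr])
  rw [exchangeMap_apply hσ] at h2
  exact hg r h2.symm

theorem cycleExchange_mem_range (hσ : Injective σ) (hg : ∀ r, g r ≠ σ r) (r : R) :
    cycleExchange σ g r ∈ Set.range σ := by
  unfold cycleExchange
  split_ifs with h
  · exact mem_range_of_mem_periodicPts hσ hg h
  · exact ⟨r, rfl⟩

theorem cycleExchange_injective (hσ : Injective σ) : Injective (cycleExchange σ g) := by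
  have key : ∀ r, σ r ∈ periodicPts (exchangeMap σ g) →
      g r ∈ periodicPts (exchangeMap σ g) := fun r h => by
    simpa [exchangeMap_apply hσ] using exchangeMap_mem_periodicPts h
  intro r s h
  unfold cycleExchange at h
  split_ifs at h with h1 h2 h2
  · apply hσ
    apply (bijOn_periodicPts (exchangeMap σ g)).injOn h1 h2
    rwa [exchangeMap_apply hσ, exchangeMap_apply hσ]
  · exact absurd (h ▸ key r h1) h2
  · exact absurd (h ▸ key s h2) h1
  · exact hσ h

theorem exists_iterate_mem_periodicPts {α : Type*} [Finite α] (f : α → α) (x : α) :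
    ∃ n, f^[n] x ∈ periodicPts f := by
  obtain ⟨a, b, hab, h⟩ := Finite.exists_ne_map_eq_of_infinite (fun n : ℕ => f^[n] x)
  wlog hlt : a < b generalizing a b
  · exact this b a hab.symm h.symm (lt_of_le_of_ne (not_lt.1 hlt) hab.symm)
  refine ⟨a, mk_mem_periodicPts (n := b - a) (by omega) ?_⟩
  show f^[b - a] (f^[a] x) = f^[a] x
  rw [← iterate_add_apply, Nat.sub_add_cancel hlt.le]
  exact h.symm

/-- If `σ` is the only matching with its image that uses values of `σ` and `g` only, then every
orbit of the exchange map leaves the image of `σ`. -/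
theorem exists_iterate_notMem_range [Finite M] (hσ : Injective σ) (hg : ∀ r, g r ≠ σ r)
    (huniq : ∀ τ : R → M, Injective τ → (∀ r, τ r ∈ Set.range σ) →
      (∀ r, τ r = σ r ∨ τ r = g r) → τ = σ) (m : M) :
    ∃ n, (exchangeMap σ g)^[n] m ∉ Set.range σ := by
  obtain ⟨n, hn⟩ := exists_iterate_mem_periodicPts (exchangeMap σ g) m
  refine ⟨n, ?_⟩
  rintro ⟨r, hr⟩
  rw [← hr] at hn
  have h := congrFun (huniq _ (cycleExchange_injective hσ) (cycleExchange_mem_range hσ hg)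
    cycleExchange_eq_or) r
  rw [cycleExchange_of_mem hn] at h
  exact hg r h

/-- Augmentation along a path: if the orbit of `g r₀` under the exchange map leaves the image of
`σ` at the column `k`, then there is a matching `τ` using values of `σ` and `g` only, which takes
`r₀` to `g r₀` and trades the column `σ r₀` for `k`. -/
theorem exists_pathExchange (hσ : Injective σ) (hg : ∀ r, g r ≠ σ r) (r₀ : R) {n : ℕ}
    (hn : (exchangeMap σ g)^[n] (g r₀) ∉ Set.range σ) :
    ∃ (τ : R → M) (k : M), k ∉ Set.range σ ∧ (∃ n, k = (exchangeMap σ g)^[n] (g r₀)) ∧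
      Injective τ ∧ (∀ r, τ r = σ r ∨ τ r = g r) ∧ τ r₀ = g r₀ ∧
      (∀ r, τ r ≠ σ r₀) ∧ ∀ r, τ r ∈ Set.range σ ∨ τ r = k := by
  classical
  -- the first exit of the orbit
  have hex : ∃ n, (exchangeMap σ g)^[n] (g r₀) ∉ Set.range σ := ⟨n, hn⟩
  set N := Nat.find hex with hN
  set k := (exchangeMap σ g)^[N] (g r₀) with hk
  have hkr : k ∉ Set.range σ := Nat.find_spec hex
  -- a virtual row closes the path up to a cycle
  let σ' : Option R → M := fun o => o.elim k σ
  let g' : Option R → M := fun o => o.elim (σ r₀) g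
  have hσ' : Injective σ' := by
    rintro (_ | r) (_ | s) h
    · rfl
    · exact absurd ⟨s, h.symm⟩ hkr
    · exact absurd ⟨r, h⟩ hkr
    · exact congrArg some (hσ h)
  have hg' : ∀ o, g' o ≠ σ' o := by
    rintro (_ | r)
    · intro h; exact hkr ⟨r₀, h⟩
    · exact hg r
  have hit : ∀ j ≤ N, (exchangeMap σ' g')^[j] (g r₀) = (exchangeMap σ g)^[j] (g r₀) := by
    intro j
    induction j with
    | zero => intro _; rfl
    | succ j ih =>
      intro hj
      rw [iterate_succ_apply', iterate_succ_apply', ih (by omega)]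
      have : (exchangeMap σ g)^[j] (g r₀) ∈ Set.range σ := by
        by_contra hc
        exact Nat.find_min hex (show j < N by omega) hc
      obtain ⟨r, hr⟩ := this
      rw [← hr, exchangeMap_apply hσ]
      exact exchangeMap_apply (g := g') hσ' (some r)
  have hper : σ r₀ ∈ periodicPts (exchangeMap σ' g') := by
    refine mk_mem_periodicPts (n := N + 2) (by omega) ?_
    show (exchangeMap σ' g')^[N + 2] (σ r₀) = σ r₀
    have h1 : exchangeMap σ' g' (σ r₀) = g r₀ := exchangeMap_apply (g := g') hσ' (some r₀)
    have h2 : exchangeMap σ' g' k = σ r₀ := exchangeMap_apply (g := g') hσ' none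
    rw [show N + 2 = (N + 1) + 1 from rfl, iterate_succ_apply, h1, iterate_succ_apply',
      hit N le_rfl, ← hk, h2]
  have hperk : k ∈ periodicPts (exchangeMap σ' g') := by
    have : ∀ j, (exchangeMap σ' g')^[j] (σ r₀) ∈ periodicPts (exchangeMap σ' g') := by
      intro j
      induction j with
      | zero => exact hper
      | succ j ih => rw [iterate_succ_apply']; exact exchangeMap_mem_periodicPts ih
    have h3 := this (N + 1)
    have h1 : exchangeMap σ' g' (σ r₀) = g r₀ := exchangeMap_apply (g := g') hσ' (some r₀)
    rwa [iterate_succ_apply, h1, hit N le_rfl] at h3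
  have hinj := cycleExchange_injective (g := g') hσ'
  have hnone : cycleExchange σ' g' none = σ r₀ := cycleExchange_of_mem (σ := σ') hperk
  refine ⟨fun r => cycleExchange σ' g' (some r), k, hkr, ⟨N, hk⟩, ?_, ?_, ?_, ?_, ?_⟩
  · intro r s h
    exact Option.some_injective _ (hinj h)
  · intro r
    exact cycleExchange_eq_or (σ := σ') (g := g') (some r)
  · exact cycleExchange_of_mem (σ := σ') (g := g') (r := some r₀) hper
  · intro r h
    have := hinj (h.trans hnone.symm)
    simp at this
  · intro r
    obtain ⟨o, ho⟩ := cycleExchange_mem_range hσ' hg' (some r)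
    rcases o with _ | s
    · exact Or.inr ho.symm
    · exact Or.inl ⟨s, ho⟩

end Exchange

/-! ### Matchings and tropical Plücker coordinates -/

/-- The cost of the matching `σ` of the rows with columns, that is, the weight of a term of a
tropical maximal minor. -/
def matchCost (C : Fin 4 → Fin 6 → ℝ) (σ : Fin 4 → Fin 6) : ℝ := ∑ r, C r (σ r)

/-- `σ` matches the four rows bijectively with the four columns other than `i` and `j`. -/
structure Avoids (i j : Fin 6) (σ : Fin 4 → Fin 6) : Prop where
  inj : Function.Injective σ
  left : ∀ r, σ r ≠ i
  right : ∀ r, σ r ≠ j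

/-- Every maximal tropical minor of `C` is attained by a single matching. -/
def GenericMatrix (C : Fin 4 → Fin 6 → ℝ) : Prop :=
  ∀ i j, i ≠ j → ∃ σ, Avoids i j σ ∧ ∀ τ, Avoids i j τ → τ ≠ σ → matchCost C σ < matchCost C τ

open Classical in
/-- The optimal matching that omits the columns `i` and `j`. -/
noncomputable def optMatching (C : Fin 4 → Fin 6 → ℝ) (i j : Fin 6) : Fin 4 → Fin 6 :=
  if h : ∃ σ, Avoids i j σ ∧ ∀ τ, Avoids i j τ → τ ≠ σ → matchCost C σ < matchCost C τ then
    h.choose else fun _ => 0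

/-- The tropical Plücker coordinate of the kernel of `C`: the tropical minor of `C` that omits the
columns `i` and `j`. -/
noncomputable def plucker (C : Fin 4 → Fin 6 → ℝ) (i j : Fin 6) : ℝ :=
  matchCost C (optMatching C i j)

/-- The Plücker coordinates after translating the columns of `C` by `a`. -/
noncomputable def shiftedPlucker (C : Fin 4 → Fin 6 → ℝ) (a : Fin 6 → ℝ) (i j : Fin 6) : ℝ :=
  plucker C i j - a i - a j

/-- The column `m` attains the minimum of row `r` of `C` translated by `a`. -/
def Tight (C : Fin 4 → Fin 6 → ℝ) (a : Fin 6 → ℝ) (r : Fin 4) (m : Fin 6) : Prop :=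
  ∀ m', a m + C r m ≤ a m' + C r m'

/-- The point `a` lies on the tropical hyperplanes given by the rows of `C`. -/
def InPencil (C : Fin 4 → Fin 6 → ℝ) (a : Fin 6 → ℝ) : Prop :=
  ∀ r, MinAttainedTwice fun m => a m + C r m

section Matchings

variable {C : Fin 4 → Fin 6 → ℝ} {a : Fin 6 → ℝ} {i j : Fin 6} {σ τ : Fin 4 → Fin 6}

theorem Avoids.symm (h : Avoids i j σ) : Avoids j i σ := ⟨h.inj, h.right, h.left⟩

theorem Avoids.image_eq (h : Avoids i j σ) (hij : i ≠ j) :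
    Finset.univ.image σ = Finset.univ \ {i, j} := by
  apply Finset.eq_of_subset_of_card_le
  · intro m hm
    obtain ⟨r, -, rfl⟩ := Finset.mem_image.1 hm
    simp [h.left r, h.right r]
  · rw [Finset.card_image_of_injective _ h.inj,
      Finset.card_sdiff_of_subset (Finset.subset_univ _), Finset.card_pair hij]
    simp

theorem Avoids.mem_range (h : Avoids i j σ) (hij : i ≠ j) {m : Fin 6} (hi : m ≠ i) (hj : m ≠ j) :
    ∃ r, σ r = m := by
  have : m ∈ Finset.univ.image σ := by rw [h.image_eq hij]; simp [hi, hj]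
  simpa using this

theorem Avoids.eq_or_eq (h : Avoids i j σ) (hij : i ≠ j) {m : Fin 6} (hm : m ∉ Set.range σ) :
    m = i ∨ m = j := by
  by_contra hc
  push Not at hc
  exact hm (h.mem_range hij hc.1 hc.2)

theorem Avoids.sum_comp (h : Avoids i j σ) (hij : i ≠ j) (a : Fin 6 → ℝ) :
    ∑ r, a (σ r) = ∑ m, a m - a i - a j := by
  rw [← Finset.sum_image (f := a) (fun x _ y _ hxy => h.inj hxy), h.image_eq hij,
    Finset.sum_sdiff_eq_sub (Finset.subset_univ _), Finset.sum_pair hij]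
  ring

theorem GenericMatrix.opt (hC : GenericMatrix C) (hij : i ≠ j) :
    Avoids i j (optMatching C i j) ∧ ∀ τ, Avoids i j τ → τ ≠ optMatching C i j →
      matchCost C (optMatching C i j) < matchCost C τ := by
  unfold optMatching
  rw [dif_pos (hC i j hij)]
  exact (hC i j hij).choose_spec

theorem GenericMatrix.avoids (hC : GenericMatrix C) (hij : i ≠ j) :
    Avoids i j (optMatching C i j) := (hC.opt hij).1

theorem GenericMatrix.plucker_le (hC : GenericMatrix C) (hij : i ≠ j) (h : Avoids i j τ) :
    plucker C i j ≤ matchCost C τ := by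
  by_cases e : τ = optMatching C i j
  · rw [e, plucker]
  · exact ((hC.opt hij).2 τ h e).le

theorem GenericMatrix.eq_opt (hC : GenericMatrix C) (hij : i ≠ j) (h : Avoids i j τ)
    (hle : matchCost C τ ≤ plucker C i j) : τ = optMatching C i j := by
  by_contra e
  exact absurd hle (not_le.2 ((hC.opt hij).2 τ h e))

theorem GenericMatrix.plucker_comm (hC : GenericMatrix C) (hij : i ≠ j) :
    plucker C i j = plucker C j i :=
  le_antisymm (hC.plucker_le hij (hC.avoids hij.symm).symm)
    (hC.plucker_le hij.symm (hC.avoids hij).symm)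

theorem GenericMatrix.shiftedPlucker_comm (hC : GenericMatrix C) (hij : i ≠ j) :
    shiftedPlucker C a i j = shiftedPlucker C a j i := by
  rw [shiftedPlucker, shiftedPlucker, hC.plucker_comm hij]; ring

theorem Avoids.sum_add (h : Avoids i j σ) (hij : i ≠ j) :
    ∑ r, (a (σ r) + C r (σ r)) = matchCost C σ - a i - a j + ∑ m, a m := by
  rw [Finset.sum_add_distrib, h.sum_comp hij, matchCost]; ring

theorem Avoids.shiftedPlucker_le (hC : GenericMatrix C) (h : Avoids i j τ) (hij : i ≠ j) :
    shiftedPlucker C a i j + ∑ m, a m ≤ ∑ r, (a (τ r) + C r (τ r)) := by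
  rw [h.sum_add hij, shiftedPlucker]
  linarith [hC.plucker_le hij h]

theorem sum_opt (hC : GenericMatrix C) (hij : i ≠ j) :
    ∑ r, (a (optMatching C i j r) + C r (optMatching C i j r)) =
      shiftedPlucker C a i j + ∑ m, a m := by
  rw [(hC.avoids hij).sum_add hij]; rfl

theorem Tight.eq {r : Fin 4} {m m' : Fin 6} (h : Tight C a r m) (h' : Tight C a r m') :
    a m + C r m = a m' + C r m' := le_antisymm (h _) (h' _)

theorem InPencil.exists_tight (h : InPencil C a) (r : Fin 4) (m : Fin 6) :
    ∃ m', m' ≠ m ∧ Tight C a r m' := by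
  obtain ⟨x, y, hxy, he, hmin⟩ := h r
  by_cases hx : x = m
  · exact ⟨y, fun e => hxy (hx.trans e.symm),
      fun k => (show a y + C r y = a x + C r x from he.symm).le.trans (hmin k)⟩
  · exact ⟨x, hx, hmin⟩

theorem inPencil_iff : InPencil C a ↔ ∀ r m, Tight C a r m → ∃ m', m' ≠ m ∧ Tight C a r m' := by
  refine ⟨fun h r m _ => h.exists_tight r m, fun h r => ?_⟩
  obtain ⟨m, -, hm⟩ := Finset.exists_min_image Finset.univ (fun m => a m + C r m)
    Finset.univ_nonempty
  have ht : Tight C a r m := fun m' => hm m' (Finset.mem_univ _)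
  obtain ⟨m', hne, ht'⟩ := h r m ht
  exact ⟨m, m', hne.symm, ht.eq ht', ht⟩

/-- Passing to tight alternatives does not increase the translated cost. -/
theorem sum_le_of_tight {g : Fin 4 → Fin 6} (hg : ∀ r, Tight C a r (g r))
    (hτ : ∀ r, τ r = σ r ∨ τ r = g r) :
    ∑ r, (a (τ r) + C r (τ r)) ≤ ∑ r, (a (σ r) + C r (σ r)) := by
  apply Finset.sum_le_sum
  intro r _
  rcases hτ r with h | h
  · rw [h]
  · rw [h]; exact hg r _

theorem GenericMatrix.exchange_unique (hC : GenericMatrix C) (hij : i ≠ j) {g : Fin 4 → Fin 6}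
    (hg : ∀ r, Tight C a r (g r)) (τ : Fin 4 → Fin 6) (hinj : Function.Injective τ)
    (hr : ∀ r, τ r ∈ Set.range (optMatching C i j))
    (hτ : ∀ r, τ r = optMatching C i j r ∨ τ r = g r) : τ = optMatching C i j := by
  have hav : Avoids i j τ := by
    refine ⟨hinj, fun r h => ?_, fun r h => ?_⟩
    · obtain ⟨s, hs⟩ := hr r
      exact (hC.avoids hij).left s (hs.trans h)
    · obtain ⟨s, hs⟩ := hr r
      exact (hC.avoids hij).right s (hs.trans h)
  apply hC.eq_opt hij hav
  have := sum_le_of_tight hg hτ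
  rw [hav.sum_add hij, sum_opt hC hij, shiftedPlucker] at this
  linarith

/-- Every orbit of the exchange map of an optimal matching towards tight alternatives ends in one
of the two omitted columns. -/
theorem GenericMatrix.exists_exit (hC : GenericMatrix C) (hij : i ≠ j) {g : Fin 4 → Fin 6}
    (hg : ∀ r, Tight C a r (g r)) (hne : ∀ r, g r ≠ optMatching C i j r) (m : Fin 6) :
    ∃ n, (exchangeMap (optMatching C i j) g)^[n] m = i ∨
      (exchangeMap (optMatching C i j) g)^[n] m = j := by
  obtain ⟨n, hn⟩ := exists_iterate_notMem_range (hC.avoids hij).inj hne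
    (hC.exchange_unique hij hg) m
  exact ⟨n, (hC.avoids hij).eq_or_eq hij hn⟩

/-- Exchanging an optimal matching along a path of tight alternatives. -/
theorem GenericMatrix.exists_augment (hC : GenericMatrix C) (hij : i ≠ j) {g : Fin 4 → Fin 6}
    (hg : ∀ r, Tight C a r (g r)) (hne : ∀ r, g r ≠ optMatching C i j r) (r₀ : Fin 4) :
    ∃ k l, (k = i ∧ l = j ∨ k = j ∧ l = i) ∧
      (∃ n, k = (exchangeMap (optMatching C i j) g)^[n] (g r₀)) ∧
      ∃ τ, Avoids (optMatching C i j r₀) l τ ∧ τ r₀ = g r₀ ∧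
        ∀ r, τ r = optMatching C i j r ∨ τ r = g r := by
  have hav := hC.avoids hij
  obtain ⟨n, hn⟩ := exists_iterate_notMem_range hav.inj hne (hC.exchange_unique hij hg) (g r₀)
  obtain ⟨τ, k, hk, hkn, hinj, hor, h0, hne0, hr⟩ := exists_pathExchange hav.inj hne r₀ hn
  rcases hav.eq_or_eq hij hk with rfl | rfl
  · refine ⟨k, j, Or.inl ⟨rfl, rfl⟩, hkn, τ, ⟨hinj, hne0, fun r h => ?_⟩, h0, hor⟩
    rcases hr r with ⟨s, hs⟩ | hs
    · exact hav.right s (hs.trans h)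
    · exact hij (hs.symm.trans h)
  · refine ⟨k, i, Or.inr ⟨rfl, rfl⟩, hkn, τ, ⟨hinj, hne0, fun r h => ?_⟩, h0, hor⟩
    rcases hr r with ⟨s, hs⟩ | hs
    · exact hav.left s (hs.trans h)
    · exact hij (h.symm.trans hs)

/-- The points of the pencil satisfy the circuit equations of the tropical line with the given
Plücker coordinates. -/
theorem GenericMatrix.circuit (hC : GenericMatrix C) (ha : InPencil C a) {i j k : Fin 6}
    (hij : i ≠ j) (hki : k ≠ i) (hkj : k ≠ j) :
    shiftedPlucker C a k i ≤ shiftedPlucker C a i j ∨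
      shiftedPlucker C a k j ≤ shiftedPlucker C a i j := by
  obtain ⟨r₀, hr₀⟩ := (hC.avoids hij).mem_range hij hki hkj
  choose g hne hg using fun r => ha.exists_tight r (optMatching C i j r)
  obtain ⟨k', l, hkl, -, τ, hτ, -, hor⟩ := hC.exists_augment hij hg hne r₀
  have h := sum_le_of_tight hg hor
  rw [sum_opt hC hij] at h
  rw [hr₀] at hτ
  rcases hkl with ⟨-, rfl⟩ | ⟨-, rfl⟩
  · right; linarith [hτ.shiftedPlucker_le (a := a) hC hkj]
  · left; linarith [hτ.shiftedPlucker_le (a := a) hC hki]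

/-- Where the translated Plücker coordinates are minimal, the optimal matching is tight. -/
theorem GenericMatrix.tight_opt (hC : GenericMatrix C) (ha : InPencil C a) (hij : i ≠ j)
    (hmin : ∀ k l, k ≠ l → shiftedPlucker C a i j ≤ shiftedPlucker C a k l) (r₀ : Fin 4) :
    Tight C a r₀ (optMatching C i j r₀) := by
  choose g hne hg using fun r => ha.exists_tight r (optMatching C i j r)
  obtain ⟨k, l, hkl, -, τ, hτ, h0, hor⟩ := hC.exists_augment hij hg hne r₀
  have hl : optMatching C i j r₀ ≠ l := by
    rcases hkl with ⟨-, rfl⟩ | ⟨-, rfl⟩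
    · exact (hC.avoids hij).right r₀
    · exact (hC.avoids hij).left r₀
  by_contra hnt
  have hlt : ∑ r, (a (τ r) + C r (τ r)) <
      ∑ r, (a (optMatching C i j r) + C r (optMatching C i j r)) := by
    apply Finset.sum_lt_sum
    · intro r _
      rcases hor r with h | h
      · rw [h]
      · rw [h]; exact hg r _
    · refine ⟨r₀, Finset.mem_univ _, ?_⟩
      rw [h0]
      refine lt_of_le_of_ne (hg r₀ _) fun he => hnt fun m' => ?_
      rw [← he]; exact hg r₀ m'
  rw [sum_opt hC hij] at hlt
  linarith [hτ.shiftedPlucker_le (a := a) hC hl, hmin _ _ hl]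

/-- There is at most one tight matching omitting two given columns. -/
theorem GenericMatrix.tight_unique (hC : GenericMatrix C) (hij : i ≠ j) (hσ : Avoids i j σ)
    (hτ : Avoids i j τ) (tσ : ∀ r, Tight C a r (σ r)) (tτ : ∀ r, Tight C a r (τ r)) : σ = τ := by
  have key : ∀ ρ, Avoids i j ρ → (∀ r, Tight C a r (ρ r)) → ρ = optMatching C i j := by
    intro ρ hρ tρ
    apply hC.eq_opt hij hρ
    have : ∑ r, (a (ρ r) + C r (ρ r)) ≤
        ∑ r, (a (optMatching C i j r) + C r (optMatching C i j r)) :=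
      Finset.sum_le_sum fun r _ => tρ r _
    rw [hρ.sum_add hij, sum_opt hC hij, shiftedPlucker] at this
    linarith
  rw [key σ hσ tσ, key τ hτ tτ]

/-- The columns of Plücker coordinates satisfy the row equations. -/
theorem GenericMatrix.exists_exchange_row (hC : GenericMatrix C) (r : Fin 4) {m j : Fin 6}
    (hmj : m ≠ j) : ∃ m', m' ≠ m ∧ m' ≠ j ∧
      C r m' + plucker C m' j ≤ C r m + plucker C m j := by
  have hav := hC.avoids hmj
  set σ := optMatching C m j with hσ
  refine ⟨σ r, hav.left r, hav.right r, ?_⟩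
  have hτ : Avoids (σ r) j (Function.update σ r m) := by
    refine ⟨?_, fun s => ?_, fun s => ?_⟩
    · intro s t h
      by_cases hs : s = r <;> by_cases ht : t = r
      · rw [hs, ht]
      · subst hs
        rw [Function.update_self, Function.update_of_ne ht] at h
        exact absurd h.symm (hav.left t)
      · subst ht
        rw [Function.update_self, Function.update_of_ne hs] at h
        exact absurd h (hav.left s)
      · rw [Function.update_of_ne hs, Function.update_of_ne ht] at h
        exact hav.inj h
    · by_cases hs : s = r
      · subst hs; rw [Function.update_self]; exact (hav.left s).symm
      · rw [Function.update_of_ne hs]; exact fun h => hs (hav.inj h)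
    · by_cases hs : s = r
      · subst hs; rw [Function.update_self]; exact hmj
      · rw [Function.update_of_ne hs]; exact hav.right s
  have h := hC.plucker_le (hav.right r) hτ
  have e : matchCost C (Function.update σ r m) = matchCost C σ - C r (σ r) + C r m := by
    unfold matchCost
    rw [← Finset.add_sum_erase _ _ (Finset.mem_univ r),
      ← Finset.add_sum_erase (a := r) (f := fun s => C s (σ s)) _ (Finset.mem_univ r),
      Function.update_self]
    have : ∑ x ∈ Finset.univ.erase r, C x (Function.update σ r m x) =
        ∑ x ∈ Finset.univ.erase r, C x (σ x) :=
      Finset.sum_congr rfl fun x hx => by rw [Function.update_of_ne (Finset.ne_of_mem_erase hx)]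
    rw [this]; ring
  rw [e] at h
  have : plucker C m j = matchCost C σ := rfl
  linarith

/-- The point `a` is the tropical combination of the `i`-th and the `j`-th column of Plücker
coordinates, the diagonal coordinates being infinite, with coefficients `l` and `μ`. -/
structure IsCombination (C : Fin 4 → Fin 6 → ℝ) (i j : Fin 6) (l μ : ℝ) (a : Fin 6 → ℝ) :
    Prop where
  le_left : ∀ m, m ≠ i → a m ≤ plucker C m i + l
  le_right : ∀ m, m ≠ j → a m ≤ plucker C m j + μ
  eq_or : ∀ m, (m ≠ i ∧ a m = plucker C m i + l) ∨ (m ≠ j ∧ a m = plucker C m j + μ)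

theorem IsCombination.exists_tight_left {l μ : ℝ} (h : IsCombination C i j l μ a)
    (hC : GenericMatrix C) {r : Fin 4} {m : Fin 6} (ht : Tight C a r m) (hm : m ≠ i)
    (he : a m = plucker C m i + l) :
    ∃ m', m' ≠ m ∧ m' ≠ i ∧ a m' = plucker C m' i + l ∧ Tight C a r m' := by
  obtain ⟨m', h1, h2, h3⟩ := hC.exists_exchange_row r hm
  have h4 := h.le_left m' h2
  have h5 := ht m'
  have h6 : a m' = plucker C m' i + l := by linarith
  exact ⟨m', h1, h2, h6, fun k => by linarith [ht k]⟩

theorem IsCombination.symm {l μ : ℝ} (h : IsCombination C i j l μ a) :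
    IsCombination C j i μ l a := ⟨h.le_right, h.le_left, fun m => (h.eq_or m).symm⟩

theorem IsCombination.inPencil {l μ : ℝ} (h : IsCombination C i j l μ a)
    (hC : GenericMatrix C) : InPencil C a := by
  rw [inPencil_iff]
  intro r m ht
  rcases h.eq_or m with ⟨hm, he⟩ | ⟨hm, he⟩
  · obtain ⟨m', h1, -, -, h4⟩ := h.exists_tight_left hC ht hm he
    exact ⟨m', h1, h4⟩
  · obtain ⟨m', h1, -, -, h4⟩ := h.symm.exists_tight_left hC ht hm he
    exact ⟨m', h1, h4⟩

open Classical in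
/-- The tropical combination of two columns of Plücker coordinates. -/
noncomputable def combination (C : Fin 4 → Fin 6 → ℝ) (i j : Fin 6) (s : ℝ) (m : Fin 6) : ℝ :=
  if m = i then plucker C m j + s else if m = j then plucker C m i
    else min (plucker C m i) (plucker C m j + s)

theorem isCombination_combination (hij : i ≠ j) (s : ℝ) :
    IsCombination C i j 0 s (combination C i j s) := by
  refine ⟨fun m hm => ?_, fun m hm => ?_, fun m => ?_⟩
  · unfold combination
    rw [if_neg hm]; split_ifs <;> simp
  · unfold combination
    rw [if_neg hm]; split_ifs <;> simp
  · unfold combination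
    split_ifs with h1 h2
    · subst h1; right; exact ⟨hij, rfl⟩
    · subst h2; left; exact ⟨h1, by simp⟩
    · rcases min_choice (plucker C m i) (plucker C m j + s) with h | h
      · left; exact ⟨h1, by rw [h]; simp⟩
      · right; exact ⟨h2, h⟩

theorem combination_left (s : ℝ) : combination C i j s i = plucker C i j + s := by
  simp [combination]

theorem combination_right (hij : i ≠ j) (s : ℝ) : combination C i j s j = plucker C j i := by
  simp [combination, hij.symm]

theorem combination_of_ne (s : ℝ) {m : Fin 6} (hi : m ≠ i) (hj : m ≠ j) :
    combination C i j s m = min (plucker C m i) (plucker C m j + s) := by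
  simp [combination, hi, hj]

/-- The three-term tropical Plücker relation, in the form of an inequality. -/
theorem GenericMatrix.three_term (hC : GenericMatrix C) {i j k l : Fin 6} (hij : i ≠ j)
    (hik : i ≠ k) (hil : i ≠ l) (hjk : j ≠ k) (hjl : j ≠ l) (hkl : k ≠ l) :
    plucker C i k + plucker C j l ≤ plucker C i j + plucker C k l ∨
      plucker C j k + plucker C i l ≤ plucker C i j + plucker C k l := by
  -- a large coefficient moves the combination onto the column of `l`
  set s : ℝ := |plucker C j l - plucker C j i| + |plucker C k l - plucker C k i| with hs
  have h1 := le_abs_self (plucker C j l - plucker C j i)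
  have h2 := le_abs_self (plucker C k l - plucker C k i)
  have h3 := abs_nonneg (plucker C j l - plucker C j i)
  have h4 := abs_nonneg (plucker C k l - plucker C k i)
  have e1 : combination C l i s i = plucker C i l := combination_right hil.symm s
  have e2 : combination C l i s j = plucker C j l := by
    rw [combination_of_ne s hjl hij.symm]
    exact min_eq_left (by linarith)
  have e3 : combination C l i s k = plucker C k l := by
    rw [combination_of_ne s hkl hik.symm]
    exact min_eq_left (by linarith)
  have := hC.circuit ((isCombination_combination (C := C) hil.symm s).inPencil hC) hij
    hik.symm hjk.symm
  simp only [shiftedPlucker, e1, e2, e3] at this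
  rw [hC.plucker_comm hik, hC.plucker_comm hjk]
  rcases this with h | h
  · left; linarith
  · right; linarith

end Matchings

/-! ### Trivalence: a quadruple of columns is never degenerate -/

/-- The three-term Grassmann–Plücker relation for `4 × 4` determinants with two common rows. -/
theorem three_term_det {R : Type*} [CommRing R] (e f u v w z : Fin 4 → R) :
    Matrix.det (Matrix.of ![u, v, e, f]) * Matrix.det (Matrix.of ![w, z, e, f]) -
      Matrix.det (Matrix.of ![u, w, e, f]) * Matrix.det (Matrix.of ![v, z, e, f]) +
      Matrix.det (Matrix.of ![u, z, e, f]) * Matrix.det (Matrix.of ![v, w, e, f]) = 0 := by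
  simp [Matrix.det_succ_row_zero, Fin.sum_univ_succ, Fin.succAbove, Matrix.submatrix]
  ring

open Classical in
/-- The column `m` of the indicator matrix of the tight entries, with coefficients mod 2. -/
noncomputable def tightColumn (C : Fin 4 → Fin 6 → ℝ) (a : Fin 6 → ℝ) (m : Fin 6) :
    Fin 4 → ZMod 2 := fun r => if Tight C a r m then 1 else 0

section Trivalent

variable {C : Fin 4 → Fin 6 → ℝ} {a : Fin 6 → ℝ}

/-- A maximal minor of the tight indicator matrix counts tight matchings mod 2, and there is at
most one of these. -/
theorem GenericMatrix.det_tightColumn (hC : GenericMatrix C) (ha : InPencil C a) {i j : Fin 6}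
    (hij : i ≠ j) (hmin : ∀ k l, k ≠ l → shiftedPlucker C a i j ≤ shiftedPlucker C a k l)
    (c : Fin 4 → Fin 6) (hc : Avoids i j c) :
    Matrix.det (Matrix.of fun s => tightColumn C a (c s)) = 1 := by
  classical
  have hav := hC.avoids hij
  have ht := hC.tight_opt ha hij hmin
  choose e he using fun r => hc.mem_range hij (hav.left r) (hav.right r)
  have einj : Function.Injective e := fun r s h => hav.inj (by rw [← he r, ← he s, h])
  let π : Equiv.Perm (Fin 4) := Equiv.ofBijective e (Finite.injective_iff_bijective.1 einj)
  rw [← Matrix.det_transpose, Matrix.det_apply', Finset.sum_eq_single π⁻¹]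
  · have h1 : ∏ s, (Matrix.of fun s => tightColumn C a (c s)).transpose (π⁻¹ s) s = 1 := by
      apply Finset.prod_eq_one
      intro s _
      have : c s = optMatching C i j (π⁻¹ s) := by
        rw [← he (π⁻¹ s)]
        exact congrArg c (π.apply_symm_apply s).symm
      simp only [Matrix.transpose_apply, Matrix.of_apply, tightColumn]
      rw [this, if_pos (ht _)]
    rw [h1, mul_one]
    rcases Int.units_eq_one_or (Equiv.Perm.sign π⁻¹) with h | h <;> rw [h] <;> decide
  · intro ρ _ hρ
    by_cases hall : ∀ s, Tight C a (ρ s) (c s)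
    · exfalso
      apply hρ
      have hav' : Avoids i j (fun r => c (ρ⁻¹ r)) :=
        ⟨hc.inj.comp (ρ⁻¹).injective, fun r => hc.left _, fun r => hc.right _⟩
      have := hC.tight_unique hij hav' hav (fun r => by
        have := hall (ρ⁻¹ r)
        rwa [show ρ (ρ⁻¹ r) = r from ρ.apply_symm_apply r] at this) ht
      have h2 : ρ⁻¹ = π := by
        ext1 r
        apply hc.inj
        exact (congrFun this r).trans (he r).symm
      rw [← h2, inv_inv]
    · push Not at hall
      obtain ⟨s, hs⟩ := hall
      rw [Finset.prod_eq_zero (Finset.mem_univ s), mul_zero]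
      simp [tightColumn, hs]
  · simp

/-- The three terms of a tropical Plücker relation are not all equal: otherwise six minors of the
tight indicator matrix at some point of the pencil would be odd, contradicting the classical
relation mod 2. -/
theorem GenericMatrix.not_all_equal (hC : GenericMatrix C) {i j k l : Fin 6} (hij : i ≠ j)
    (hik : i ≠ k) (hil : i ≠ l) (hjk : j ≠ k) (hjl : j ≠ l) (hkl : k ≠ l)
    (h1 : plucker C i j + plucker C k l = plucker C i k + plucker C j l)
    (h2 : plucker C i k + plucker C j l = plucker C i l + plucker C j k) : False := by
  set s := plucker C k i - plucker C k j with hs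
  set a := combination C i j s with ha
  have hcomb : IsCombination C i j 0 s a := isCombination_combination hij s
  have haX := hcomb.inPencil hC
  have c1 := hC.plucker_comm hij
  have c2 := hC.plucker_comm hik
  have c3 := hC.plucker_comm hil
  have c4 := hC.plucker_comm hjk
  have c5 := hC.plucker_comm hjl
  have c6 := hC.plucker_comm hkl
  have ai : a i = plucker C i j + s := combination_left s
  have aj : a j = plucker C j i := combination_right hij s
  have ak : a k = plucker C k i := by
    rw [ha, combination_of_ne s hik.symm hjk.symm]; exact min_eq_left (by linarith)
  have al : a l = plucker C l i := by
    rw [ha, combination_of_ne s hil.symm hjl.symm]; exact min_eq_left (by linarith)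
  set κ := shiftedPlucker C a i j with hκ
  have qi : ∀ m, m ≠ i → κ ≤ shiftedPlucker C a i m := by
    intro m hm
    have h := hcomb.le_left m hm
    have := hC.plucker_comm hm
    simp only [hκ, shiftedPlucker]
    linarith
  -- the value on `{i, j}` is minimal
  have hmin : ∀ m n, m ≠ n → κ ≤ shiftedPlucker C a m n := by
    intro m n hmn
    by_cases h : m = i
    · subst h; exact qi n hmn.symm
    by_cases h' : n = i
    · subst h'; rw [hC.shiftedPlucker_comm hmn]; exact qi m hmn
    rcases hC.circuit haX hmn (k := i) (Ne.symm h) (Ne.symm h') with hh | hh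
    · exact (qi m h).trans hh
    · exact (qi n h').trans hh
  have hminAll : ∀ m n, shiftedPlucker C a m n = κ → ∀ k' l', k' ≠ l' →
      shiftedPlucker C a m n ≤ shiftedPlucker C a k' l' := fun m n e k' l' h =>
    e.trans_le (hmin k' l' h)
  -- the two remaining columns
  obtain ⟨e, f, hef, hei, hej, hek, hel, hfi, hfj, hfk, hfl⟩ : ∃ e f : Fin 6, e ≠ f ∧ e ≠ i ∧
      e ≠ j ∧ e ≠ k ∧ e ≠ l ∧ f ≠ i ∧ f ≠ j ∧ f ≠ k ∧ f ≠ l := by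
    have hcard : 1 < (Finset.univ \ ({i, j, k, l} : Finset (Fin 6))).card := by
      rw [Finset.card_sdiff_of_subset (Finset.subset_univ _)]
      have := Finset.card_le_four (a := i) (b := j) (c := k) (d := l)
      simp only [Finset.card_univ, Fintype.card_fin]
      omega
    obtain ⟨e, he, f, hf, hef⟩ := Finset.one_lt_card.1 hcard
    simp at he hf
    exact ⟨e, f, hef, he.1, he.2.1, he.2.2.1, he.2.2.2, hf.1, hf.2.1, hf.2.2.1, hf.2.2.2⟩
  have key : ∀ m n p q : Fin 6, m ≠ n → m ≠ p → m ≠ q → n ≠ p → n ≠ q → p ≠ q →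
      e ≠ m → e ≠ n → e ≠ p → e ≠ q → f ≠ m → f ≠ n → f ≠ p → f ≠ q →
      shiftedPlucker C a m n = κ →
      Matrix.det (Matrix.of ![tightColumn C a p, tightColumn C a q, tightColumn C a e,
        tightColumn C a f]) = 1 := by
    intro m n p q hmn hmp hmq hnp hnq hpq em en ep eq fm fn fp fq hval
    have hav : Avoids m n ![p, q, e, f] := by
      refine ⟨?_, ?_, ?_⟩
      · intro x y hxy
        fin_cases x <;> fin_cases y <;> first
          | rfl
          | exact absurd hxy hpq | exact absurd hxy hpq.symm | exact absurd hxy ep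
          | exact absurd hxy ep.symm | exact absurd hxy eq | exact absurd hxy eq.symm
          | exact absurd hxy fp | exact absurd hxy fp.symm | exact absurd hxy fq
          | exact absurd hxy fq.symm | exact absurd hxy hef | exact absurd hxy hef.symm
      · intro r
        fin_cases r
        exacts [hmp.symm, hmq.symm, em, fm]
      · intro r
        fin_cases r
        exacts [hnp.symm, hnq.symm, en, fn]
    have := hC.det_tightColumn haX hmn (hminAll m n hval) _ hav
    rw [← this]
    congr 2
    ext s : 1
    fin_cases s <;> rfl
  have d1 := key i j k l hij hik hil hjk hjl hkl hei hej hek hel hfi hfj hfk hfl rfl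
  have d2 := key k l i j hkl hik.symm hjk.symm hil.symm hjl.symm hij hek hel hei hej hfk hfl hfi
    hfj (by simp only [hκ, shiftedPlucker]; linarith)
  have d3 := key i k j l hik hij hil hjk.symm hkl hjl hei hek hej hel hfi hfk hfj hfl
    (by simp only [hκ, shiftedPlucker]; linarith)
  have d4 := key j l i k hjl hij.symm hjk hil.symm hkl.symm hik hej hel hei hek hfj hfl hfi hfk
    (by simp only [hκ, shiftedPlucker]; linarith)
  have d5 := key i l j k hil hij hik hjl.symm hkl.symm hjk hei hel hej hek hfi hfl hfj hfk
    (by simp only [hκ, shiftedPlucker]; linarith)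
  have d6 := key j k i l hjk hij.symm hjl hik.symm hkl hil hej hek hei hel hfj hfk hfi hfl
    (by simp only [hκ, shiftedPlucker]; linarith)
  have := three_term_det (tightColumn C a e) (tightColumn C a f) (tightColumn C a i)
    (tightColumn C a j) (tightColumn C a k) (tightColumn C a l)
  rw [d1, d2, d3, d4, d5, d6] at this
  revert this
  decide

end Trivalent

/-! ### Planarity -/

/-- Whether exactly one of `u < w` and `u' < w` holds: the side of the chord `u u'` of the hexagon
on which `w` lies. -/
def side (u u' w : Fin 6) : Bool := decide (u < w) ^^ decide (u' < w)

theorem side_eq_comm {u u' b d : Fin 6} (h1 : u ≠ b) (h2 : u ≠ d) (h3 : u' ≠ b) (h4 : u' ≠ d) :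
    side u u' b = side u u' d ↔ side b d u = side b d u' := by
  unfold side
  rcases lt_or_gt_of_ne h1 with h1 | h1 <;> rcases lt_or_gt_of_ne h2 with h2 | h2 <;>
  rcases lt_or_gt_of_ne h3 with h3 | h3 <;> rcases lt_or_gt_of_ne h4 with h4 | h4 <;>
  simp [h1, h2, h3, h4, h1.not_gt, h2.not_gt, h3.not_gt, h4.not_gt]

/-- Twice the area of the triangle spanned by three exponent vectors, up to a common factor. -/
def exponentArea (u v w : Fin 6) : ℕ :=
  ((conicExponent u 0 : ℤ) *
      (conicExponent v 1 * conicExponent w 2 - conicExponent v 2 * conicExponent w 1) -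
    (conicExponent u 1 : ℤ) *
      (conicExponent v 0 * conicExponent w 2 - conicExponent v 2 * conicExponent w 0) +
    (conicExponent u 2 : ℤ) *
      (conicExponent v 0 * conicExponent w 1 - conicExponent v 1 * conicExponent w 0)).natAbs

set_option maxRecDepth 100000 in
/-- The exponents of the six monomials are in weakly convex position in the order
`x², xy, y², yz, z², xz`: crossing chords meet, and the areas are the barycentric coordinates of
the intersection point. -/
theorem exponent_relation : ∀ m₁ m₃ m₂ m₄ : Fin 6, m₁ ≠ m₂ → m₁ ≠ m₄ → m₃ ≠ m₂ → m₃ ≠ m₄ →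
    side m₁ m₃ m₂ ≠ side m₁ m₃ m₄ →
    0 < exponentArea m₁ m₃ m₄ + exponentArea m₁ m₃ m₂ ∧
    exponentArea m₃ m₂ m₄ + exponentArea m₁ m₂ m₄ =
      exponentArea m₁ m₃ m₄ + exponentArea m₁ m₃ m₂ ∧
    ∀ i, exponentArea m₃ m₂ m₄ * conicExponent m₁ i + exponentArea m₁ m₂ m₄ * conicExponent m₃ i =
      exponentArea m₁ m₃ m₄ * conicExponent m₂ i + exponentArea m₁ m₃ m₂ * conicExponent m₄ i := by
  decide +kernel

section Planar

variable {x : Fin 4 → Fin 3 → ℝ} {a : Fin 6 → ℝ}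

/-- If two monomials are tight at one point, two others at another point, and the corresponding
chords of the hexagon cross, then one of the latter is tight at the first point as well. -/
theorem tight_of_crossing {r s : Fin 4} {m₁ m₃ m₂ m₄ : Fin 6}
    (h1 : Tight (fun r m => conicMonomial (x r) m) a r m₁)
    (h3 : Tight (fun r m => conicMonomial (x r) m) a r m₃)
    (h2 : Tight (fun r m => conicMonomial (x r) m) a s m₂)
    (h4 : Tight (fun r m => conicMonomial (x r) m) a s m₄)
    (n12 : m₁ ≠ m₂) (n14 : m₁ ≠ m₄) (n32 : m₃ ≠ m₂) (n34 : m₃ ≠ m₄)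
    (hc : side m₁ m₃ m₂ ≠ side m₁ m₃ m₄) :
    Tight (fun r m => conicMonomial (x r) m) a r m₂ ∨
      Tight (fun r m => conicMonomial (x r) m) a r m₄ := by
  obtain ⟨hpos, hsum, hrel⟩ := exponent_relation m₁ m₃ m₂ m₄ n12 n14 n32 n34 hc
  set l₁ := exponentArea m₃ m₂ m₄
  set l₃ := exponentArea m₁ m₂ m₄
  set l₂ := exponentArea m₁ m₃ m₄
  set l₄ := exponentArea m₁ m₃ m₂
  have hmono : ∀ y : Fin 3 → ℝ, (l₁ : ℝ) * conicMonomial y m₁ + l₃ * conicMonomial y m₃ =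
      l₂ * conicMonomial y m₂ + l₄ * conicMonomial y m₄ := by
    intro y
    simp only [conicMonomial, Finset.mul_sum, ← Finset.sum_add_distrib]
    refine Finset.sum_congr rfl fun i _ => ?_
    have : ((l₁ * conicExponent m₁ i + l₃ * conicExponent m₃ i : ℕ) : ℝ) =
        ((l₂ * conicExponent m₂ i + l₄ * conicExponent m₄ i : ℕ) : ℝ) := by rw [hrel i]
    push_cast at this
    linear_combination y i * this
  have hsum' : (l₁ : ℝ) + l₃ = l₂ + l₄ := by exact_mod_cast hsum
  have p1 : (0 : ℝ) ≤ l₁ := Nat.cast_nonneg _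
  have p2 : (0 : ℝ) ≤ l₂ := Nat.cast_nonneg _
  have p3 : (0 : ℝ) ≤ l₃ := Nat.cast_nonneg _
  have p4 : (0 : ℝ) ≤ l₄ := Nat.cast_nonneg _
  have e13 := h1.eq h3
  have e24 := h2.eq h4
  set μ := a m₁ + conicMonomial (x r) m₁ with hμ
  set ν := a m₂ + conicMonomial (x s) m₂ with hν
  have A2 : μ ≤ a m₂ + conicMonomial (x r) m₂ := h1 m₂
  have A4 : μ ≤ a m₄ + conicMonomial (x r) m₄ := h1 m₄
  have B1 : ν ≤ a m₁ + conicMonomial (x s) m₁ := h2 m₁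
  have B3 : ν ≤ a m₃ + conicMonomial (x s) m₃ := h2 m₃
  have hr := hmono (x r)
  have hs := hmono (x s)
  -- both inequalities between the weighted coefficients hold, so they are equalities
  have F : (l₁ : ℝ) * a m₁ + l₃ * a m₃ = (l₁ + l₃) * μ - (l₁ * conicMonomial (x r) m₁ +
      l₃ * conicMonomial (x r) m₃) := by
    have : a m₃ = μ - conicMonomial (x r) m₃ := by linarith
    rw [this, hμ]; ring
  have G : (l₂ : ℝ) * a m₂ + l₄ * a m₄ = (l₂ + l₄) * ν - (l₂ * conicMonomial (x s) m₂ +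
      l₄ * conicMonomial (x s) m₄) := by
    have : a m₄ = ν - conicMonomial (x s) m₄ := by linarith
    rw [this, hν]; ring
  have H1 := mul_le_mul_of_nonneg_left B1 p1
  have H3 := mul_le_mul_of_nonneg_left B3 p3
  have hν' : ((l₁ : ℝ) + l₃) * ν = (l₂ + l₄) * ν := by rw [hsum']
  have hμ' : ((l₁ : ℝ) + l₃) * μ = (l₂ + l₄) * μ := by rw [hsum']
  have E : l₂ * (a m₂ + conicMonomial (x r) m₂ - μ) + l₄ * (a m₄ + conicMonomial (x r) m₄ - μ)
      ≤ 0 := by linarith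
  have E2 : 0 ≤ l₂ * (a m₂ + conicMonomial (x r) m₂ - μ) := mul_nonneg p2 (by linarith)
  have E4 : 0 ≤ l₄ * (a m₄ + conicMonomial (x r) m₄ - μ) := mul_nonneg p4 (by linarith)
  rcases Nat.eq_zero_or_pos l₂ with h0 | h0
  · right
    have h0' : 0 < (l₄ : ℝ) := by exact_mod_cast (by omega : 0 < l₄)
    have : a m₄ + conicMonomial (x r) m₄ - μ = 0 := by
      have : l₄ * (a m₄ + conicMonomial (x r) m₄ - μ) = 0 := by linarith
      rcases mul_eq_zero.1 this with h | h
      · exact absurd h h0'.ne'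
      · exact h
    intro m'
    have := h1 m'
    dsimp only at this ⊢
    linarith
  · left
    have h0' : 0 < (l₂ : ℝ) := by exact_mod_cast h0
    have : a m₂ + conicMonomial (x r) m₂ - μ = 0 := by
      have : l₂ * (a m₂ + conicMonomial (x r) m₂ - μ) = 0 := by linarith
      rcases mul_eq_zero.1 this with h | h
      · exact absurd h h0'.ne'
      · exact h
    intro m'
    have := h1 m'
    dsimp only at this ⊢
    linarith

/-- A point in the interior of an edge of the pencil induces a colouring of the monomials such
that no point of the configuration has a single tight monomial of some colour. Such a colouring is
noncrossing: the tight monomials of either colour form a tree of chords of the Newton polygon, and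
tight chords do not cross since they belong to a regular subdivision. -/
theorem noncrossing_of_colouring (hC : GenericMatrix fun r m => conicMonomial (x r) m)
    {col : Fin 6 → Bool}
    (hmono : ∀ r m, Tight (fun r m => conicMonomial (x r) m) a r m →
      ∃ m', m' ≠ m ∧ Tight (fun r m => conicMonomial (x r) m) a r m' ∧ col m' = col m)
    {u v w z : Fin 6} (huv : u < v) (hvw : v < w) (hwz : w < z)
    (huw : col u = col w) (hvz : col v = col z) (hne : col u ≠ col v) : False := by
  set C : Fin 4 → Fin 6 → ℝ := fun r m => conicMonomial (x r) m with hCdef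
  have ha : InPencil C a := by
    rw [inPencil_iff]
    intro r m ht
    obtain ⟨m', h1, h2, -⟩ := hmono r m ht
    exact ⟨m', h1, h2⟩
  obtain ⟨⟨i, j⟩, hmem, hmin⟩ := Finset.exists_min_image
    (Finset.univ.filter fun q : Fin 6 × Fin 6 => q.1 ≠ q.2)
    (fun q => shiftedPlucker C a q.1 q.2) ⟨(0, 1), by simp⟩
  have hij : i ≠ j := by simpa using hmem
  have hσt := hC.tight_opt ha hij fun k l hkl => hmin (k, l) (by simpa using hkl)
  have hav := hC.avoids hij
  choose g hgne hgt hgc using fun r => hmono r _ (hσt r)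
  set σ := optMatching C i j with hσ
  have hcol : ∀ n m, col ((exchangeMap σ g)^[n] m) = col m := by
    intro n
    induction n with
    | zero => intro m; rfl
    | succ n ih =>
      intro m
      rw [Function.iterate_succ_apply, ih]
      by_cases hm : m ∈ Set.range σ
      · obtain ⟨r, rfl⟩ := hm
        rw [exchangeMap_apply hav.inj, hgc]
      · rw [exchangeMap_of_notMem hm]
  -- the roots of the two trees have different colours
  have hcij : col i ≠ col j := by
    intro he
    obtain ⟨n, hn⟩ := hC.exists_exit hij hgt hgne u
    obtain ⟨n', hn'⟩ := hC.exists_exit hij hgt hgne v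
    have h1 := hcol n u
    have h2 := hcol n' v
    rcases hn with h | h <;> rcases hn' with h' | h' <;> rw [h] at h1 <;> rw [h'] at h2 <;>
      simp_all
  have hroot : ∀ k k' : Fin 6, (k = i ∨ k = j) → (k' = i ∨ k' = j) → col k = col k' → k = k' := by
    rintro k k' (rfl | rfl) (rfl | rfl) h
    · rfl
    · exact absurd h hcij
    · exact absurd h.symm hcij
    · rfl
  -- a row whose matched column has one colour has no two tight columns of the other colour
  have hnb : ∀ r b₁ b₂, b₁ ≠ b₂ → Tight C a r b₁ → Tight C a r b₂ → col b₁ ≠ col (σ r) →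
      col b₂ ≠ col (σ r) → False := by
    intro r b₁ b₂ hb t1 t2 c1 c2
    have aug : ∀ b, Tight C a r b → col b ≠ col (σ r) →
        ∃ k l, (k = i ∧ l = j ∨ k = j ∧ l = i) ∧ col k = col b ∧
          ∃ τ, Avoids (σ r) l τ ∧ τ r = b ∧ ∀ s, Tight C a s (τ s) := by
      intro b tb cb
      have hne' : ∀ s, Function.update g r b s ≠ σ s := by
        intro s
        by_cases hs : s = r
        · subst hs; rw [Function.update_self]; exact fun h => cb (h ▸ rfl)
        · rw [Function.update_of_ne hs]; exact hgne s
      have ht' : ∀ s, Tight C a s (Function.update g r b s) := by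
        intro s
        by_cases hs : s = r
        · subst hs; rw [Function.update_self]; exact tb
        · rw [Function.update_of_ne hs]; exact hgt s
      obtain ⟨k, l, hkl, ⟨n, hn⟩, τ, hτ, h0, hor⟩ := hC.exists_augment hij ht' hne' r
      refine ⟨k, l, hkl, ?_, τ, hτ, ?_, ?_⟩
      · rw [hn, Function.update_self]
        clear hn
        induction n with
        | zero => rfl
        | succ n ih =>
          rw [Function.iterate_succ_apply']
          set m := (exchangeMap (optMatching C i j) (Function.update g r b))^[n] b
          by_cases hm : m ∈ Set.range σ
          · obtain ⟨s, hs⟩ := hm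
            have hsr : s ≠ r := by
              rintro rfl
              exact cb (ih.symm.trans (hs ▸ rfl))
            rw [← hs, ← hσ, exchangeMap_apply hav.inj, Function.update_of_ne hsr, hgc, ← ih, ← hs]
          · rw [← hσ, exchangeMap_of_notMem hm, ih]
      · rw [h0, Function.update_self]
      · intro s
        rcases hor s with h | h
        · rw [h]; exact hσt s
        · rw [h]; exact ht' s
    obtain ⟨k₁, l₁, hk₁, hc₁, τ₁, hτ₁, e₁, s₁⟩ := aug b₁ t1 c1
    obtain ⟨k₂, l₂, hk₂, hc₂, τ₂, hτ₂, e₂, s₂⟩ := aug b₂ t2 c2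
    have hkk : k₁ = k₂ := hroot k₁ k₂ (by tauto) (by tauto) (by
      rw [hc₁, hc₂]
      revert c1 c2
      cases col b₁ <;> cases col b₂ <;> cases col (σ r) <;> simp)
    have hll : l₁ = l₂ := by
      rcases hk₁ with ⟨p, q⟩ | ⟨p, q⟩ <;> rcases hk₂ with ⟨p', q'⟩ | ⟨p', q'⟩
      · rw [q, q']
      · exact absurd (p.symm.trans (hkk.trans p')) hij
      · exact absurd (p'.symm.trans (hkk.symm.trans p)) hij
      · rw [q, q']
    subst hll
    have hl : σ r ≠ l₁ := by
      rcases hk₁ with ⟨-, rfl⟩ | ⟨-, rfl⟩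
      · exact hav.right r
      · exact hav.left r
    have := hC.tight_unique hl hτ₁ hτ₂ s₁ s₂
    exact hb (by rw [← e₁, ← e₂, this])
  -- hence chords of different colours do not cross
  have hcross : ∀ r s, col (σ r) ≠ col (σ s) →
      side (σ r) (g r) (σ s) = side (σ r) (g r) (g s) := by
    intro r s hrs
    by_contra hside
    have n12 : σ r ≠ σ s := fun h => hrs (h ▸ rfl)
    have n14 : σ r ≠ g s := fun h => hrs (by rw [h, hgc])
    have n32 : g r ≠ σ s := fun h => hrs (by rw [← h, hgc])
    have n34 : g r ≠ g s := fun h => hrs (by rw [← hgc r, ← hgc s, h])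
    have : ∃ b, Tight C a r b ∧ col b ≠ col (σ r) := by
      rcases tight_of_crossing (hσt r) (hgt r) (hσt s) (hgt s) n12 n14 n32 n34 hside with h | h
      · exact ⟨_, h, hrs.symm⟩
      · exact ⟨_, h, by rw [hgc]; exact hrs.symm⟩
    obtain ⟨b, tb, cb⟩ := this
    obtain ⟨b', hb', tb', cb'⟩ := hmono r b tb
    exact hnb r b b' hb'.symm tb tb' cb (cb' ▸ cb)
  have exit_eq : ∀ (P : Fin 6 → Bool) (c : Bool),
      (∀ s, col (σ s) = c → P (σ s) = P (g s)) →
      ∀ m m', col m = c → col m' = c → P m = P m' := by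
    intro P c hP
    have inv : ∀ n m, col m = c → P ((exchangeMap σ g)^[n] m) = P m := by
      intro n
      induction n with
      | zero => intro m _; rfl
      | succ n ih =>
        intro m hm
        rw [Function.iterate_succ_apply', ← ih m hm]
        have hc' := (hcol n m).trans hm
        set m' := (exchangeMap σ g)^[n] m
        by_cases hr : m' ∈ Set.range σ
        · obtain ⟨s, hs⟩ := hr
          rw [← hs, exchangeMap_apply hav.inj]
          exact (hP s (by rw [hs]; exact hc')).symm
        · rw [exchangeMap_of_notMem hr]
    intro m m' hm hm'
    obtain ⟨n, hn⟩ := hC.exists_exit hij hgt hgne m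
    obtain ⟨n', hn'⟩ := hC.exists_exit hij hgt hgne m'
    have := hroot _ _ hn hn' (by
      show col ((exchangeMap σ g)^[n] m) = col ((exchangeMap σ g)^[n'] m')
      rw [hcol, hcol, hm, hm'])
    rw [← inv n m hm, ← inv n' m' hm']
    exact congrArg P this
  have hvzside : ∀ r, col (σ r) = col u → side v z (σ r) = side v z (g r) := by
    intro r hr
    have n1 : σ r ≠ v := fun h => hne (by rw [← hr, h])
    have n2 : σ r ≠ z := fun h => hne (by rw [← hr, h, hvz])
    have n3 : g r ≠ v := fun h => hne (by rw [← hr, ← hgc, h])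
    have n4 : g r ≠ z := fun h => hne (by rw [← hr, ← hgc, h, hvz])
    rw [← side_eq_comm n1 n2 n3 n4]
    exact exit_eq (side (σ r) (g r)) (col v)
      (fun s hs => hcross r s (by rw [hr, hs]; exact hne)) v z rfl hvz.symm
  have := exit_eq (side v z) (col u) hvzside u w rfl huw.symm
  simp [side, huv.not_gt, (huv.trans (hvw.trans hwz)).not_gt, hvw, hwz.not_gt] at this

/-- The planar form of the tropical Plücker relations. -/
theorem plucker_quartet (hC : GenericMatrix fun r m => conicMonomial (x r) m) {i j k l : Fin 6}
    (hij : i < j) (hjk : j < k) (hkl : k < l) :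
    let p := plucker fun r m => conicMonomial (x r) m
    (p i k + p j l = p i l + p j k ∧ p i k + p j l < p i j + p k l) ∨
      (p i k + p j l = p i j + p k l ∧ p i k + p j l < p i l + p j k) := by
  intro p
  set C : Fin 4 → Fin 6 → ℝ := fun r m => conicMonomial (x r) m with hCdef
  have nij := hij.ne
  have njk := hjk.ne
  have nkl := hkl.ne
  have nik := (hij.trans hjk).ne
  have njl := (hjk.trans hkl).ne
  have nil := (hij.trans (hjk.trans hkl)).ne
  have c1 : p i j = p j i := hC.plucker_comm nij
  have c2 : p i k = p k i := hC.plucker_comm nik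
  have c3 : p i l = p l i := hC.plucker_comm nil
  have c4 : p j k = p k j := hC.plucker_comm njk
  have c5 : p j l = p l j := hC.plucker_comm njl
  have c6 : p k l = p l k := hC.plucker_comm nkl
  have t1 := hC.three_term nij nik nil njk njl nkl
  have t2 := hC.three_term nik nij nil njk.symm nkl njl
  have t3 := hC.three_term nil nij nik njl.symm nkl.symm njk
  have t4 := hC.not_all_equal nij nik nil njk njl nkl
  change p i k + p j l ≤ p i j + p k l ∨ p j k + p i l ≤ p i j + p k l at t1
  change p i j + p k l ≤ p i k + p j l ∨ p k j + p i l ≤ p i k + p j l at t2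
  change p i j + p l k ≤ p i l + p j k ∨ p l j + p i k ≤ p i l + p j k at t3
  change p i j + p k l = p i k + p j l → p i k + p j l = p i l + p j k → False at t4
  rw [← c4] at t2
  rw [← c6, ← c5] at t3
  by_cases hcr : p i j + p k l < p i k + p j l ∧ p i l + p j k < p i k + p j l
  · exfalso
    obtain ⟨hc1, hc2⟩ := hcr
    have he : p i j + p k l = p i l + p j k := by
      rcases t1 with h | h <;> rcases t3 with h' | h' <;> linarith
    -- a combination of the columns of `i` and `j` in the interior of the crossing edge
    obtain ⟨s, ⟨hs1, hs2⟩, hs3⟩ : ∃ s ∈ Set.Ioo (p l i - p l j) (p k i - p k j),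
        s ∉ Set.range fun m => p m i - p m j := by
      have hinf : (Set.Ioo (p l i - p l j) (p k i - p k j)).Infinite :=
        Set.Ioo_infinite (by linarith)
      exact hinf.exists_notMem_finite (Set.finite_range _)
    have hcomb := isCombination_combination (C := C) nij s
    set a := combination C i j s with ha
    -- the colour records by which of the two columns a coordinate is attained
    set col : Fin 6 → Bool := fun m => decide (m ≠ j ∧ a m = p m j + s) with hcoldef
    have hexcl : ∀ m, m ≠ i → m ≠ j → a m = p m i → a m = p m j + s → False :=
      fun m _ _ h1 h2 => hs3 ⟨m, by dsimp only; linarith⟩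
    have ak : a k = p k j + s := by
      rw [ha, combination_of_ne s nik.symm njk.symm]; exact min_eq_right (by linarith)
    have al : a l = p l i := by
      rw [ha, combination_of_ne s nil.symm njl.symm]; exact min_eq_left (by linarith)
    refine noncrossing_of_colouring (x := x) (a := a) (col := col) hC ?_ hij hjk hkl ?_ ?_ ?_
    · intro r m ht
      by_cases hm : m ≠ j ∧ a m = p m j + s
      · obtain ⟨m', h1, h2, h3, h4⟩ := hcomb.symm.exists_tight_left hC ht hm.1 hm.2
        refine ⟨m', h1, h4, ?_⟩
        rw [hcoldef]
        simp only [decide_eq_decide]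
        exact ⟨fun _ => hm, fun _ => ⟨h2, h3⟩⟩
      · rcases hcomb.eq_or m with h | h
        · obtain ⟨m', h1, h2, h3, h4⟩ := hcomb.exists_tight_left hC ht h.1 h.2
          refine ⟨m', h1, h4, ?_⟩
          rw [hcoldef]
          simp only [decide_eq_decide]
          refine ⟨fun h' => ?_, fun h' => absurd h' hm⟩
          rw [add_zero] at h3
          exact absurd h'.2 fun h'' => hexcl m' h2 h'.1 h3 h''
        · exact absurd h hm
    · have : a i = p i j + s := combination_left s
      simp [hcoldef, this, ak, nij, njk.symm]
    · have : ¬ (a l = p l j + s) := fun h => hexcl l nil.symm njl.symm al h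
      simp [hcoldef, this]
    · have : a i = p i j + s := combination_left s
      simp [hcoldef, this, nij]
  · rw [not_and_or, not_lt, not_lt] at hcr
    rcases lt_trichotomy (p i j + p k l) (p i l + p j k) with h | h | h
    · right
      rcases t1 with h1 | h1
      · rcases t2 with h2 | h2
        · exact ⟨by linarith, by linarith⟩
        · linarith
      · linarith
    · exfalso
      rcases lt_trichotomy (p i k + p j l) (p i j + p k l) with h1 | h1 | h1
      · rcases t2 with h2 | h2 <;> linarith
      · exact t4 h1.symm (h1.trans h)
      · rcases hcr with h2 | h2 <;> linarith
    · left
      rcases t3 with h1 | h1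
      · linarith
      · rcases t2 with h2 | h2
        · linarith
        · exact ⟨by linarith, by linarith⟩

end Planar

/-! ### The fourteen planar trees -/

/-- The bipartition `D` of the four internal vertices defined by an inner edge, in the two shapes of
a trivalent tree with six leaves: a star with centre `3`, or the path `0 – 1 – 2 – 3`. -/
def splitBit (star : Bool) (D : Fin 3) (v : Fin 4) : Bool :=
  if star then decide (v = D.castSucc)
  else ![![true, false, false, false], ![true, true, false, false], ![false, false, false, true]] D v

/-- Adjacency of internal vertices in the two shapes. -/
def innerAdj (star : Bool) (v w : Fin 4) : Bool :=
  if star then decide (v ≠ w ∧ (v = 3 ∨ w = 3)) else decide (v.val + 1 = w.val ∨ w.val + 1 = v.val)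

/-- Adjacency in the tree of the given shape in which the leaf `m` is attached to `par m`. -/
def nodeAdj (star : Bool) (par : Fin 6 → Fin 4) : Fin 6 ⊕ Fin 4 → Fin 6 ⊕ Fin 4 → Bool
  | Sum.inl _, Sum.inl _ => false
  | Sum.inl m, Sum.inr v => decide (par m = v)
  | Sum.inr v, Sum.inl m => decide (par m = v)
  | Sum.inr v, Sum.inr w => innerAdj star v w

/-- For each of the fourteen trivalent trees which are planar with respect to the cyclic order of
the leaves, the internal vertices to which the six leaves are attached. -/
def treePar : Fin 14 → Fin 6 → Fin 4 :=
  ![![0, 0, 1, 2, 3, 3],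
    ![3, 0, 0, 1, 2, 3],
    ![3, 3, 0, 0, 1, 2],
    ![2, 3, 3, 0, 0, 1],
    ![1, 2, 3, 3, 0, 0],
    ![0, 1, 2, 3, 3, 0],
    ![0, 0, 1, 3, 3, 2],
    ![2, 0, 0, 1, 3, 3],
    ![3, 2, 0, 0, 1, 3],
    ![0, 0, 2, 3, 3, 1],
    ![1, 0, 0, 2, 3, 3],
    ![3, 1, 0, 0, 2, 3],
    ![0, 0, 1, 1, 2, 2],
    ![2, 0, 0, 1, 1, 2]]

/-- The last two of the fourteen trees are stars. -/
def treeStar (t : Fin 14) : Bool := decide (12 ≤ t)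

/-- The side of an internal vertex with respect to the inner edge `D`. -/
def vBit (t : Fin 14) (D : Fin 3) (v : Fin 4) : Bool := splitBit (treeStar t) D v

/-- The side of a leaf with respect to the inner edge `D`. -/
def lBit (t : Fin 14) (D : Fin 3) (m : Fin 6) : Bool := vBit t D (treePar t m)

/-- Adjacency in the `t`-th planar tree. -/
def treeAdj (t : Fin 14) : Fin 6 ⊕ Fin 4 → Fin 6 ⊕ Fin 4 → Bool := nodeAdj (treeStar t) (treePar t)

/-- The leaves beyond `y`, as seen from the vertex `v` adjacent to `y`. -/
def leafSide (t : Fin 14) (v : Fin 4) : Fin 6 ⊕ Fin 4 → Fin 6 → Bool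
  | Sum.inl m₀, m => decide (m = m₀)
  | Sum.inr w, m => decide (∃ D, vBit t D v ≠ vBit t D w ∧ lBit t D m = vBit t D w)

/-- Two leaves lie beyond a common inner edge, as seen from the vertex `v`. -/
def sameArm (t : Fin 14) (v : Fin 4) (i j : Fin 6) : Bool :=
  decide (∃ D, lBit t D i = lBit t D j ∧ lBit t D i ≠ vBit t D v)

theorem nodeAdj_symm (star : Bool) (par : Fin 6 → Fin 4) (y z : Fin 6 ⊕ Fin 4)
    (h : nodeAdj star par y z = true) : nodeAdj star par z y = true := by
  rcases y with m | v <;> rcases z with m' | w <;> simp only [nodeAdj] at h ⊢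
  · exact h
  · exact h
  · exact h
  · revert star v w; decide

theorem nodeAdj_irrefl (star : Bool) (par : Fin 6 → Fin 4) (y : Fin 6 ⊕ Fin 4) :
    nodeAdj star par y y = false := by
  rcases y with m | v
  · rfl
  · simp only [nodeAdj]; revert star v; decide

/-- The `t`-th planar tree as a graph. -/
def treeGraph (t : Fin 14) : SimpleGraph (Fin 6 ⊕ Fin 4) where
  Adj y z := treeAdj t y z = true
  symm := ⟨fun _ _ h => nodeAdj_symm _ _ _ _ h⟩
  loopless := ⟨fun y h => by simp [treeAdj, nodeAdj_irrefl] at h⟩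

instance (t : Fin 14) : DecidableRel (treeGraph t).Adj :=
  fun y z => inferInstanceAs (Decidable (treeAdj t y z = true))

theorem treeGraph_degree : ∀ t, (∀ m, (treeGraph t).degree (Sum.inl m) = 1) ∧
    ∀ v, (treeGraph t).degree (Sum.inr v) = 3 := by
  decide +kernel

theorem treeGraph_inner_reach : ∀ t v, v = 3 ∨ treeAdj t (Sum.inr v) (Sum.inr 3) = true ∨
    (∃ u, treeAdj t (Sum.inr v) (Sum.inr u) = true ∧ treeAdj t (Sum.inr u) (Sum.inr 3) = true) ∨
    ∃ u w, treeAdj t (Sum.inr v) (Sum.inr u) = true ∧ treeAdj t (Sum.inr u) (Sum.inr w) = true ∧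
      treeAdj t (Sum.inr w) (Sum.inr 3) = true := by
  decide +kernel

theorem treeGraph_isTree (t : Fin 14) : (treeGraph t).IsTree := by
  rw [SimpleGraph.isTree_iff_connected_and_card]
  have adj : ∀ y z, treeAdj t y z = true → (treeGraph t).Reachable y z :=
    fun y z h => SimpleGraph.Adj.reachable h
  have hin : ∀ v, (treeGraph t).Reachable (Sum.inr v) (Sum.inr 3) := by
    intro v
    rcases treeGraph_inner_reach t v with rfl | h | ⟨u, h1, h2⟩ | ⟨u, w, h1, h2, h3⟩
    · exact SimpleGraph.Reachable.refl _
    · exact adj _ _ h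
    · exact (adj _ _ h1).trans (adj _ _ h2)
    · exact ((adj _ _ h1).trans (adj _ _ h2)).trans (adj _ _ h3)
  have hall : ∀ y, (treeGraph t).Reachable y (Sum.inr 3) := by
    rintro (m | v)
    · exact (adj (Sum.inl m) (Sum.inr (treePar t m)) (by simp [treeAdj, nodeAdj])).trans (hin _)
    · exact hin v
  constructor
  · rw [SimpleGraph.connected_iff]
    exact ⟨fun y z => (hall y).trans (hall z).symm, ⟨Sum.inr 3⟩⟩
  · have h := (treeGraph t).sum_degrees_eq_twice_card_edges
    rw [Fintype.sum_sum_type] at h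
    simp only [(treeGraph_degree t).1, (treeGraph_degree t).2] at h
    rw [Nat.card_eq_fintype_card, ← SimpleGraph.edgeFinset_card]
    simp at h ⊢
    omega

/-- The `t`-th planar tree. -/
def planarTree (t : Fin 14) : PencilTree where
  graph := treeGraph t
  isTree := treeGraph_isTree t
  leaf_degree m := by
    rw [← (treeGraph_degree t).1 m, Set.ncard_eq_toFinset_card']; rfl
  internal_degree v := by
    rw [← (treeGraph_degree t).2 v, Set.ncard_eq_toFinset_card']; rfl

theorem exists_split_of_adj : ∀ t v w, treeAdj t (Sum.inr v) (Sum.inr w) = true →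
    ∃ D, vBit t D v ≠ vBit t D w ∧ ∀ D', D' ≠ D → vBit t D' v = vBit t D' w := by
  decide +kernel

theorem leafSide_balanced : ∀ t v m,
    ∑ y ∈ Finset.univ.filter (fun y => treeAdj t (Sum.inr v) y = true),
      (if leafSide t v y m then (1 : ℤ) else 0) = 1 := by
  decide +kernel

theorem exists_leafSide : ∀ t v y, treeAdj t (Sum.inr v) y = true →
    (∃ i, leafSide t v y i = true) ∧ ∃ j, leafSide t v y j = false := by
  decide +kernel

theorem leafSide_swap : ∀ t v w, treeAdj t (Sum.inr v) (Sum.inr w) = true →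
    ∀ m, leafSide t w (Sum.inr v) m = !leafSide t v (Sum.inr w) m := by
  decide +kernel

theorem sameArm_of_leafSide_ne : ∀ t v y, treeAdj t (Sum.inr v) y = true →
    ∀ i j, leafSide t v y i = true → leafSide t v y j = false → sameArm t v i j = false := by
  decide +kernel

theorem split_of_leafSide : ∀ t v w, treeAdj t (Sum.inr v) (Sum.inr w) = true →
    ∀ D, vBit t D v ≠ vBit t D w → ∀ i, leafSide t v (Sum.inr w) i = true ↔
      lBit t D i ≠ vBit t D v := by
  decide +kernel

/-- The arms of a vertex determine the vertex. -/
theorem vertex_eq_of_sameArm : ∀ t v w, (∀ i j, i ≠ j → (sameArm t v i j = sameArm t w i j)) →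
    v = w := by
  decide +kernel

/-- The sides of an edge are not the arms of a vertex. -/
theorem not_leafSide_eq_sameArm : ∀ t v y w, treeAdj t (Sum.inr v) y = true →
    ∃ i j, i ≠ j ∧ ¬ (leafSide t v y i ≠ leafSide t v y j ↔ sameArm t w i j = false) := by
  decide +kernel

/-- The sides of an edge determine the edge. -/
theorem edge_eq_of_leafSide : ∀ t v y v' y', treeAdj t (Sum.inr v) y = true →
    treeAdj t (Sum.inr v') y' = true → (∀ i j, i ≠ j → (leafSide t v y i ≠ leafSide t v y j ↔
      leafSide t v' y' i ≠ leafSide t v' y' j)) →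
    (Sum.inr v = (Sum.inr v' : Fin 6 ⊕ Fin 4) ∧ y = y') ∨ (Sum.inr v = y' ∧ y = Sum.inr v') := by
  decide +kernel

theorem exists_other_arms : ∀ t v m, ∃ j k, m ≠ j ∧ m ≠ k ∧ j ≠ k ∧ sameArm t v m j = false ∧
    sameArm t v m k = false ∧ sameArm t v j k = false := by
  decide +kernel

theorem exists_third_arm : ∀ t v m j, m ≠ j → sameArm t v m j = false →
    ∃ y, treeAdj t (Sum.inr v) y = true ∧ ∀ i, leafSide t v y i = false →
      (m = i ∨ sameArm t v m i = true) ∨ (j = i ∨ sameArm t v j i = true) := by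
  decide +kernel

theorem sameArm_comm : ∀ t v i j, sameArm t v i j = sameArm t v j i := by
  decide +kernel

theorem sameArm_trans_false : ∀ t v i j k, sameArm t v i j = false → i ≠ j →
    (i = k ∨ sameArm t v i k = true) → (j ≠ k ∧ sameArm t v j k = false) := by
  decide +kernel

/-- In a tree there is an edge whose two ends point at each other, for every choice of an inner
edge at each vertex. -/
theorem exists_mutual : ∀ (star : Bool) (w : Fin 4 → Fin 4), (∀ v, innerAdj star v (w v) = true) →
    ∃ v, w (w v) = v := by
  decide +kernel

/-! ### Tropical projective space in homogeneous coordinates -/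

section TropProj

variable {n : ℕ}

theorem TropProj.mk_eq_mkQ (x : Fin (n + 1) → ℝ) :
    TropProj.mk x = (Submodule.span ℝ {(1 : Fin (n + 1) → ℝ)}).mkQ x := rfl

theorem TropProj.mk_surjective (a : TropProj n) : ∃ x, TropProj.mk x = a :=
  Submodule.Quotient.mk_surjective _ a

theorem TropProj.mk_eq_mk {x y : Fin (n + 1) → ℝ} :
    TropProj.mk x = TropProj.mk y ↔ ∃ c : ℝ, ∀ m, x m = y m + c := by
  unfold TropProj.mk
  rw [Submodule.Quotient.eq, Submodule.mem_span_singleton]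
  constructor
  · rintro ⟨c, hc⟩
    refine ⟨c, fun m => ?_⟩
    have := congrFun hc m
    simp at this
    linarith
  · rintro ⟨c, hc⟩
    refine ⟨c, ?_⟩
    ext m
    simp [hc m]

theorem TropProj.mk_add (x y : Fin (n + 1) → ℝ) :
    TropProj.mk (x + y) = TropProj.mk x + TropProj.mk y := rfl

theorem TropProj.mk_smul (c : ℝ) (x : Fin (n + 1) → ℝ) :
    TropProj.mk (c • x) = c • TropProj.mk x := rfl

theorem TropProj.mk_sum {ι : Type*} (s : Finset ι) (x : ι → Fin (n + 1) → ℝ) :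
    TropProj.mk (∑ i ∈ s, x i) = ∑ i ∈ s, TropProj.mk (x i) := by
  simp only [TropProj.mk_eq_mkQ, map_sum]

end TropProj

theorem minAttainedTwice_add_const {ι : Type*} {f g : ι → ℝ} (c : ℝ) (h : ∀ i, g i = f i + c)
    (hf : MinAttainedTwice f) : MinAttainedTwice g := by
  obtain ⟨i, j, hij, he, hmin⟩ := hf
  exact ⟨i, j, hij, by rw [h, h, he], fun k => by rw [h, h]; linarith [hmin k]⟩

theorem conicExponent_sum : ∀ m, ∑ i, conicExponent m i = 2 := by decide

theorem conicMonomial_add_const (x : Fin 3 → ℝ) (c : ℝ) (m : Fin 6) :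
    conicMonomial (fun i => x i + c) m = conicMonomial x m + 2 * c := by
  have h : ((∑ i, conicExponent m i : ℕ) : ℝ) = 2 := by rw [conicExponent_sum]; norm_num
  push_cast at h
  simp only [conicMonomial, mul_add, Finset.sum_add_distrib, ← Finset.sum_mul, h]

theorem mk_mem_conicPencil {x : Fin 4 → Fin 3 → ℝ} {a : Fin 6 → ℝ} :
    TropProj.mk a ∈ conicPencil (fun i => TropProj.mk (x i)) ↔
      InPencil (fun r m => conicMonomial (x r) m) a := by
  refine forall_congr' fun r => ?_
  constructor
  · rintro ⟨c, y, hc, hy, h⟩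
    obtain ⟨s, hs⟩ := TropProj.mk_eq_mk.1 hc
    obtain ⟨u, hu⟩ := TropProj.mk_eq_mk.1 hy
    refine minAttainedTwice_add_const (-(s + 2 * u)) (fun m => ?_) h
    have : y = fun i => x r i + u := funext hu
    rw [hs m, this, conicMonomial_add_const]
    ring
  · intro h
    exact ⟨a, x r, rfl, rfl, h⟩

theorem conicPencil_eq (x : Fin 4 → Fin 3 → ℝ) :
    conicPencil (fun i => TropProj.mk (x i)) =
      {p | ∃ a, InPencil (fun r m => conicMonomial (x r) m) a ∧ p = TropProj.mk a} := by
  ext p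
  constructor
  · intro hp
    obtain ⟨a, rfl⟩ := TropProj.mk_surjective p
    exact ⟨a, mk_mem_conicPencil.1 hp, rfl⟩
  · rintro ⟨a, ha, rfl⟩
    exact mk_mem_conicPencil.2 ha

theorem exists_avoids_iff_perm {i j : Fin 6} (hij : i ≠ j) : ∃ I : Fin 4 ↪o Fin 6,
    ∀ σ : Fin 4 → Fin 6, Avoids i j σ ↔ ∃ π : Equiv.Perm (Fin 4), ∀ r, σ r = I (π r) := by
  have hcard : (Finset.univ \ ({i, j} : Finset (Fin 6))).card = 4 := by
    rw [Finset.card_sdiff_of_subset (Finset.subset_univ _), Finset.card_pair hij]; rfl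
  set S := Finset.univ \ ({i, j} : Finset (Fin 6)) with hS
  refine ⟨S.orderEmbOfFin hcard, fun σ => ⟨fun h => ?_, ?_⟩⟩
  · have : ∀ r, ∃ s, S.orderEmbOfFin hcard s = σ r := by
      intro r
      have hr : σ r ∈ Set.range (S.orderEmbOfFin hcard) := by
        rw [Finset.range_orderEmbOfFin]
        simp [hS, h.left r, h.right r]
      exact hr
    choose e he using this
    have einj : Function.Injective e := fun r s hrs => h.inj (by rw [← he r, ← he s, hrs])
    exact ⟨Equiv.ofBijective e (Finite.injective_iff_bijective.1 einj), fun r => (he r).symm⟩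
  · rintro ⟨π, hπ⟩
    have hmem : ∀ r, σ r ∈ S := fun r => by
      rw [hπ r]; exact Finset.orderEmbOfFin_mem _ _ _
    refine ⟨fun r s hrs => ?_, fun r h => ?_, fun r h => ?_⟩
    · rw [hπ, hπ] at hrs
      exact π.injective ((S.orderEmbOfFin hcard).injective hrs)
    · have := hmem r; rw [h] at this; simp [hS] at this
    · have := hmem r; rw [h] at this; simp [hS] at this

theorem exists_avoids_of_orderEmb (I : Fin 4 ↪o Fin 6) : ∃ i j, i ≠ j ∧
    ∀ π : Equiv.Perm (Fin 4), Avoids i j fun r => I (π r) := by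
  have hcard : (Finset.univ \ Finset.univ.map I.toEmbedding).card = 2 := by
    rw [Finset.card_sdiff_of_subset (Finset.subset_univ _), Finset.card_map]; rfl
  obtain ⟨i, j, hij, h⟩ := Finset.card_eq_two.1 hcard
  have hi : i ∈ Finset.univ \ Finset.univ.map I.toEmbedding := by rw [h]; simp
  have hj : j ∈ Finset.univ \ Finset.univ.map I.toEmbedding := by rw [h]; simp
  simp at hi hj
  exact ⟨i, j, hij, fun π => ⟨I.injective.comp π.injective, fun r => hi _, fun r => hj _⟩⟩

theorem not_minAttainedTwice_iff {ι : Type*} [Finite ι] [Nonempty ι] (f : ι → ℝ) :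
    ¬ MinAttainedTwice f ↔ ∃ i, ∀ j, j ≠ i → f i < f j := by
  constructor
  · intro h
    obtain ⟨i, hi⟩ := Finite.exists_min f
    refine ⟨i, fun j hj => lt_of_le_of_ne (hi j) fun he => h ⟨i, j, hj.symm, he, hi⟩⟩
  · rintro ⟨i, hi⟩ ⟨j, k, hjk, he, hmin⟩
    by_cases hj : j = i
    · subst hj
      exact absurd (hi k hjk.symm) (by rw [he]; exact lt_irrefl _)
    · exact absurd (hi j hj) (not_lt.2 (hmin i))

theorem genericMatrix_iff {C : Fin 4 → Fin 6 → ℝ} : GenericMatrix C ↔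
    ∀ I : Fin 4 ↪o Fin 6, ¬ TropicallySingular ((Matrix.of C).submatrix id I) := by
  constructor
  · intro hC I
    obtain ⟨i, j, hij, hav⟩ := exists_avoids_of_orderEmb I
    rintro ⟨π, ρ, hne, he, hmin⟩
    have key : ∀ π' : Equiv.Perm (Fin 4), ∑ r, ((Matrix.of C).submatrix id I) r (π' r) =
        matchCost C fun r => I (π' r) := fun _ => rfl
    simp only [key] at he hmin
    have hle : matchCost C (fun r => I (π r)) ≤ plucker C i j := by
      -- the optimal matching comes from a permutation
      have hopt := hC.avoids hij
      choose e he' using fun r => (hav 1).mem_range hij (hopt.left r) (hopt.right r)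
      have einj : Function.Injective e := fun r s h => hopt.inj (by rw [← he' r, ← he' s, h])
      have := hmin (Equiv.ofBijective e (Finite.injective_iff_bijective.1 einj))
      refine this.trans_eq ?_
      exact congrArg (matchCost C) (funext he')
    have h1 := hC.eq_opt hij (hav π) hle
    have h2 := hC.eq_opt hij (hav ρ) (he ▸ hle)
    apply hne
    ext1 r
    exact I.injective (congrFun (h1.trans h2.symm) r)
  · intro h i j hij
    obtain ⟨I, hI⟩ := exists_avoids_iff_perm hij
    obtain ⟨π, hπ⟩ := (not_minAttainedTwice_iff _).1 (h I)
    refine ⟨fun r => I (π r), (hI _).2 ⟨π, fun _ => rfl⟩, fun τ hτ hne => ?_⟩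
    obtain ⟨ρ, hρ⟩ := (hI τ).1 hτ
    obtain rfl : τ = fun r => I (ρ r) := funext hρ
    exact hπ ρ fun e => hne (by rw [e])

theorem genericMatrix_of_genericPoints {x : Fin 4 → Fin 3 → ℝ}
    (h : GenericPoints fun i => TropProj.mk (x i)) :
    GenericMatrix fun r m => conicMonomial (x r) m :=
  genericMatrix_iff.2 (h x fun _ => rfl)

theorem genericPoints_of_genericMatrix {x : Fin 4 → Fin 3 → ℝ}
    (h : GenericMatrix fun r m => conicMonomial (x r) m) :
    GenericPoints fun i => TropProj.mk (x i) := by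
  intro y hy I hsing
  choose c hc using fun i => TropProj.mk_eq_mk.1 (hy i)
  refine genericMatrix_iff.1 h I (minAttainedTwice_add_const (-∑ i, 2 * c i) (fun π => ?_) hsing)
  rw [← sub_eq_add_neg, ← Finset.sum_sub_distrib]
  refine Finset.sum_congr rfl fun r _ => ?_
  have : y r = fun i => x r i + c r := funext (hc r)
  simp only [conicMatrix, Matrix.submatrix_apply, Matrix.of_apply, id]
  rw [this, conicMonomial_add_const]
  ring

/-! ### The tropical line of a planar tree metric -/

/-- Homogeneous coordinates of the vertex `v` of the tropical line whose inner edges have lengths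
`2 * l D`, translated by `s`. -/
def vertexPos (t : Fin 14) (s : Fin 6 → ℝ) (l : Fin 3 → ℝ) (v : Fin 4) (m : Fin 6) : ℝ :=
  s m + ∑ D, if vBit t D v = lBit t D m then l D else 0

/-- Half of the length of the path between two vertices. -/
def halfDist (t : Fin 14) (l : Fin 3 → ℝ) (v w : Fin 4) : ℝ :=
  ∑ D, if vBit t D v = vBit t D w then 0 else l D

/-- Half of the length of the part shared by the paths from the vertex `v` to two leaves. -/
def armWeight (t : Fin 14) (l : Fin 3 → ℝ) (v : Fin 4) (i j : Fin 6) : ℝ :=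
  ∑ D, if lBit t D i = lBit t D j ∧ lBit t D i ≠ vBit t D v then l D else 0

/-- The Plücker coordinates of `C` are those of the tropical line with the tree `t`, with inner
edges of lengths `2 * l D`, translated by `s`. -/
structure HasTreeMetric (C : Fin 4 → Fin 6 → ℝ) (t : Fin 14) (s : Fin 6 → ℝ) (l : Fin 3 → ℝ) :
    Prop where
  pos : ∀ D, 0 < l D
  plucker_eq : ∀ i j, i ≠ j →
    plucker C i j = s i + s j + ∑ D, if lBit t D i = lBit t D j then l D else 0

/-- The homogeneous coordinates of the point at distance `x` from the vertex `v` on the edge from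
`v` to `y`. -/
def edgePoint (t : Fin 14) (s : Fin 6 → ℝ) (l : Fin 3 → ℝ) (v : Fin 4) (y : Fin 6 ⊕ Fin 4) (x : ℝ)
    (m : Fin 6) : ℝ :=
  vertexPos t s l v m + if leafSide t v y m then x else 0

section TreeLine

variable {C : Fin 4 → Fin 6 → ℝ} {t : Fin 14} {s : Fin 6 → ℝ} {l : Fin 3 → ℝ}

theorem armWeight_nonneg (hl : ∀ D, 0 < l D) (v : Fin 4) (i j : Fin 6) :
    0 ≤ armWeight t l v i j :=
  Finset.sum_nonneg fun D _ => by split_ifs <;> [exact (hl D).le; exact le_rfl]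

theorem armWeight_eq_zero (v : Fin 4) {i j : Fin 6} (h : sameArm t v i j = false) :
    armWeight t l v i j = 0 := by
  refine Finset.sum_eq_zero fun D _ => if_neg fun hD => ?_
  simp only [sameArm, decide_eq_false_iff_not] at h
  exact h ⟨D, hD⟩

theorem le_armWeight (hl : ∀ D, 0 < l D) {v : Fin 4} {i j : Fin 6} {D : Fin 3}
    (h : lBit t D i = lBit t D j ∧ lBit t D i ≠ vBit t D v) : l D ≤ armWeight t l v i j := by
  refine le_trans ?_ (Finset.single_le_sum (fun D _ => ?_) (Finset.mem_univ D))
  · rw [if_pos h]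
  · split_ifs <;> [exact (hl D).le; exact le_rfl]

theorem armWeight_pos (hl : ∀ D, 0 < l D) {v : Fin 4} {i j : Fin 6}
    (h : sameArm t v i j = true) : 0 < armWeight t l v i j := by
  simp only [sameArm, decide_eq_true_eq] at h
  obtain ⟨D, hD⟩ := h
  exact (hl D).trans_le (le_armWeight hl hD)

theorem armWeight_comm (v : Fin 4) (i j : Fin 6) : armWeight t l v i j = armWeight t l v j i := by
  refine Finset.sum_congr rfl fun D _ => if_congr ⟨?_, ?_⟩ rfl rfl
  · rintro ⟨h1, h2⟩; exact ⟨h1.symm, h1 ▸ h2⟩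
  · rintro ⟨h1, h2⟩; exact ⟨h1.symm, h1 ▸ h2⟩

theorem HasTreeMetric.shiftedPlucker_vertexPos (h : HasTreeMetric C t s l) (v : Fin 4)
    {i j : Fin 6} (hij : i ≠ j) :
    shiftedPlucker C (vertexPos t s l v) i j = 2 * armWeight t l v i j - ∑ D, l D := by
  rw [shiftedPlucker, h.plucker_eq i j hij, vertexPos, vertexPos, armWeight, Finset.mul_sum,
    ← Finset.sum_sub_distrib]
  have : ∀ D, (2 * if lBit t D i = lBit t D j ∧ lBit t D i ≠ vBit t D v then l D else 0) - l D =
      (if lBit t D i = lBit t D j then l D else 0) - (if vBit t D v = lBit t D i then l D else 0)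
        - (if vBit t D v = lBit t D j then l D else 0) := by
    intro D
    cases lBit t D i <;> cases lBit t D j <;> cases vBit t D v <;> simp <;> ring
  rw [Finset.sum_congr rfl fun D _ => this D, Finset.sum_sub_distrib, Finset.sum_sub_distrib]
  ring

theorem halfDist_of_split {v w : Fin 4} {D : Fin 3} (hD : vBit t D v ≠ vBit t D w)
    (h : ∀ D', D' ≠ D → vBit t D' v = vBit t D' w) : halfDist t l v w = l D := by
  unfold halfDist
  rw [Finset.sum_eq_single D (fun D' _ hD' => if_pos (h D' hD')) (by simp), if_neg hD]

theorem halfDist_pos (hl : ∀ D, 0 < l D) {v w : Fin 4}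
    (h : treeAdj t (Sum.inr v) (Sum.inr w) = true) : 0 < halfDist t l v w := by
  obtain ⟨D, hD, hD'⟩ := exists_split_of_adj t v w h
  rw [halfDist_of_split hD hD']
  exact hl D

theorem vertexPos_of_adj {v w : Fin 4} (h : treeAdj t (Sum.inr v) (Sum.inr w) = true)
    (m : Fin 6) : vertexPos t s l w m = vertexPos t s l v m +
      (if leafSide t v (Sum.inr w) m then 2 * halfDist t l v w else 0) - halfDist t l v w := by
  obtain ⟨D, hD, hD'⟩ := exists_split_of_adj t v w h
  rw [halfDist_of_split hD hD', vertexPos, vertexPos,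
    ← Finset.add_sum_erase _ _ (Finset.mem_univ D),
    ← Finset.add_sum_erase _ (fun D => if vBit t D v = lBit t D m then l D else 0)
      (Finset.mem_univ D)]
  have : ∑ D' ∈ Finset.univ.erase D, (if vBit t D' w = lBit t D' m then l D' else 0) =
      ∑ D' ∈ Finset.univ.erase D, if vBit t D' v = lBit t D' m then l D' else 0 :=
    Finset.sum_congr rfl fun D' hD'' => by rw [hD' D' (Finset.ne_of_mem_erase hD'')]
  rw [this]
  have hs := split_of_leafSide t v w h D hD m
  by_cases hm : leafSide t v (Sum.inr w) m = true
  · have h1 := hs.1 hm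
    have h2 : vBit t D w = lBit t D m := by
      revert h1 hD; cases lBit t D m <;> cases vBit t D v <;> cases vBit t D w <;> simp
    rw [if_pos hm, if_pos h2, if_neg (Ne.symm h1)]
    ring
  · have h1 : lBit t D m = vBit t D v := by
      by_contra hc; exact hm (hs.2 hc)
    have h2 : vBit t D w ≠ lBit t D m := by rw [h1]; exact hD.symm
    rw [if_neg hm, if_neg h2, if_pos h1.symm]
    ring

/-- Beyond an inner edge the common part of two paths contains the edge. -/
theorem halfDist_le_armWeight (hl : ∀ D, 0 < l D) {v w : Fin 4}
    (h : treeAdj t (Sum.inr v) (Sum.inr w) = true) {i j : Fin 6}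
    (hi : leafSide t v (Sum.inr w) i = true) (hj : leafSide t v (Sum.inr w) j = true) :
    halfDist t l v w ≤ armWeight t l v i j := by
  obtain ⟨D, hD, hD'⟩ := exists_split_of_adj t v w h
  rw [halfDist_of_split hD hD']
  have h1 := (split_of_leafSide t v w h D hD i).1 hi
  have h2 := (split_of_leafSide t v w h D hD j).1 hj
  apply le_armWeight hl
  refine ⟨?_, h1⟩
  revert h1 h2; cases lBit t D i <;> cases lBit t D j <;> cases vBit t D v <;> simp

theorem edgePoint_zero (v : Fin 4) (y : Fin 6 ⊕ Fin 4) :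
    edgePoint t s l v y 0 = vertexPos t s l v := by
  funext m; simp [edgePoint]

theorem HasTreeMetric.shiftedPlucker_edgePoint (h : HasTreeMetric C t s l) (v : Fin 4)
    (y : Fin 6 ⊕ Fin 4) (x : ℝ) {i j : Fin 6} (hij : i ≠ j) :
    shiftedPlucker C (edgePoint t s l v y x) i j = 2 * armWeight t l v i j - ∑ D, l D -
      (if leafSide t v y i then x else 0) - (if leafSide t v y j then x else 0) := by
  rw [← h.shiftedPlucker_vertexPos v hij]
  simp only [shiftedPlucker, edgePoint]
  ring

/-- A parameter `x` for which `edgePoint` is a point of the edge. -/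
def OnEdge (t : Fin 14) (l : Fin 3 → ℝ) (v : Fin 4) (y : Fin 6 ⊕ Fin 4) (x : ℝ) : Prop :=
  0 ≤ x ∧ ∀ w, y = Sum.inr w → x ≤ 2 * halfDist t l v w

theorem OnEdge.le_armWeight (hl : ∀ D, 0 < l D) {v : Fin 4} {y : Fin 6 ⊕ Fin 4} {x : ℝ}
    (hx : OnEdge t l v y x) (hy : treeAdj t (Sum.inr v) y = true) {i j : Fin 6} (hij : i ≠ j)
    (hi : leafSide t v y i = true) (hj : leafSide t v y j = true) :
    x ≤ 2 * armWeight t l v i j := by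
  rcases y with m | w
  · simp only [leafSide, decide_eq_true_eq] at hi hj
    exact absurd (hi.trans hj.symm) hij
  · linarith [hx.2 w rfl, halfDist_le_armWeight hl hy hi hj]

/-- Every point of an edge is a tropical combination of two columns of Plücker coordinates, namely
those of two leaves on different sides of the edge. -/
theorem HasTreeMetric.inPencil_edgePoint (h : HasTreeMetric C t s l) (hC : GenericMatrix C)
    {v : Fin 4} {y : Fin 6 ⊕ Fin 4} (hy : treeAdj t (Sum.inr v) y = true) {x : ℝ}
    (hx : OnEdge t l v y x) : InPencil C (edgePoint t s l v y x) := by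
  obtain ⟨⟨j, hj⟩, ⟨i, hi⟩⟩ := exists_leafSide t v y hy
  have key : ∀ m n, m ≠ n → plucker C m n = vertexPos t s l v m + vertexPos t s l v n +
      2 * armWeight t l v m n - ∑ D, l D := by
    intro m n hmn
    have := h.shiftedPlucker_vertexPos v hmn
    simp only [shiftedPlucker] at this
    linarith
  have hcomb : IsCombination C j i (-vertexPos t s l v j + ∑ D, l D)
      (-vertexPos t s l v i + ∑ D, l D + x) (edgePoint t s l v y x) := by
    refine ⟨fun m hm => ?_, fun m hm => ?_, fun m => ?_⟩
    · rw [key m j hm, edgePoint]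
      split_ifs with hs
      · linarith [hx.le_armWeight h.pos hy hm hs hj]
      · linarith [armWeight_nonneg (t := t) h.pos v m j]
    · rw [key m i hm, edgePoint]
      have := armWeight_nonneg (t := t) h.pos v m i
      have := hx.1
      split_ifs <;> linarith
    · by_cases hs : leafSide t v y m = true
      · right
        have hmi : m ≠ i := by rintro rfl; rw [hs] at hi; exact Bool.noConfusion hi
        refine ⟨hmi, ?_⟩
        rw [key m i hmi, edgePoint, if_pos hs,
          armWeight_eq_zero v (sameArm_of_leafSide_ne t v y hy m i hs hi)]
        ring
      · left
        have hmj : m ≠ j := by rintro rfl; exact hs hj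
        refine ⟨hmj, ?_⟩
        rw [key m j hmj, edgePoint, if_neg hs, armWeight_comm,
          armWeight_eq_zero v (sameArm_of_leafSide_ne t v y hy j m hj (by simpa using hs))]
        ring
  exact hcomb.inPencil hC

/-- The pairs of leaves at which the translated Plücker coordinates are minimal. -/
def Separates (C : Fin 4 → Fin 6 → ℝ) (a : Fin 6 → ℝ) (i j : Fin 6) : Prop :=
  ∀ m n, m ≠ n → shiftedPlucker C a i j ≤ shiftedPlucker C a m n

theorem separates_congr {a b : Fin 6 → ℝ} (hab : TropProj.mk (n := 5) a = TropProj.mk b)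
    (i j : Fin 6) : Separates C a i j ↔ Separates C b i j := by
  obtain ⟨c, hc⟩ := TropProj.mk_eq_mk.1 hab
  have : ∀ m n, shiftedPlucker C a m n = shiftedPlucker C b m n - 2 * c := by
    intro m n
    simp only [shiftedPlucker, hc]
    ring
  simp only [Separates, this, sub_le_sub_iff_right]

theorem HasTreeMetric.separates_vertexPos (h : HasTreeMetric C t s l) (v : Fin 4) {i j : Fin 6}
    (hij : i ≠ j) : Separates C (vertexPos t s l v) i j ↔ sameArm t v i j = false := by
  constructor
  · intro hs
    by_contra hc
    obtain ⟨j', -, hm, -, -, hs', -⟩ := exists_other_arms t v i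
    have := hs i j' hm
    rw [h.shiftedPlucker_vertexPos v hij, h.shiftedPlucker_vertexPos v hm,
      armWeight_eq_zero v hs'] at this
    linarith [armWeight_pos (t := t) (v := v) (i := i) (j := j) h.pos (by simpa using hc)]
  · intro hs m n hmn
    rw [h.shiftedPlucker_vertexPos v hij, h.shiftedPlucker_vertexPos v hmn,
      armWeight_eq_zero v hs]
    linarith [armWeight_nonneg (t := t) h.pos v m n]

/-- A parameter `x` for which `edgePoint` is an interior point of the edge. -/
def InsideEdge (t : Fin 14) (l : Fin 3 → ℝ) (v : Fin 4) (y : Fin 6 ⊕ Fin 4) (x : ℝ) : Prop :=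
  0 < x ∧ ∀ w, y = Sum.inr w → x < 2 * halfDist t l v w

theorem HasTreeMetric.separates_edgePoint (h : HasTreeMetric C t s l)
    {v : Fin 4} {y : Fin 6 ⊕ Fin 4} (hy : treeAdj t (Sum.inr v) y = true) {x : ℝ}
    (hx : InsideEdge t l v y x) {i j : Fin 6} (hij : i ≠ j) :
    Separates C (edgePoint t s l v y x) i j ↔ leafSide t v y i ≠ leafSide t v y j := by
  have hval : ∀ m n, m ≠ n → leafSide t v y m ≠ leafSide t v y n →
      shiftedPlucker C (edgePoint t s l v y x) m n = - ∑ D, l D - x := by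
    intro m n hmn hne
    rw [h.shiftedPlucker_edgePoint v y x hmn]
    by_cases hm : leafSide t v y m = true
    · have hn : leafSide t v y n = false := by
        revert hne; rw [hm]; cases leafSide t v y n <;> simp
      rw [armWeight_eq_zero v (sameArm_of_leafSide_ne t v y hy m n hm hn), hm, hn]
      simp
    · have hm' : leafSide t v y m = false := by simpa using hm
      have hn : leafSide t v y n = true := by
        revert hne; rw [hm']; cases leafSide t v y n <;> simp
      rw [armWeight_comm, armWeight_eq_zero v (sameArm_of_leafSide_ne t v y hy n m hn hm'), hm', hn]
      simp
  have hgt : ∀ m n, m ≠ n → leafSide t v y m = leafSide t v y n →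
      - ∑ D, l D - x < shiftedPlucker C (edgePoint t s l v y x) m n := by
    intro m n hmn he
    rw [h.shiftedPlucker_edgePoint v y x hmn, ← he]
    have h0 := hx.1
    split_ifs with hm
    · rw [hm] at he
      have : x < 2 * armWeight t l v m n := by
        rcases y with m₀ | w
        · simp only [leafSide, decide_eq_true_eq, true_eq_decide_iff] at hm he
          exact absurd (hm.trans he.symm) hmn
        · linarith [hx.2 w rfl, halfDist_le_armWeight h.pos hy hm he.symm]
      linarith
    · linarith [armWeight_nonneg (t := t) h.pos v m n]
  constructor
  · intro hs he
    obtain ⟨⟨m, hm⟩, ⟨n, hn⟩⟩ := exists_leafSide t v y hy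
    have hmn : m ≠ n := by rintro rfl; rw [hm] at hn; exact Bool.noConfusion hn
    have := hs m n hmn
    rw [hval m n hmn (by rw [hm, hn]; simp)] at this
    exact absurd this (not_le.2 (hgt i j hij he))
  · intro hne m n hmn
    rw [hval i j hij hne]
    by_cases he : leafSide t v y m = leafSide t v y n
    · exact (hgt m n hmn he).le
    · exact (hval m n hmn he).ge

/-- Seen from a vertex, every point of the pencil lies beyond one of the three edges. -/
theorem HasTreeMetric.exists_direction (h : HasTreeMetric C t s l) (hC : GenericMatrix C)
    {a : Fin 6 → ℝ} (ha : InPencil C a) (v : Fin 4) :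
    ∃ y, treeAdj t (Sum.inr v) y = true ∧ ∃ c, ∀ m, vertexPos t s l v m + c ≤ a m ∧
      (leafSide t v y m = false → a m = vertexPos t s l v m + c) := by
  set b : Fin 6 → ℝ := fun m => a m - vertexPos t s l v m with hb
  obtain ⟨m, hm⟩ := Finite.exists_min b
  have circ : ∀ i j k, i ≠ j → k ≠ i → k ≠ j →
      2 * armWeight t l v k i + b j ≤ 2 * armWeight t l v i j + b k ∨
        2 * armWeight t l v k j + b i ≤ 2 * armWeight t l v i j + b k := by
    intro i j k hij hki hkj
    have key : ∀ m n, m ≠ n → shiftedPlucker C a m n =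
        2 * armWeight t l v m n - ∑ D, l D - b m - b n := by
      intro m n hmn
      rw [← h.shiftedPlucker_vertexPos v hmn]
      simp only [shiftedPlucker, hb]
      ring
    have := hC.circuit ha hij hki hkj
    rw [key k i hki, key i j hij, key k j hkj] at this
    rcases this with h' | h'
    · left; linarith
    · right; linarith
  have nn := armWeight_nonneg (t := t) h.pos v
  -- the minimum of `b` is attained on a second arm
  obtain ⟨j, hmj, hmj', hbj⟩ : ∃ j, m ≠ j ∧ sameArm t v m j = false ∧ b j = b m := by
    obtain ⟨j, k, hmj, hmk, hjk, s1, s2, s3⟩ := exists_other_arms t v m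
    rcases circ j k m hjk hmj hmk with h' | h'
    · rw [armWeight_eq_zero v s3] at h'
      exact ⟨k, hmk, s2, le_antisymm (by linarith [nn m j]) (hm k)⟩
    · rw [armWeight_eq_zero v s3] at h'
      exact ⟨j, hmj, s1, le_antisymm (by linarith [nn m k]) (hm j)⟩
  -- on two arms where the minimum is attained, the coordinates are constant
  have harm : ∀ m₁ m₂, m₁ ≠ m₂ → sameArm t v m₁ m₂ = false → b m₁ = b m → b m₂ = b m →
      ∀ i, m₁ = i ∨ sameArm t v m₁ i = true → b i = b m := by
    intro m₁ m₂ hne hs e1 e2 i hi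
    rcases hi with rfl | hi
    · exact e1
    by_cases hi1 : i = m₁
    · rw [hi1, e1]
    obtain ⟨hn, hs'⟩ := sameArm_trans_false t v m₁ m₂ i hs hne (Or.inr hi)
    rw [sameArm_comm] at hs'
    refine le_antisymm ?_ (hm i)
    rcases circ i m₂ m₁ hn.symm (Ne.symm hi1) hne with h' | h'
    · rw [armWeight_eq_zero v hs'] at h'
      linarith [armWeight_pos (t := t) (v := v) h.pos hi]
    · rw [armWeight_eq_zero v hs', armWeight_eq_zero v hs] at h'
      linarith
  obtain ⟨y, hy, hy'⟩ := exists_third_arm t v m j hmj hmj'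
  refine ⟨y, hy, b m, fun i => ⟨by have := hm i; simp only [hb] at this ⊢; linarith,
    fun hi => ?_⟩⟩
  have : b i = b m := by
    rcases hy' i hi with h' | h'
    · exact harm m j hmj hmj' rfl hbj i h'
    · exact harm j m hmj.symm (by rw [sameArm_comm]; exact hmj') hbj rfl i h'
  rw [← this]
  simp only [hb]
  ring

/-- Every point of the pencil lies on an edge of the tree. -/
theorem HasTreeMetric.exists_edgePoint (h : HasTreeMetric C t s l) (hC : GenericMatrix C)
    {a : Fin 6 → ℝ} (ha : InPencil C a) :
    ∃ v y x, treeAdj t (Sum.inr v) y = true ∧ OnEdge t l v y x ∧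
      TropProj.mk (n := 5) a = TropProj.mk (edgePoint t s l v y x) := by
  choose y hy c hc using fun v => h.exists_direction hC ha v
  by_cases hleaf : ∃ v m, y v = Sum.inl m
  · obtain ⟨v, m, hm⟩ := hleaf
    refine ⟨v, y v, a m - vertexPos t s l v m - c v, hy v, ⟨?_, ?_⟩, ?_⟩
    · linarith [(hc v m).1]
    · rw [hm]; intro w hw; exact absurd hw (by simp)
    · refine TropProj.mk_eq_mk.2 ⟨c v, fun i => ?_⟩
      rw [edgePoint]
      split_ifs with hi
      · rw [hm] at hi
        simp only [leafSide, decide_eq_true_eq] at hi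
        rw [hi]; ring
      · rw [(hc v i).2 (by simpa using hi)]; ring
  · have : ∀ v, ∃ w, y v = Sum.inr w := by
      intro v
      rcases hv : y v with m | w
      · exact absurd ⟨v, m, hv⟩ hleaf
      · exact ⟨w, rfl⟩
    choose w hw using this
    -- two neighbouring vertices point at each other
    obtain ⟨v, hv⟩ := exists_mutual (treeStar t) w fun v => by
      have := hy v; rw [hw v] at this; exact this
    have hadj := hy v
    have hadj' := hy (w v)
    rw [hw] at hadj hadj'
    rw [hv] at hadj'
    have h1 := hc v
    have h2 := hc (w v)
    rw [hw] at h1 h2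
    rw [hv] at h2
    simp only [leafSide_swap t v (w v) hadj, Bool.not_eq_false'] at h2
    have hpos := vertexPos_of_adj (s := s) (l := l) hadj
    set d := halfDist t l v (w v) with hd
    obtain ⟨⟨i, hi⟩, ⟨j, hj⟩⟩ := exists_leafSide t v _ hadj
    have key : ∀ m, leafSide t v (Sum.inr (w v)) m = true →
        a m = vertexPos t s l v m + d + c (w v) := by
      intro m hm
      rw [(h2 m).2 hm, hpos m, if_pos hm]; ring
    refine ⟨v, Sum.inr (w v), d + c (w v) - c v, hadj, ⟨?_, ?_⟩, ?_⟩
    · have := (h1 i).1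
      rw [key i hi] at this
      linarith
    · intro w' hw'
      obtain rfl : w v = w' := Sum.inr_injective hw'
      have e1 := (h1 j).2 hj
      have e2 := (h2 j).1
      rw [hpos j, if_neg (by rw [hj]; simp)] at e2
      linarith
    · refine TropProj.mk_eq_mk.2 ⟨c v, fun m => ?_⟩
      rw [edgePoint]
      split_ifs with hm
      · rw [key m hm]; ring
      · rw [(h1 m).2 (by simpa using hm)]; ring

end TreeLine

section TreeLineType

variable {C : Fin 4 → Fin 6 → ℝ} {t : Fin 14} {s : Fin 6 → ℝ} {l : Fin 3 → ℝ}

theorem treePiece_comm (p : Fin 4 → TropProj 5) (y z : Fin 6 ⊕ Fin 4) :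
    treePiece p y z = treePiece p z y := by
  rcases y with m | v <;> rcases z with m' | w <;> simp only [treePiece]
  exact segment_symm ℝ _ _

theorem treePiece_inr_inl {s : Fin 6 → ℝ} (v : Fin 4) (m : Fin 6) :
    treePiece (fun v => TropProj.mk (vertexPos t s l v)) (Sum.inr v) (Sum.inl m) =
      {a | ∃ x, OnEdge t l v (Sum.inl m) x ∧
        a = TropProj.mk (edgePoint t s l v (Sum.inl m) x)} := by
  have key : ∀ x : ℝ, TropProj.mk (vertexPos t s l v) + x • TropProj.mk (n := 5) (Pi.single m 1) =
      TropProj.mk (edgePoint t s l v (Sum.inl m) x) := by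
    intro x
    rw [← TropProj.mk_smul, ← TropProj.mk_add]
    congr 1
    funext i
    simp [edgePoint, leafSide, Pi.single_apply]
  ext a
  constructor
  · rintro ⟨x, hx, rfl⟩
    exact ⟨x, ⟨hx, fun w hw => absurd hw (by simp)⟩, key x⟩
  · rintro ⟨x, hx, rfl⟩
    exact ⟨x, hx.1, (key x).symm⟩

theorem treePiece_inr_inr (hl : ∀ D, 0 < l D) {s : Fin 6 → ℝ} {v w : Fin 4}
    (h : treeAdj t (Sum.inr v) (Sum.inr w) = true) :
    treePiece (fun v => TropProj.mk (vertexPos t s l v)) (Sum.inr v) (Sum.inr w) =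
      {a | ∃ x, OnEdge t l v (Sum.inr w) x ∧
        a = TropProj.mk (edgePoint t s l v (Sum.inr w) x)} := by
  have hd := halfDist_pos (t := t) hl h
  set d := halfDist t l v w with hdd
  have key : ∀ α β : ℝ, α + β = 1 → α • TropProj.mk (vertexPos t s l v) +
      β • TropProj.mk (n := 5) (vertexPos t s l w) =
      TropProj.mk (edgePoint t s l v (Sum.inr w) (β * (2 * d))) := by
    intro α β hαβ
    rw [← TropProj.mk_smul, ← TropProj.mk_smul, ← TropProj.mk_add]
    refine TropProj.mk_eq_mk.2 ⟨-(β * d), fun m => ?_⟩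
    simp only [Pi.add_apply, Pi.smul_apply, smul_eq_mul, vertexPos_of_adj h m, ← hdd, edgePoint]
    obtain rfl : α = 1 - β := by linarith
    split_ifs <;> ring
  ext a
  constructor
  · rintro ⟨α, β, hα, hβ, hαβ, rfl⟩
    refine ⟨β * (2 * d), ⟨by positivity, fun w' hw' => ?_⟩, key α β hαβ⟩
    obtain rfl : w = w' := Sum.inr_injective hw'
    nlinarith
  · rintro ⟨x, hx, rfl⟩
    have hx2 := hx.2 w rfl
    rw [← hdd] at hx2
    refine ⟨1 - x / (2 * d), x / (2 * d), ?_, div_nonneg hx.1 (by linarith), by ring, ?_⟩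
    · rw [sub_nonneg, div_le_one (by linarith)]; exact hx2
    · rw [key _ _ (by ring), div_mul_cancel₀ _ (by linarith)]

theorem mem_treePiece_iff (hl : ∀ D, 0 < l D) {s : Fin 6 → ℝ} {v : Fin 4} {y : Fin 6 ⊕ Fin 4}
    (h : treeAdj t (Sum.inr v) y = true) {a : TropProj 5} :
    a ∈ treePiece (fun v => TropProj.mk (vertexPos t s l v)) (Sum.inr v) y ↔
      ∃ x, OnEdge t l v y x ∧ a = TropProj.mk (edgePoint t s l v y x) := by
  rcases y with m | w
  · rw [treePiece_inr_inl]; rfl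
  · rw [treePiece_inr_inr hl h]; rfl

theorem exists_inner_end (t : Fin 14) (p : Fin 4 → TropProj 5) {y z : Fin 6 ⊕ Fin 4}
    (h : treeAdj t y z = true) : ∃ v y', s(y, z) = s(Sum.inr v, y') ∧
      treeAdj t (Sum.inr v) y' = true ∧ treePiece p y z = treePiece p (Sum.inr v) y' := by
  rcases y with m | v
  · rcases z with m' | w
    · exact absurd h (by simp [treeAdj, nodeAdj])
    · exact ⟨w, Sum.inl m, Sym2.eq_swap, nodeAdj_symm _ _ _ _ h, treePiece_comm _ _ _⟩
  · exact ⟨v, z, rfl, h, rfl⟩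

/-- A point of an edge is a vertex or an interior point. -/
theorem vertex_or_inside (hl : ∀ D, 0 < l D) {v : Fin 4} {y : Fin 6 ⊕ Fin 4}
    (h : treeAdj t (Sum.inr v) y = true) {a : TropProj 5}
    (ha : a ∈ treePiece (fun v => TropProj.mk (vertexPos t s l v)) (Sum.inr v) y) :
    (∃ w, Sum.inr w ∈ s(Sum.inr v, y) ∧ a = TropProj.mk (vertexPos t s l w)) ∨
      ∃ x, InsideEdge t l v y x ∧ a = TropProj.mk (edgePoint t s l v y x) := by
  obtain ⟨x, hx, rfl⟩ := (mem_treePiece_iff hl h).1 ha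
  rcases hx.1.eq_or_lt with h0 | h0
  · left
    exact ⟨v, Sym2.mem_mk_left _ _, by rw [← h0, edgePoint_zero]⟩
  by_cases hw : ∃ w, y = Sum.inr w ∧ x = 2 * halfDist t l v w
  · left
    obtain ⟨w, rfl, hxw⟩ := hw
    refine ⟨w, Sym2.mem_mk_right _ _, TropProj.mk_eq_mk.2 ⟨halfDist t l v w, fun m => ?_⟩⟩
    rw [vertexPos_of_adj h, edgePoint, hxw]
    ring
  · right
    exact ⟨x, ⟨h0, fun w hyw => lt_of_le_of_ne (hx.2 w hyw) fun he => hw ⟨w, hyw, he⟩⟩, rfl⟩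

theorem HasTreeMetric.vertexPos_injective (h : HasTreeMetric C t s l) :
    Function.Injective fun v => TropProj.mk (n := 5) (vertexPos t s l v) := by
  intro v w hvw
  refine vertex_eq_of_sameArm t v w fun i j hij => ?_
  have := (h.separates_vertexPos v hij).symm.trans
    ((separates_congr (C := C) hvw i j).trans (h.separates_vertexPos w hij))
  revert this
  cases sameArm t v i j <;> cases sameArm t w i j <;> simp

/-- The pencil of a generic matrix whose Plücker coordinates form the metric of a planar tree is a
tropical line with this tree. -/
theorem HasTreeMetric.isTropicalLineOfType (h : HasTreeMetric C t s l) (hC : GenericMatrix C) :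
    IsTropicalLineOfType (planarTree t) {p | ∃ a, InPencil C a ∧ p = TropProj.mk a} := by
  have hl := h.pos
  refine ⟨fun v => TropProj.mk (vertexPos t s l v),
    fun v y m => if leafSide t v y m then 1 else 0, ?_, ?_, ?_, h.vertexPos_injective, ?_, ?_⟩
  · intro v m _
    funext i
    simp [leafSide, Pi.single_apply]
  · intro v w hvw
    refine ⟨?_, 2 * halfDist t l v w, by linarith [halfDist_pos (t := t) hl hvw], ?_⟩
    · intro d hd
      obtain ⟨⟨i, hi⟩, ⟨j, hj⟩⟩ := exists_leafSide t v _ hvw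
      have := hd i j
      simp only [hi, hj] at this
      exact isUnit_of_dvd_one (by simpa using this)
    · rw [← TropProj.mk_smul, ← TropProj.mk_add]
      refine TropProj.mk_eq_mk.2 ⟨-halfDist t l v w, fun m => ?_⟩
      rw [vertexPos_of_adj hvw]
      simp only [Pi.add_apply, Pi.smul_apply, smul_eq_mul]
      split_ifs <;> push_cast <;> ring
  · intro v
    rw [← TropProj.mk_sum]
    refine TropProj.mk_eq_mk.2 ⟨1, fun m => ?_⟩
    have hb : ((∑ y ∈ Finset.univ.filter (fun y => treeAdj t (Sum.inr v) y = true),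
        (if leafSide t v y m then (1 : ℤ) else 0) : ℤ) : ℝ) = 1 := by
      rw [leafSide_balanced t v m]; norm_num
    push_cast at hb
    rw [Finset.sum_apply, Pi.zero_apply, zero_add, ← hb]
    refine Finset.sum_congr ?_ fun y _ => by push_cast; rfl
    ext y
    simp only [Finset.mem_filter, Finset.mem_univ, true_and]
    rfl
  · intro y z y' z' hyz hyz' hne a ⟨ha, ha'⟩
    obtain ⟨v, e, he, hadj, hpiece⟩ :=
      exists_inner_end t (fun v => TropProj.mk (vertexPos t s l v)) hyz
    obtain ⟨v', e', he', hadj', hpiece'⟩ :=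
      exists_inner_end t (fun v => TropProj.mk (vertexPos t s l v)) hyz'
    rw [hpiece] at ha
    rw [hpiece'] at ha'
    rw [he, he'] at hne ⊢
    -- the minimal pairs of leaves tell the vertices and the open edges apart
    rcases vertex_or_inside hl hadj ha with ⟨w, hw, rfl⟩ | ⟨x, hx, rfl⟩
    · rcases vertex_or_inside hl hadj' ha' with ⟨w', hw', heq⟩ | ⟨x', hx', heq⟩
      · obtain rfl := h.vertexPos_injective heq
        exact ⟨w, hw, hw', rfl⟩
      · exfalso
        obtain ⟨i, j, hij, hn⟩ := not_leafSide_eq_sameArm t v' e' w hadj'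
        exact hn ((h.separates_edgePoint hadj' hx' hij).symm.trans
          ((separates_congr heq i j).symm.trans (h.separates_vertexPos w hij)))
    · rcases vertex_or_inside hl hadj' ha' with ⟨w', hw', heq⟩ | ⟨x', hx', heq⟩
      · exfalso
        obtain ⟨i, j, hij, hn⟩ := not_leafSide_eq_sameArm t v e w' hadj
        exact hn ((h.separates_edgePoint hadj hx hij).symm.trans
          ((separates_congr heq i j).trans (h.separates_vertexPos w' hij)))
      · exfalso
        apply hne
        rcases edge_eq_of_leafSide t v e v' e' hadj hadj' fun i j hij =>
          (h.separates_edgePoint hadj hx hij).symm.trans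
            ((separates_congr heq i j).trans (h.separates_edgePoint hadj' hx' hij)) with
          ⟨h1, h2⟩ | ⟨h1, h2⟩
        · rw [h1, h2]
        · rw [h1, h2, Sym2.eq_swap]
  · ext a
    constructor
    · rintro ⟨b, hb, rfl⟩
      obtain ⟨v, y, x, hadj, hx, he⟩ := h.exists_edgePoint hC hb
      exact ⟨Sum.inr v, y, hadj, (mem_treePiece_iff hl hadj).2 ⟨x, hx, he⟩⟩
    · rintro ⟨y, z, hyz, ha⟩
      obtain ⟨v, e, -, hadj, hpiece⟩ :=
        exists_inner_end t (fun v => TropProj.mk (vertexPos t s l v)) hyz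
      rw [hpiece] at ha
      obtain ⟨x, hx, rfl⟩ := (mem_treePiece_iff hl hadj).1 ha
      exact ⟨_, h.inPencil_edgePoint hC hadj hx, rfl⟩

end TreeLineType

/-! ### From planar Plücker relations to a planar tree -/

/-- The sides of the nine inner diagonals of the hexagon, which are the intervals not containing the
last leaf. -/
def diagBit (D : Fin 9) (m : Fin 6) : Bool :=
  decide ((![0, 1, 2, 3, 0, 1, 2, 0, 1] : Fin 9 → ℕ) D ≤ m.val ∧
    m.val < (![2, 3, 4, 5, 3, 4, 5, 4, 5] : Fin 9 → ℕ) D)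

/-- The three diagonals dual to the inner edges of the `t`-th planar tree. -/
def treeDiag : Fin 14 → Fin 3 → Fin 9 :=
  ![![0, 4, 7], ![1, 5, 8], ![2, 6, 0], ![3, 4, 1], ![7, 5, 2], ![8, 6, 3], ![0, 4, 3], ![1, 5, 7],
    ![2, 6, 8], ![0, 6, 3], ![1, 4, 7], ![2, 5, 8], ![0, 2, 7], ![1, 3, 8]]

/-- The weight of a diagonal in the decomposition of `p` into weighted splits. -/
noncomputable def diagWeight (p : Fin 6 → Fin 6 → ℝ) : Fin 9 → ℝ :=
  ![(p 0 1 + p 2 5 - p 0 2 - p 1 5) / 2,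
    (p 1 2 + p 0 3 - p 1 3 - p 0 2) / 2,
    (p 2 3 + p 1 4 - p 2 4 - p 1 3) / 2,
    (p 3 4 + p 2 5 - p 3 5 - p 2 4) / 2,
    (p 0 2 + p 3 5 - p 0 3 - p 2 5) / 2,
    (p 1 3 + p 0 4 - p 1 4 - p 0 3) / 2,
    (p 2 4 + p 1 5 - p 2 5 - p 1 4) / 2,
    (p 0 3 + p 4 5 - p 0 4 - p 3 5) / 2,
    (p 1 4 + p 0 5 - p 1 5 - p 0 4) / 2]

/-- The total weight of the diagonals which do not separate `i` and `j`. -/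
noncomputable def splitSum (w : Fin 9 → ℝ) (i j : Fin 6) : ℝ :=
  ∑ D, if diagBit D i = diagBit D j then w D else 0

theorem diagBit_injective_treeDiag : ∀ t, Function.Injective (treeDiag t) := by decide +kernel

theorem lBit_eq_iff_diagBit : ∀ t D i j,
    lBit t D i = lBit t D j ↔ diagBit (treeDiag t D) i = diagBit (treeDiag t D) j := by
  decide +kernel

theorem diagBit_noncrossing : ∀ D i j, i < j → ∀ k, j < k → ∀ l, k < l →
    ¬ (diagBit D i = diagBit D k ∧ diagBit D j = diagBit D l ∧ diagBit D i ≠ diagBit D j) := by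
  decide +kernel

/-- Some diagonal of the set `β` has `i, j` on one side and `k, l` on the other. -/
def diagSeparates (β : Fin 9 → Bool) (i j k l : Fin 6) : Bool :=
  decide (∃ D, β D = true ∧ diagBit D i = diagBit D j ∧ diagBit D k = diagBit D l ∧
    diagBit D i ≠ diagBit D k)

/-- A set of diagonals of the hexagon which resolves every quadruple of sides in exactly one way is
a triangulation. -/
theorem exists_treeDiag : ∀ β : Fin 9 → Bool,
    (∀ i j : Fin 6, i < j → ∀ k, j < k → ∀ l, k < l →
      diagSeparates β i j k l = !diagSeparates β i l j k) →
    ∃ t, ∀ D, β D = true ↔ ∃ D', treeDiag t D' = D := by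
  decide +kernel

/-- The decomposition of a function on pairs into weighted diagonals, up to translation. -/
theorem exists_split_decomposition {p : Fin 6 → Fin 6 → ℝ} (hp : ∀ i j, i ≠ j → p i j = p j i) :
    ∃ s : Fin 6 → ℝ, ∀ i j, i ≠ j → p i j = s i + s j + splitSum (diagWeight p) i j := by
  set R : Fin 6 → Fin 6 → ℝ := fun i j => p i j - splitSum (diagWeight p) i j with hR
  -- on three leaves the equations determine `s`
  obtain ⟨s, key⟩ : ∃ s : Fin 6 → ℝ, ∀ i j, i < j → R i j = s i + s j := by
    refine ⟨![(R 0 1 + R 0 2 - R 1 2) / 2, (R 0 1 + R 1 2 - R 0 2) / 2,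
      (R 0 2 + R 1 2 - R 0 1) / 2, (R 0 3 + R 1 3 - R 0 1) / 2, (R 0 4 + R 1 4 - R 0 1) / 2,
      (R 0 5 + R 1 5 - R 0 1) / 2], fun i j hij => ?_⟩
    fin_cases i <;> fin_cases j <;> first
      | exact absurd hij (by decide)
      | (simp [hR, splitSum, Fin.sum_univ_succ, diagBit, diagWeight]
         ring)
  refine ⟨s, fun i j hij => sub_eq_iff_eq_add.1 ?_⟩
  rcases lt_or_gt_of_ne hij with h | h
  · exact key i j h
  · have hs : splitSum (diagWeight p) i j = splitSum (diagWeight p) j i :=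
      Finset.sum_congr rfl fun D _ => if_congr eq_comm rfl rfl
    rw [hp i j hij, hs, add_comm]
    exact key j i h

theorem splitSum_quartet (w : Fin 9 → ℝ) {i j k l : Fin 6} (hij : i < j) (hjk : j < k)
    (hkl : k < l) :
    splitSum w i j + splitSum w k l - splitSum w i k - splitSum w j l =
        2 * ∑ D, (if diagBit D i = diagBit D j ∧ diagBit D k = diagBit D l ∧
          diagBit D i ≠ diagBit D k then w D else 0) ∧
      splitSum w i l + splitSum w j k - splitSum w i k - splitSum w j l =
        2 * ∑ D, (if diagBit D i = diagBit D l ∧ diagBit D j = diagBit D k ∧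
          diagBit D i ≠ diagBit D j then w D else 0) := by
  simp only [splitSum, ← Finset.sum_add_distrib, ← Finset.sum_sub_distrib, Finset.mul_sum]
  constructor <;>
  · refine Finset.sum_congr rfl fun D _ => ?_
    have := diagBit_noncrossing D i j hij k hjk l hkl
    revert this
    cases diagBit D i <;> cases diagBit D j <;> cases diagBit D k <;> cases diagBit D l <;>
      simp <;> ring

/-- A function on pairs satisfying the planar tropical Plücker relations strictly is the metric of
a planar trivalent tree. -/
theorem exists_planar_metric {p : Fin 6 → Fin 6 → ℝ} (hp : ∀ i j, i ≠ j → p i j = p j i)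
    (hq : ∀ i j k l : Fin 6, i < j → j < k → k < l →
      (p i k + p j l = p i l + p j k ∧ p i k + p j l < p i j + p k l) ∨
      (p i k + p j l = p i j + p k l ∧ p i k + p j l < p i l + p j k)) :
    ∃ (t : Fin 14) (s : Fin 6 → ℝ) (l : Fin 3 → ℝ), (∀ D, 0 < l D) ∧ ∀ i j, i ≠ j →
      p i j = s i + s j + ∑ D, if lBit t D i = lBit t D j then l D else 0 := by
  obtain ⟨s, hs⟩ := exists_split_decomposition hp
  set w := diagWeight p with hw
  have hge : ∀ i j k l : Fin 6, i < j → j < k → k < l →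
      p i k + p j l ≤ p i l + p j k ∧ p i k + p j l ≤ p i j + p k l := by
    intro i j k l h1 h2 h3
    rcases hq i j k l h1 h2 h3 with ⟨h, h'⟩ | ⟨h, h'⟩
    · exact ⟨h.le, h'.le⟩
    · exact ⟨h'.le, h.le⟩
  have hnn : ∀ D, 0 ≤ w D := by
    have q1 := (hge 0 1 2 5 (by decide) (by decide) (by decide)).2
    have q2 := (hge 0 1 2 3 (by decide) (by decide) (by decide)).1
    have q3 := (hge 1 2 3 4 (by decide) (by decide) (by decide)).1
    have q4 := (hge 2 3 4 5 (by decide) (by decide) (by decide)).1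
    have q5 := (hge 0 2 3 5 (by decide) (by decide) (by decide)).2
    have q6 := (hge 0 1 3 4 (by decide) (by decide) (by decide)).1
    have q7 := (hge 1 2 4 5 (by decide) (by decide) (by decide)).1
    have q8 := (hge 0 3 4 5 (by decide) (by decide) (by decide)).2
    have q9 := (hge 0 1 4 5 (by decide) (by decide) (by decide)).1
    intro D
    fin_cases D <;> simp [hw, diagWeight] <;> linarith
  have hsum : ∀ P : Fin 9 → Prop, ∀ _ : DecidablePred P,
      (0 < ∑ D, if P D then w D else 0) ↔ ∃ D, decide (0 < w D) = true ∧ P D := by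
    intro P _
    rw [Finset.sum_pos_iff_of_nonneg fun D _ => by split_ifs <;> [exact hnn D; exact le_rfl]]
    constructor
    · rintro ⟨D, -, hD⟩
      by_cases hP : P D
      · rw [if_pos hP] at hD; exact ⟨D, by simpa using hD, hP⟩
      · rw [if_neg hP] at hD; exact absurd hD (lt_irrefl _)
    · rintro ⟨D, hD, hP⟩
      exact ⟨D, Finset.mem_univ _, by rw [if_pos hP]; simpa using hD⟩
  obtain ⟨t, ht⟩ := exists_treeDiag (fun D => decide (0 < w D)) (by
    intro i j h1 k h2 l h3
    suffices hiff : diagSeparates (fun D => decide (0 < w D)) i j k l = true ↔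
        ¬ diagSeparates (fun D => decide (0 < w D)) i l j k = true by
      revert hiff
      cases diagSeparates (fun D => decide (0 < w D)) i j k l <;>
        cases diagSeparates (fun D => decide (0 < w D)) i l j k <;> simp
    rw [diagSeparates, diagSeparates, decide_eq_true_iff, decide_eq_true_iff, ← hsum, ← hsum]
    obtain ⟨e1, e2⟩ := splitSum_quartet w h1 h2 h3
    have n1 := h1.ne
    have n2 := h2.ne
    have n3 := h3.ne
    have n4 := (h1.trans h2).ne
    have n5 := (h2.trans h3).ne
    have n6 := (h1.trans (h2.trans h3)).ne
    have := hq i j k l h1 h2 h3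
    rw [hs i j n1, hs k l n3, hs i k n4, hs j l n5, hs i l n6, hs j k n2] at this
    constructor
    · intro h
      rcases this with ⟨h', h''⟩ | ⟨h', h''⟩
      · linarith
      · linarith
    · intro h
      rcases this with ⟨h', h''⟩ | ⟨h', h''⟩
      · linarith
      · exact absurd (by linarith) h)
  refine ⟨t, s, fun D => w (treeDiag t D), fun D => by simpa using (ht _).2 ⟨D, rfl⟩,
    fun i j hij => ?_⟩
  rw [hs i j hij]
  congr 1
  simp only [lBit_eq_iff_diagBit]
  rw [splitSum, ← Finset.sum_image (g := treeDiag t)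
    (f := fun D => if diagBit D i = diagBit D j then w D else 0)
    (fun x _ y _ h => diagBit_injective_treeDiag t h)]
  refine (Finset.sum_subset (Finset.subset_univ _) fun D _ hD => ?_).symm
  have : ¬ 0 < w D := by
    intro h
    obtain ⟨D', hD'⟩ := (ht D).1 (by simpa using h)
    exact hD (Finset.mem_image.2 ⟨D', Finset.mem_univ _, hD'⟩)
  rw [le_antisymm (not_lt.1 this) (hnn D), ite_self]

/-- The pencil of conics through four generic points is a tropical line. -/
theorem exists_isTropicalLineOfType (P : Fin 4 → TropProj 2) (hP : GenericPoints P) :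
    ∃ t, IsTropicalLineOfType (planarTree t) (conicPencil P) := by
  choose x hx using fun i => TropProj.mk_surjective (P i)
  obtain rfl : P = fun i => TropProj.mk (x i) := funext fun i => (hx i).symm
  have hC := genericMatrix_of_genericPoints hP
  obtain ⟨t, s, l, hl, hpl⟩ := exists_planar_metric
    (p := plucker fun r m => conicMonomial (x r) m) (fun i j hij => hC.plucker_comm hij)
    fun i j k l h1 h2 h3 => plucker_quartet hC h1 h2 h3
  have hm : HasTreeMetric (fun r m => conicMonomial (x r) m) t s l := ⟨hl, hpl⟩
  refine ⟨t, ?_⟩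
  rw [conicPencil_eq]
  exact hm.isTropicalLineOfType hC

/-! ### Configurations realizing the fourteen planar trees -/

/-- Four points for each planar tree. -/
def samplePoints : Fin 14 → Fin 4 → Fin 3 → ℤ :=
  ![![![2, 0, 0], ![0, 0, 0], ![4, 4, 0], ![3, 2, 0]],
    ![![3, 2, 0], ![4, 4, 0], ![2, 0, 0], ![2, 4, 0]],
    ![![4, 3, 0], ![2, 2, 0], ![4, 0, 0], ![0, 1, 0]],
    ![![0, 2, 0], ![0, 0, 0], ![4, 4, 0], ![2, 3, 0]],
    ![![2, 1, 0], ![1, 2, 0], ![3, 0, 0], ![3, 4, 0]],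
    ![![4, 4, 0], ![2, 0, 0], ![1, 3, 0], ![0, 4, 0]],
    ![![2, 0, 0], ![5, 2, 0], ![2, 4, 0], ![0, 1, 0]],
    ![![2, 0, 0], ![2, 4, 0], ![0, 3, 0], ![4, 1, 0]],
    ![![3, 1, 0], ![3, 3, 0], ![0, 3, 0], ![1, 2, 0]],
    ![![1, 4, 0], ![0, 2, 0], ![3, 0, 0], ![4, 2, 0]],
    ![![2, 0, 0], ![5, 5, 0], ![0, 2, 0], ![4, 3, 0]],
    ![![1, 1, 0], ![2, 0, 0], ![2, 3, 0], ![0, 3, 0]],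
    ![![2, 1, 0], ![0, 0, 0], ![3, 0, 0], ![3, 3, 0]],
    ![![3, 3, 0], ![1, 2, 0], ![0, 0, 0], ![0, 3, 0]]]

/-- Four times the translation part of the Plücker coordinates of `samplePoints`; all inner edges of
the resulting lines have length `1`. -/
def sampleShift : Fin 14 → Fin 6 → ℤ :=
  ![![1, 1, 7, 9, 23, 7],
    ![9, 7, 15, 17, 31, 17],
    ![3, -1, 9, 9, 19, 5],
    ![7, 1, 1, 7, 23, 9],
    ![3, 1, 11, 11, 21, 9],
    ![11, -3, 3, 5, 21, 11],
    ![3, -1, 5, 9, 17, 7],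
    ![5, -3, 5, 7, 15, 7],
    ![11, 1, 5, 9, 19, 11],
    ![5, -3, 5, 7, 15, 7],
    ![7, 1, 9, 13, 31, 11],
    ![5, -3, 3, 3, 11, 5],
    ![-1, -1, 7, 7, 15, 3],
    ![7, -1, -1, 3, 15, 7]]

/-- The `m`-th monomial at the `r`-th sample point. -/
def sampleEntry (t : Fin 14) (r : Fin 4) (m : Fin 6) : ℤ :=
  (conicExponent m 0 : ℤ) * samplePoints t r 0 + (conicExponent m 1 : ℤ) * samplePoints t r 1 +
    (conicExponent m 2 : ℤ) * samplePoints t r 2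

/-- Four times a Plücker coordinate of the sample points. -/
def samplePlucker (t : Fin 14) (i j : Fin 6) : ℤ :=
  sampleShift t i + sampleShift t j + ((if lBit t 0 i = lBit t 0 j then 2 else 0) +
    ((if lBit t 1 i = lBit t 1 j then 2 else 0) + (if lBit t 2 i = lBit t 2 j then 2 else 0)))

/-- Four times the cost of a matching for the sample points. -/
def sampleCost (t : Fin 14) (a b c d : Fin 6) : ℤ :=
  4 * (sampleEntry t 0 a + sampleEntry t 1 b + sampleEntry t 2 c + sampleEntry t 3 d)

/-- The matching with the columns `a`, `b`, `c`, `d` is the only one omitting `i` and `j` whose cost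
is at most the expected Plücker coordinate. -/
def sampleUnique (t : Fin 14) (i j a b c d : Fin 6) : Bool :=
  decide (∀ a', a' ∉ [i, j] → ∀ b', b' ∉ [i, j, a'] → ∀ c', c' ∉ [i, j, a', b'] →
    ∀ d', d' ∉ [i, j, a', b', c'] →
      samplePlucker t i j < sampleCost t a' b' c' d' ∨ (a' = a ∧ b' = b ∧ c' = c ∧ d' = d))

/-- The Plücker coordinates of the sample points, each attained by a single matching. -/
theorem sample_minors : ∀ (t : Fin 14) (i j : Fin 6), i < j →
    ∃ a, a ∉ [i, j] ∧ ∃ b, b ∉ [i, j, a] ∧ ∃ c, c ∉ [i, j, a, b] ∧ ∃ d, d ∉ [i, j, a, b, c] ∧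
      sampleCost t a b c d = samplePlucker t i j ∧ sampleUnique t i j a b c d = true := by
  decide +kernel

/-- The sample points in homogeneous coordinates. -/
def sampleConfig (t : Fin 14) (r : Fin 4) (i : Fin 3) : ℝ := samplePoints t r i

theorem sampleConfig_cost (t : Fin 14) (σ : Fin 4 → Fin 6) :
    4 * matchCost (fun r m => conicMonomial (sampleConfig t r) m) σ =
      (sampleCost t (σ 0) (σ 1) (σ 2) (σ 3) : ℝ) := by
  simp only [matchCost, conicMonomial, sampleConfig, sampleCost, sampleEntry, Fin.sum_univ_four,
    Fin.sum_univ_three]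
  push_cast
  ring

theorem sampleConfig_opt (t : Fin 14) {i j : Fin 6} (hij : i < j) :
    ∃ σ, Avoids i j σ ∧
      4 * matchCost (fun r m => conicMonomial (sampleConfig t r) m) σ = samplePlucker t i j ∧
      ∀ τ, Avoids i j τ → τ ≠ σ →
        matchCost (fun r m => conicMonomial (sampleConfig t r) m) σ <
          matchCost (fun r m => conicMonomial (sampleConfig t r) m) τ := by
  obtain ⟨a, ha, b, hb, c, hc, d, hd, hcost, hmin⟩ := sample_minors t i j hij
  simp only [sampleUnique, decide_eq_true_eq] at hmin
  simp only [List.mem_cons, List.not_mem_nil, or_false, not_or] at ha hb hc hd hmin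
  obtain ⟨ai, aj⟩ := ha
  obtain ⟨bi, bj, ba⟩ := hb
  obtain ⟨ci, cj, ca, cb⟩ := hc
  obtain ⟨di, dj, da, db, dc⟩ := hd
  have hσ : 4 * matchCost (fun r m => conicMonomial (sampleConfig t r) m) ![a, b, c, d] =
      samplePlucker t i j := by
    rw [sampleConfig_cost]
    exact_mod_cast hcost
  refine ⟨![a, b, c, d], ⟨?_, ?_, ?_⟩, hσ, fun τ hτ hne => ?_⟩
  · intro x y hxy
    fin_cases x <;> fin_cases y <;> first
      | rfl
      | exact absurd hxy ba | exact absurd hxy (Ne.symm ba) | exact absurd hxy ca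
      | exact absurd hxy (Ne.symm ca) | exact absurd hxy cb | exact absurd hxy (Ne.symm cb)
      | exact absurd hxy da | exact absurd hxy (Ne.symm da) | exact absurd hxy db
      | exact absurd hxy (Ne.symm db) | exact absurd hxy dc | exact absurd hxy (Ne.symm dc)
  · intro r
    fin_cases r
    exacts [ai, bi, ci, di]
  · intro r
    fin_cases r
    exacts [aj, bj, cj, dj]
  · have n : ∀ r s : Fin 4, r ≠ s → τ r ≠ τ s := fun r s h => hτ.inj.ne h
    rcases hmin (τ 0) ⟨hτ.left _, hτ.right _⟩ (τ 1) ⟨hτ.left _, hτ.right _, n _ _ (by decide)⟩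
      (τ 2) ⟨hτ.left _, hτ.right _, n _ _ (by decide), n _ _ (by decide)⟩
      (τ 3) ⟨hτ.left _, hτ.right _, n _ _ (by decide), n _ _ (by decide), n _ _ (by decide)⟩
      with h | ⟨h0, h1, h2, h3⟩
    · have h' : (samplePlucker t i j : ℝ) < sampleCost t (τ 0) (τ 1) (τ 2) (τ 3) := by
        exact_mod_cast h
      rw [← hσ, ← sampleConfig_cost] at h'
      linarith
    · exfalso
      apply hne
      funext r
      fin_cases r
      exacts [h0, h1, h2, h3]

theorem sampleConfig_generic (t : Fin 14) :
    GenericMatrix fun r m => conicMonomial (sampleConfig t r) m := by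
  intro i j hij
  rcases lt_or_gt_of_ne hij with h | h
  · obtain ⟨σ, h1, -, h2⟩ := sampleConfig_opt t h
    exact ⟨σ, h1, h2⟩
  · obtain ⟨σ, h1, -, h2⟩ := sampleConfig_opt t h
    exact ⟨σ, h1.symm, fun τ hτ => h2 τ hτ.symm⟩

theorem sampleConfig_metric (t : Fin 14) :
    HasTreeMetric (fun r m => conicMonomial (sampleConfig t r) m) t
      (fun m => sampleShift t m / 4) (fun _ => 1 / 2) := by
  have hC := sampleConfig_generic t
  have key : ∀ i j, i < j → plucker (fun r m => conicMonomial (sampleConfig t r) m) i j =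
      (sampleShift t i / 4 : ℝ) + sampleShift t j / 4 +
        ∑ D, if lBit t D i = lBit t D j then (1 / 2 : ℝ) else 0 := by
    intro i j hij
    obtain ⟨σ, h1, h2, h3⟩ := sampleConfig_opt t hij
    have hle := hC.plucker_le hij.ne h1
    have he : plucker (fun r m => conicMonomial (sampleConfig t r) m) i j =
        matchCost (fun r m => conicMonomial (sampleConfig t r) m) σ := by
      refine le_antisymm hle ?_
      by_cases e : optMatching (fun r m => conicMonomial (sampleConfig t r) m) i j = σ
      · rw [plucker, e]
      · exact (h3 _ (hC.avoids hij.ne) e).le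
    have : (samplePlucker t i j : ℝ) = sampleShift t i + sampleShift t j +
        ∑ D, if lBit t D i = lBit t D j then (2 : ℝ) else 0 := by
      rw [samplePlucker, Fin.sum_univ_three]
      push_cast
      split_ifs <;> ring
    rw [he]
    have h4 : ∑ D, (if lBit t D i = lBit t D j then (2 : ℝ) else 0) =
        4 * ∑ D, if lBit t D i = lBit t D j then (1 / 2 : ℝ) else 0 := by
      rw [Finset.mul_sum]
      refine Finset.sum_congr rfl fun D _ => ?_
      split_ifs <;> norm_num
    linarith
  refine ⟨fun _ => by norm_num, fun i j hij => ?_⟩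
  rcases lt_or_gt_of_ne hij with h | h
  · exact key i j h
  · rw [hC.plucker_comm hij, key j i h]
    simp only [eq_comm]
    ring

theorem planarTree_realizable (t : Fin 14) : RealizableByPencil (planarTree t) := by
  have hC := sampleConfig_generic t
  refine ⟨fun r => TropProj.mk (sampleConfig t r), genericPoints_of_genericMatrix hC, ?_⟩
  rw [conicPencil_eq]
  exact (sampleConfig_metric t).isTropicalLineOfType hC

/-! ### Classification of trivalent trees with six leaves -/

/-- `e` is an isomorphism from `Γ` to the standard tree of the given shape in which the leaf `m` is
attached to `par m`; it fixes the leaves. -/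
def IsPresentation (Γ : PencilTree) (star : Bool) (par : Fin 6 → Fin 4) (e : Equiv.Perm (Fin 4)) :
    Prop :=
  ∀ y z, Γ.graph.Adj y z ↔ nodeAdj star par (Sum.map id e y) (Sum.map id e z) = true

/-- No inner edge of the tree separates the leaves in a way that crosses their cyclic order. -/
def Noncrossing (star : Bool) (par : Fin 6 → Fin 4) : Prop :=
  ∀ D i j, i < j → ∀ k, j < k → ∀ l, k < l →
    ¬ (splitBit star D (par i) = splitBit star D (par k) ∧
      splitBit star D (par j) = splitBit star D (par l) ∧
      splitBit star D (par i) ≠ splitBit star D (par j))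

/-- A symmetric relation on four vertices from its six entries. -/
def symmRel (b : Fin 6 → Bool) (v w : Fin 4) : Bool :=
  (![![false, b 0, b 1, b 2], ![b 0, false, b 3, b 4], ![b 1, b 3, false, b 5],
    ![b 2, b 4, b 5, false]] : Fin 4 → Fin 4 → Bool) v w

/-- Every proper nonempty set of vertices is left by an edge. -/
def isConnectedRel (h : Fin 4 → Fin 4 → Bool) : Bool :=
  decide (∀ U : Fin 4 → Bool, (∃ v, U v = true) → (∃ w, U w = false) →
    ∃ v w, U v = true ∧ U w = false ∧ h v w = true)

/-- A connected graph on four vertices with three edges is a star or a path. -/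
theorem exists_shape : ∀ b : Fin 6 → Bool,
    ∑ v, (Finset.univ.filter fun w => symmRel b v w = true).card = 6 →
    isConnectedRel (symmRel b) = true →
    ∃ star, ∃ p q r s : Fin 4, [p, q, r, s].Nodup ∧
      ∀ v w, symmRel b (![p, q, r, s] v) (![p, q, r, s] w) = innerAdj star v w := by
  decide +kernel

/-- The number of leaves attached to each internal vertex of a trivalent tree. -/
def isTrivalent (star : Bool) (par : Fin 6 → Fin 4) : Bool :=
  decide (∀ v, (Finset.univ.filter fun m => par m = v).card +
    (Finset.univ.filter fun w => innerAdj star v w = true).card = 3)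

/-- Symmetries of the two shapes. -/
def shapeAut : Fin 7 → Fin 4 → Fin 4 :=
  ![![0, 1, 2, 3], ![3, 2, 1, 0], ![0, 2, 1, 3], ![1, 0, 2, 3], ![1, 2, 0, 3], ![2, 0, 1, 3],
    ![2, 1, 0, 3]]

instance (star : Bool) (par : Fin 6 → Fin 4) : Decidable (Noncrossing star par) :=
  inferInstanceAs (Decidable (∀ D i j, i < j → ∀ k, j < k → ∀ l, k < l →
    ¬ (splitBit star D (par i) = splitBit star D (par k) ∧
      splitBit star D (par j) = splitBit star D (par l) ∧
      splitBit star D (par i) ≠ splitBit star D (par j))))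

/-- The finite search behind `exists_planar_index`, pruned by the fact that no three leaves are
attached to the same vertex. -/
theorem exists_planar_index_aux : ∀ (star : Bool) (a b c : Fin 4), ¬ (a = b ∧ b = c) →
    ∀ d, ¬ (a = b ∧ b = d) ∧ ¬ (a = c ∧ c = d) ∧ ¬ (b = c ∧ c = d) → ∀ e f,
    isTrivalent star ![a, b, c, d, e, f] = true → Noncrossing star ![a, b, c, d, e, f] →
    ∃ t k, treeStar t = star ∧ (∀ m, treePar t m = shapeAut k (![a, b, c, d, e, f] m)) ∧
      ∀ v w, innerAdj star (shapeAut k v) (shapeAut k w) = innerAdj star v w := by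
  decide +kernel

theorem isTrivalent_card_le {star : Bool} {par : Fin 6 → Fin 4} (h : isTrivalent star par = true)
    {i j k : Fin 6} (hij : i ≠ j) (hik : i ≠ k) (hjk : j ≠ k) :
    ¬ (par i = par j ∧ par j = par k) := by
  rintro ⟨h1, h2⟩
  rw [isTrivalent, decide_eq_true_eq] at h
  have h3 := h (par i)
  have h4 : 3 ≤ (Finset.univ.filter fun m => par m = par i).card := by
    rw [← Finset.card_eq_three.2 ⟨i, j, k, hij, hik, hjk, rfl⟩]
    apply Finset.card_le_card
    intro m hm
    simp only [Finset.mem_insert, Finset.mem_singleton] at hm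
    rcases hm with rfl | rfl | rfl <;> simp [h1, h2]
  have h5 : 0 < (Finset.univ.filter fun w => innerAdj star (par i) w = true).card := by
    rw [Finset.card_pos]
    have h6 : ∀ star v, (Finset.univ.filter fun w => innerAdj star v w = true).Nonempty := by
      decide
    exact h6 _ _
  omega

/-- The planar trees are the noncrossing ones, up to relabelling of internal vertices. -/
theorem exists_planar_index (star : Bool) (par : Fin 6 → Fin 4) (ht : isTrivalent star par = true)
    (hn : Noncrossing star par) : ∃ t k, treeStar t = star ∧
      (∀ m, treePar t m = shapeAut k (par m)) ∧
      ∀ v w, innerAdj star (shapeAut k v) (shapeAut k w) = innerAdj star v w := by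
  have hp : par = ![par 0, par 1, par 2, par 3, par 4, par 5] := by
    funext m; fin_cases m <;> rfl
  have hc := @isTrivalent_card_le star par ht
  rw [hp] at ht hn ⊢
  exact exists_planar_index_aux star _ _ _ (hc (by decide) (by decide) (by decide)) _
    ⟨hc (by decide) (by decide) (by decide), hc (by decide) (by decide) (by decide),
      hc (by decide) (by decide) (by decide)⟩ _ _ ht hn

theorem shapeAut_injective : ∀ k, Function.Injective (shapeAut k) := by
  decide +kernel

theorem SimpleGraph.Reachable.mem_of_closed {V : Type*} {G : SimpleGraph V} {S : Set V}
    (hS : ∀ x y, x ∈ S → G.Adj x y → y ∈ S) {x y : V} (h : G.Reachable x y) (hx : x ∈ S) :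
    y ∈ S := by
  obtain ⟨p⟩ := h
  induction p with
  | nil => exact hx
  | cons hadj _ ih => exact ih (hS _ _ hx hadj)

section Classification

variable (Γ : PencilTree)

theorem PencilTree.exists_unique_neighbor (m : Fin 6) :
    ∃ y, ∀ z, Γ.graph.Adj (Sum.inl m) z ↔ z = y := by
  obtain ⟨y, hy⟩ := Set.ncard_eq_one.1 (Γ.leaf_degree m)
  refine ⟨y, fun z => ?_⟩
  rw [← SimpleGraph.mem_neighborSet, hy]; rfl

theorem PencilTree.exists_parent (m : Fin 6) :
    ∃ v, ∀ z, Γ.graph.Adj (Sum.inl m) z ↔ z = Sum.inr v := by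
  obtain ⟨y, hy⟩ := Γ.exists_unique_neighbor m
  rcases y with m' | v
  · exfalso
    obtain ⟨y', hy'⟩ := Γ.exists_unique_neighbor m'
    have h1 : Γ.graph.Adj (Sum.inl m) (Sum.inl m') := (hy _).2 rfl
    have h2 := (hy' _).1 h1.symm
    have := SimpleGraph.Reachable.mem_of_closed (G := Γ.graph)
      (S := {Sum.inl m, Sum.inl m'}) (by
        rintro x z (rfl | rfl) hxz
        · right; exact (hy z).1 hxz
        · left; rw [(hy' z).1 hxz, h2]) (Γ.isTree.connected.preconnected (Sum.inl m) (Sum.inr 0))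
      (Or.inl rfl)
    simp at this
  · exact ⟨v, hy⟩

open Classical in
theorem PencilTree.exists_presentation : ∃ star par e, IsPresentation Γ star par e ∧
    isTrivalent star par = true := by
  choose par hpar using Γ.exists_parent
  set h : Fin 4 → Fin 4 → Bool := fun v w => decide (Γ.graph.Adj (Sum.inr v) (Sum.inr w)) with hh
  have hsymm : ∀ v w, h v w = h w v := fun v w => by simp [hh, Γ.graph.adj_comm]
  have hirr : ∀ v, h v v = false := fun v => by simp [hh]
  have hleaf : ∀ v m, Γ.graph.Adj (Sum.inr v) (Sum.inl m) ↔ par m = v := by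
    intro v m
    rw [Γ.graph.adj_comm, hpar m]
    constructor
    · intro e; exact (Sum.inr_injective e).symm
    · rintro rfl; rfl
  have hdeg : ∀ v, (Finset.univ.filter fun m => par m = v).card +
      (Finset.univ.filter fun w => h v w = true).card = 3 := by
    intro v
    rw [← Γ.internal_degree v, ← Finset.card_disjSum, ← Set.ncard_coe_finset]
    congr 1
    ext y
    rcases y with m | w
    · simp [hleaf v m]
    · simp [hh]
  have hsum : ∑ v, (Finset.univ.filter fun w => h v w = true).card = 6 := by
    have h1 : ∑ v, (Finset.univ.filter fun m => par m = v).card = 6 := by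
      rw [← Finset.card_eq_sum_card_fiberwise (fun _ _ => Finset.mem_univ _)]
      simp
    have h2 := Finset.sum_congr (rfl : (Finset.univ : Finset (Fin 4)) = Finset.univ)
      fun v _ => hdeg v
    rw [Finset.sum_add_distrib, h1] at h2
    simp at h2
    omega
  have hconn : isConnectedRel h = true := by
    rw [isConnectedRel, decide_eq_true_eq]
    rintro U ⟨v, hv⟩ ⟨w, hw⟩
    by_contra hc
    push Not at hc
    have := SimpleGraph.Reachable.mem_of_closed (G := Γ.graph)
      (S := {y | Sum.elim (fun m => U (par m)) U y = true}) (by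
        rintro (m | x) (m' | z) hx hxz
        · exact absurd ((hpar m _).1 hxz) (by simp)
        · have := Sum.inr_injective ((hpar m _).1 hxz)
          subst this; exact hx
        · have := (hleaf x m').1 hxz
          subst this; exact hx
        · by_contra hz
          exact hc x z hx (by simpa using hz) (by simp [hh, hxz]))
      (Γ.isTree.connected.preconnected (Sum.inr v) (Sum.inr w)) hv
    rw [Set.mem_ofPred_eq, Sum.elim_inr, hw] at this
    exact Bool.noConfusion this
  have hrel : h = symmRel ![h 0 1, h 0 2, h 0 3, h 1 2, h 1 3, h 2 3] := by
    funext v w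
    fin_cases v <;> fin_cases w <;> first
      | exact hirr _
      | rfl
      | exact hsymm _ _
  rw [hrel] at hsum hconn
  obtain ⟨star, p, q, r, s, hnd, hshape⟩ := exists_shape _ hsum hconn
  rw [← hrel] at hshape
  have hinj : Function.Injective ![p, q, r, s] := by
    simp only [List.nodup_cons, List.mem_cons, List.not_mem_nil, or_false, not_or] at hnd
    obtain ⟨⟨pq, pr, ps⟩, ⟨qr, qs⟩, rs, -⟩ := hnd
    intro x y hxy
    fin_cases x <;> fin_cases y <;> first
      | rfl
      | exact absurd hxy pq | exact absurd hxy (Ne.symm pq) | exact absurd hxy pr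
      | exact absurd hxy (Ne.symm pr) | exact absurd hxy ps | exact absurd hxy (Ne.symm ps)
      | exact absurd hxy qr | exact absurd hxy (Ne.symm qr) | exact absurd hxy qs
      | exact absurd hxy (Ne.symm qs) | exact absurd hxy rs | exact absurd hxy (Ne.symm rs)
  let π : Equiv.Perm (Fin 4) := Equiv.ofBijective _ (Finite.injective_iff_bijective.1 hinj)
  have hshape' : ∀ v w, h v w = innerAdj star (π.symm v) (π.symm w) := by
    intro v w
    rw [← hshape]
    exact congrArg₂ h (π.apply_symm_apply v).symm (π.apply_symm_apply w).symm
  refine ⟨star, fun m => π.symm (par m), π.symm, ?_, ?_⟩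
  · rintro (m | v) (m' | w)
    · rw [hpar m]; simp [nodeAdj]
    · rw [hpar m]; simp [nodeAdj, eq_comm]
    · rw [hleaf]; simp [nodeAdj]
    · have := hshape' v w
      simp only [hh] at this
      simp [nodeAdj, ← this]
  · rw [isTrivalent, decide_eq_true_eq]
    intro v
    rw [← hdeg (π v)]
    congr 1
    · congr 1
      ext m
      simp [Equiv.symm_apply_eq]
    · refine Finset.card_bij (fun w _ => π w) ?_ (fun _ _ _ _ h => π.injective h) ?_
      · intro w hw
        simpa [hshape'] using hw
      · intro w hw
        exact ⟨π.symm w, by simpa [hshape'] using hw, by simp⟩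

variable {Γ}

theorem IsPresentation.exists_planar {star : Bool} {par : Fin 6 → Fin 4} {e : Equiv.Perm (Fin 4)}
    (h : IsPresentation Γ star par e) (ht : isTrivalent star par = true)
    (hn : Noncrossing star par) :
    ∃ t e', IsPresentation Γ (treeStar t) (treePar t) e' := by
  obtain ⟨t, k, rfl, hpar, haut⟩ := exists_planar_index star par ht hn
  let π : Equiv.Perm (Fin 4) :=
    Equiv.ofBijective _ (Finite.injective_iff_bijective.1 (shapeAut_injective k))
  refine ⟨t, e.trans π, fun y z => ?_⟩
  rw [h y z]
  have hπ : ∀ v, π v = shapeAut k v := fun _ => rfl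
  rcases y with m | v <;> rcases z with m' | w <;>
    simp [nodeAdj, hpar, hπ, haut, (shapeAut_injective k).eq_iff]

theorem treePiece_map (p : Fin 4 → TropProj 5) (e : Fin 4 → Fin 4) (y z : Fin 6 ⊕ Fin 4) :
    treePiece (p ∘ e) y z = treePiece p (Sum.map id e y) (Sum.map id e z) := by
  rcases y with m | v <;> rcases z with m' | w <;> rfl

/-- The type of a tropical line is invariant under isomorphisms of trees fixing the leaves. -/
theorem IsPresentation.isTropicalLineOfType {t : Fin 14} {e : Equiv.Perm (Fin 4)}
    (h : IsPresentation Γ (treeStar t) (treePar t) e) {L : Set (TropProj 5)}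
    (hL : IsTropicalLineOfType (planarTree t) L) : IsTropicalLineOfType Γ L := by
  obtain ⟨p, u, h1, h2, h3, h4, h5, h6⟩ := hL
  let φ : Fin 6 ⊕ Fin 4 ≃ Fin 6 ⊕ Fin 4 := Equiv.sumCongr (Equiv.refl _) e
  have hφ : ∀ y, φ y = Sum.map id e y := fun y => by rcases y with m | v <;> rfl
  have hadj : ∀ y z, Γ.graph.Adj y z ↔ (planarTree t).graph.Adj (φ y) (φ z) := by
    intro y z
    rw [h y z, hφ, hφ]
    rfl
  have hpiece : ∀ y z, treePiece (p ∘ e) y z = treePiece p (φ y) (φ z) := by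
    intro y z; rw [treePiece_map, hφ, hφ]
  refine ⟨p ∘ e, fun v y => u (e v) (φ y), ?_, ?_, ?_, h4.comp e.injective, ?_, ?_⟩
  · intro v m hvm
    exact h1 (e v) m ((hadj _ _).1 hvm)
  · intro v w hvw
    exact h2 (e v) (e w) ((hadj _ _).1 hvw)
  · intro v
    rw [← h3 (e v)]
    refine Finset.sum_bij (fun y _ => φ y) ?_ (fun _ _ _ _ h => φ.injective h) ?_ ?_
    · intro y hy
      simp only [Finset.mem_filter, Finset.mem_univ, true_and] at hy ⊢
      exact (hadj _ _).1 hy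
    · intro z hz
      simp only [Finset.mem_filter, Finset.mem_univ, true_and] at hz ⊢
      refine ⟨φ.symm z, (hadj _ _).2 ?_, φ.apply_symm_apply z⟩
      rw [φ.apply_symm_apply]; exact hz
    · intro y _; rfl
  · intro y z y' z' hyz hyz' hne a ha
    rw [hpiece, hpiece] at ha
    have hs : ∀ y z, s(φ y, φ z) = Sym2.map φ s(y, z) := fun _ _ => rfl
    obtain ⟨v, hv, hv', hav⟩ := h5 (φ y) (φ z) (φ y') (φ z') ((hadj _ _).1 hyz)
      ((hadj _ _).1 hyz') (fun he => hne (Sym2.map.injective φ.injective he)) a ha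
    have back : ∀ q : Sym2 (Fin 6 ⊕ Fin 4), Sum.inr v ∈ Sym2.map φ q →
        Sum.inr (e.symm v) ∈ q := by
      intro q hq
      obtain ⟨x, hx, hxv⟩ := Sym2.mem_map.1 hq
      have : x = φ.symm (Sum.inr v) := by rw [← hxv, φ.symm_apply_apply]
      rw [this] at hx
      exact hx
    exact ⟨e.symm v, back _ hv, back _ hv', by simp [hav]⟩
  · rw [h6]
    ext a
    constructor
    · rintro ⟨y, z, hyz, ha⟩
      refine ⟨φ.symm y, φ.symm z, (hadj _ _).2 (by simpa using hyz), ?_⟩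
      rw [hpiece]; simpa using ha
    · rintro ⟨y, z, hyz, ha⟩
      exact ⟨φ y, φ z, (hadj _ _).1 hyz, by rw [← hpiece]; exact ha⟩

end Classification

/-! ### Crossing paths in the disc -/

theorem Complex.arg_one_sub_exp {φ : ℝ} (h0 : 0 < φ) (h1 : φ < 2 * Real.pi) :
    Complex.arg (1 - Complex.exp (φ * Complex.I)) = (φ - Real.pi) / 2 := by
  have hs : 0 < Real.sin (φ / 2) := Real.sin_pos_of_pos_of_lt_pi (by linarith) (by linarith)
  have h : 1 - Complex.exp (φ * Complex.I) = ((2 * Real.sin (φ / 2) : ℝ) : ℂ) *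
      (Complex.cos (((φ - Real.pi) / 2 : ℝ) : ℂ) +
        Complex.sin (((φ - Real.pi) / 2 : ℝ) : ℂ) * Complex.I) := by
    have e : (φ - Real.pi) / 2 = φ / 2 - Real.pi / 2 := by ring
    have e2 : φ = 2 * (φ / 2) := by ring
    rw [Complex.exp_mul_I, e, ← Complex.ofReal_cos, ← Complex.ofReal_sin, ← Complex.ofReal_cos,
      ← Complex.ofReal_sin, Real.cos_sub_pi_div_two, Real.sin_sub_pi_div_two]
    conv_lhs => rw [e2, Real.cos_two_mul, Real.sin_two_mul]
    have := congrArg Complex.ofReal (Real.sin_sq_add_cos_sq (φ / 2))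
    generalize Real.sin (φ / 2) = S at this ⊢
    generalize Real.cos (φ / 2) = T at this ⊢
    push_cast at this ⊢
    linear_combination 2 * (-this)
  rw [h, Complex.arg_mul_cos_add_sin_mul_I (by positivity)
    ⟨by linarith, by linarith [Real.pi_pos]⟩]

theorem Complex.one_sub_mem_slitPlane {w : ℂ} (hw : ‖w‖ ≤ 1) (h1 : w ≠ 1) :
    1 - w ∈ Complex.slitPlane := by
  have hre : w.re ≤ 1 := (Complex.re_le_norm w).trans hw
  rcases hre.lt_or_eq with h | h
  · left; simp [h]
  · right
    intro hi
    apply h1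
    apply Complex.ext <;> simp_all

/-- Along a path in the slit plane, up to a constant factor, the increment of a continuous logarithm
is that of the principal branch. -/
theorem log_increment {L w : ℝ → ℂ} {c : ℂ} (hL : Continuous L) (hw : Continuous w)
    (hs : ∀ x, w x ∈ Complex.slitPlane) (h : ∀ x, Complex.exp (L x) = c * w x) (x y : ℝ) :
    (L y - L x).im = (w y).arg - (w x).arg := by
  have hlog : Continuous fun x => Complex.log (w x) := by
    rw [continuous_iff_continuousAt]
    exact fun x => (hw.continuousAt).clog (hs x)
  have hc : c ≠ 0 := by
    rintro rfl
    exact Complex.exp_ne_zero _ ((h 0).trans (zero_mul _))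
  have key := Complex.isCoveringMap_exp.const_of_comp (g := fun x => L x - Complex.log (w x))
    (hL.sub hlog) (fun a b => by
      have : ∀ x, Complex.exp (L x - Complex.log (w x)) = c := fun x => by
        rw [Complex.exp_sub, h, Complex.exp_log (Complex.slitPlane_ne_zero (hs x)),
          mul_div_cancel_right₀ _ (Complex.slitPlane_ne_zero (hs x))]
      exact Subtype.ext ((this a).trans (this b).symm)) x y
  have : L y - L x = Complex.log (w y) - Complex.log (w x) := by linear_combination -key
  rw [this, Complex.sub_im, Complex.log_im, Complex.log_im]

/-- The increment of the argument of the vector from a point of the circle to a point which moves in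
the disc between two points of the circle. -/
theorem arg_increment {L f : ℝ → ℂ} {c : ℂ} {α β₀ β₁ : ℝ} (hL : Continuous L) (hf : Continuous f)
    (hf1 : ∀ x, ‖f x‖ ≤ 1) (hne : ∀ x, f x ≠ Complex.exp (α * Complex.I))
    (h : ∀ x, Complex.exp (L x) = c * (Complex.exp (α * Complex.I) - f x))
    (h0 : f 0 = Complex.exp (β₀ * Complex.I)) (h1 : f 1 = Complex.exp (β₁ * Complex.I))
    (hβ₀ : 0 < β₀ - α) (hβ₀' : β₀ - α < 2 * Real.pi)
    (hβ₁ : 0 < β₁ - α) (hβ₁' : β₁ - α < 2 * Real.pi) :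
    (L 1 - L 0).im = (β₁ - β₀) / 2 := by
  set b := Complex.exp (α * Complex.I) with hb
  have hbn : ‖b‖ = 1 := by rw [hb, Complex.norm_exp_ofReal_mul_I]
  have hb0 : b ≠ 0 := Complex.exp_ne_zero _
  have hq : ∀ β : ℝ, Complex.exp (β * Complex.I) / b =
      Complex.exp (((β - α : ℝ) : ℂ) * Complex.I) := by
    intro β
    rw [hb, ← Complex.exp_sub]
    congr 1; push_cast; ring
  rw [log_increment (w := fun x => 1 - f x / b) (c := c * b) hL (by fun_prop)
    (fun x => Complex.one_sub_mem_slitPlane (by rw [norm_div, hbn, div_one]; exact hf1 x)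
      (fun he => hne x ((div_eq_one_iff_eq hb0).1 he)))
    (fun x => by rw [h x]; field_simp) 0 1]
  rw [h0, h1, hq, hq, Complex.arg_one_sub_exp hβ₀ hβ₀', Complex.arg_one_sub_exp hβ₁ hβ₁']
  ring

/-- Two paths in the closed unit disc meet if their ends alternate on the boundary circle. If they
did not, the argument of the vector from one to the other would be a continuous function on a
square, but its increments along the four sides do not add up to zero. -/
theorem exists_eq_of_crossing {f g : ℝ → ℂ} (hf : Continuous f) (hg : Continuous g)
    (hf1 : ∀ x, ‖f x‖ ≤ 1) (hg1 : ∀ x, ‖g x‖ ≤ 1) {a b c d : ℝ} (hab : a < b) (hbc : b < c)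
    (hcd : c < d) (hda : d < a + 2 * Real.pi) (hf0 : f 0 = Complex.exp (a * Complex.I))
    (hfe : f 1 = Complex.exp (c * Complex.I)) (hg0 : g 0 = Complex.exp (b * Complex.I))
    (hge : g 1 = Complex.exp (d * Complex.I)) : ∃ x y, f x = g y := by
  by_contra hc
  push Not at hc
  let F : C(ℝ × ℝ, {z : ℂ // z ≠ 0}) :=
    ⟨fun q => ⟨f q.1 - g q.2, sub_ne_zero.2 (hc q.1 q.2)⟩, by fun_prop⟩
  obtain ⟨L, ⟨-, hL⟩, -⟩ := Complex.isCoveringMap_exp.existsUnique_continuousMap_lifts F (0, 0)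
    (Complex.log (f 0 - g 0)) (Subtype.ext (Complex.exp_log (sub_ne_zero.2 (hc 0 0))))
  have hexp : ∀ x y, Complex.exp (L (x, y)) = f x - g y :=
    fun x y => congrArg Subtype.val (congrFun hL (x, y))
  have shift : ∀ x : ℝ, Complex.exp (((x + 2 * Real.pi : ℝ) : ℂ) * Complex.I) =
      Complex.exp (x * Complex.I) := by
    intro x
    push_cast
    rw [add_mul, Complex.exp_add, Complex.exp_two_pi_mul_I, mul_one]
  have e1 := arg_increment (L := fun x => L (x, 0)) (f := f) (c := -1) (α := b)
    (β₀ := a + 2 * Real.pi) (β₁ := c) (by fun_prop) hf hf1 (fun x => by rw [← hg0]; exact hc x 0)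
    (fun x => by rw [hexp, hg0]; ring) (by rw [shift, hf0]) hfe (by linarith) (by linarith)
    (by linarith) (by linarith)
  have e2 := arg_increment (L := fun y => L (1, y)) (f := g) (c := 1) (α := c)
    (β₀ := b + 2 * Real.pi) (β₁ := d) (by fun_prop) hg hg1
    (fun y => by rw [← hfe]; exact (hc 1 y).symm)
    (fun y => by rw [hexp, hfe]; ring) (by rw [shift, hg0]) hge (by linarith) (by linarith)
    (by linarith) (by linarith)
  have e3 := arg_increment (L := fun x => L (x, 1)) (f := f) (c := -1) (α := d)
    (β₀ := a + 2 * Real.pi) (β₁ := c + 2 * Real.pi) (by fun_prop) hf hf1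
    (fun x => by rw [← hge]; exact hc x 1)
    (fun x => by rw [hexp, hge]; ring) (by rw [shift, hf0]) (by rw [shift, hfe]) (by linarith)
    (by linarith) (by linarith) (by linarith)
  have e4 := arg_increment (L := fun y => L (0, y)) (f := g) (c := 1) (α := a)
    (β₀ := b) (β₁ := d) (by fun_prop) hg hg1
    (fun y => by rw [← hf0]; exact (hc 0 y).symm)
    (fun y => by rw [hexp, hf0]; ring) hg0 hge (by linarith) (by linarith)
    (by linarith) (by linarith)
  simp only [Complex.sub_im] at e1 e2 e3 e4
  linarith [Real.pi_pos]

/-! ### Planar embeddings have noncrossing edges -/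

theorem splitBit_connected : ∀ star D v w, splitBit star D v = splitBit star D w →
    v = w ∨ innerAdj star v w = true ∨ ∃ u, splitBit star D u = splitBit star D v ∧
      innerAdj star v u = true ∧ innerAdj star u w = true := by
  decide +kernel

/-- The two sides of an inner edge are drawn as disjoint connected sets. If leaves of both sides
alternated on the boundary circle, these sets would contain crossing paths. -/
theorem IsPresentation.noncrossing {Γ : PencilTree} {star : Bool} {par : Fin 6 → Fin 4}
    {e : Equiv.Perm (Fin 4)} (h : IsPresentation Γ star par e)
    (hd : EmbedsInDisc Γ.graph fun m : Fin 6 => (Sum.inl m : Fin 6 ⊕ Fin 4)) :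
    Noncrossing star par := by
  obtain ⟨pos, arc, -, -, -, harc, hsymm, -, hmeet, θ, hθ, hθ', hpos⟩ := hd
  rintro D i j hij k hjk l hkl ⟨hik, hjl, hne⟩
  let bit : Fin 6 ⊕ Fin 4 → Bool :=
    Sum.elim (fun m => splitBit star D (par m)) fun v => splitBit star D (e v)
  let U : Bool → Set ℂ := fun x =>
    {z | ∃ d : Γ.graph.Dart, (∀ v ∈ d.edge, bit v = x) ∧ z ∈ Set.range (arc d)}
  have hU1 : ∀ x, ∀ z ∈ U x, ‖z‖ ≤ 1 := by
    rintro x z ⟨d, -, s, rfl⟩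
    exact harc d s
  have hdisj : ∀ x y z, z ∈ U x → z ∈ U y → x = y := by
    rintro x y z ⟨d, hdx, hz⟩ ⟨d', hdy, hz'⟩
    by_cases hdd : d.edge = d'.edge
    · have hm : d.fst ∈ d.edge := Sym2.mem_mk_left _ _
      rw [← hdx _ hm, hdy _ (hdd ▸ hm)]
    · obtain ⟨v, hv, hv', -⟩ := hmeet d d' hdd z ⟨hz, hz'⟩
      rw [← hdx v hv, hdy v hv']
  have hstep : ∀ y z, nodeAdj star par (Sum.map id e y) (Sum.map id e z) = true → bit y = bit z →
      JoinedIn (U (bit y)) (pos y) (pos z) := by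
    intro y z hyz hb
    let d : Γ.graph.Dart := ⟨(y, z), (h y z).2 hyz⟩
    refine ⟨arc d, fun s => ⟨d, fun v hv => ?_, s, rfl⟩⟩
    rcases Sym2.mem_iff.1 hv with rfl | rfl
    · rfl
    · exact hb.symm
  have hjoin : ∀ m n, splitBit star D (par m) = splitBit star D (par n) →
      JoinedIn (U (splitBit star D (par m))) (pos (Sum.inl m)) (pos (Sum.inl n)) := by
    intro m n hmn
    have hleaf : ∀ m, JoinedIn (U (splitBit star D (par m))) (pos (Sum.inl m))
        (pos (Sum.inr (e.symm (par m)))) := fun m =>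
      hstep (Sum.inl m) (Sum.inr (e.symm (par m))) (by simp [nodeAdj]) (by simp [bit])
    have hinner : ∀ v w, innerAdj star v w = true → splitBit star D v = splitBit star D w →
        JoinedIn (U (splitBit star D v)) (pos (Sum.inr (e.symm v))) (pos (Sum.inr (e.symm w))) := by
      intro v w hvw hb
      have := hstep (Sum.inr (e.symm v)) (Sum.inr (e.symm w)) (by simp [nodeAdj, hvw])
        (by simp [bit, hb])
      simpa [bit] using this
    have h2 := (hleaf n).symm
    rw [← hmn] at h2
    refine ((hleaf m).trans ?_).trans h2
    rcases splitBit_connected star D (par m) (par n) hmn with heq | h1 | ⟨u, hu, h1, h3⟩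
    · rw [← heq]; exact JoinedIn.refl (hleaf m).target_mem
    · exact hinner _ _ h1 hmn
    · have := hinner u (par n) h3 (hu.trans hmn)
      rw [hu] at this
      exact (hinner _ _ h1 hu.symm).trans this
  obtain ⟨f, hf⟩ := hjoin i k hik
  obtain ⟨g, hg⟩ := hjoin j l hjl
  have hf' : ∀ x, f.extend x ∈ U _ := fun x => hf _
  have hg' : ∀ x, g.extend x ∈ U _ := fun x => hg _
  obtain ⟨x, y, hxy⟩ := exists_eq_of_crossing f.continuous_extend g.continuous_extend
    (fun x => hU1 _ _ (hf' x)) (fun x => hU1 _ _ (hg' x)) (hθ hij) (hθ hjk) (hθ hkl) (hθ' l i)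
    (by rw [f.extend_zero, hpos]) (by rw [f.extend_one, hpos]) (by rw [g.extend_zero, hpos])
    (by rw [g.extend_one, hpos])
  exact hne (hdisj _ _ _ (hf' x) (hxy ▸ hg' y))

/-! ### Straight-line drawings of the planar trees -/

/-- The vertices of the regular hexagon in the basis `1, exp (π i / 3)` of `ℂ`. -/
def hexagon : Fin 6 → ℤ × ℤ :=
  ![(1, 0), (0, 1), (-1, 1), (-1, 0), (0, -1), (1, -1)]

/-- Positions of the internal vertices in straight-line drawings of the planar trees, in which the
leaves are the vertices of a regular hexagon of radius `3`. The coordinates are those with respect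
to the basis `1, exp (π i / 3)` of `ℂ`. -/
def drawnVertex : Fin 14 → Fin 4 → ℤ × ℤ :=
  ![![(1, 1), (-1, 1), (-1, 0), (1, -2)],
    ![(-1, 2), (-1, 0), (0, -1), (2, -1)],
    ![(-2, 1), (0, -1), (1, -1), (1, 1)],
    ![(-1, -1), (1, -1), (1, 0), (-1, 2)],
    ![(1, -2), (1, 0), (0, 1), (-2, 1)],
    ![(2, -1), (0, 1), (-1, 1), (-1, -1)],
    ![(1, 1), (-1, 1), (0, -2), (-1, -1)],
    ![(-1, 2), (-1, 1), (1, -1), (1, -2)],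
    ![(-2, 1), (0, 0), (1, 1), (2, 0)],
    ![(1, 1), (1, -1), (-1, 0), (-1, -1)],
    ![(-1, 2), (0, 1), (0, 0), (1, -2)],
    ![(-2, 1), (-1, 1), (1, -1), (2, -1)],
    ![(1, 1), (-2, 1), (1, -2), (0, 0)],
    ![(-1, 2), (-1, -1), (2, -1), (0, 0)]]

/-- Positions of all vertices in the drawings. -/
def drawnPoint (t : Fin 14) : Fin 6 ⊕ Fin 4 → ℤ × ℤ :=
  Sum.elim (fun m => 3 * hexagon m) (drawnVertex t)

/-- The oriented area spanned by three points of the lattice. -/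
def latticeArea (p q r : ℤ × ℤ) : ℤ := (q.1 - p.1) * (r.2 - p.2) - (q.2 - p.2) * (r.1 - p.1)

/-- The segment between `p'` and `q'` meets the line through `p` and `q` at most in a common end of
the two segments. -/
def meetsOnlyAtEnds (p q p' q' : ℤ × ℤ) : Bool :=
  decide (0 < latticeArea p q p' * latticeArea p q q' ∨
    ((p' = p ∨ p' = q) ∧ latticeArea p q q' ≠ 0) ∨ ((q' = p ∨ q' = q) ∧ latticeArea p q p' ≠ 0))

theorem drawnPoint_injective : ∀ t, Function.Injective (drawnPoint t) := by
  decide +kernel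

theorem drawnPoint_norm : ∀ t y, (drawnPoint t y).1 ^ 2 + (drawnPoint t y).1 * (drawnPoint t y).2 +
    (drawnPoint t y).2 ^ 2 ≤ 9 := by
  decide +kernel

theorem drawnPoint_meetsOnlyAtEnds : ∀ t y z, treeAdj t y z = true → ∀ y' z',
    treeAdj t y' z' = true → ¬ (y = y' ∧ z = z') → ¬ (y = z' ∧ z = y') →
    meetsOnlyAtEnds (drawnPoint t y) (drawnPoint t z) (drawnPoint t y') (drawnPoint t z') = true ∨
    meetsOnlyAtEnds (drawnPoint t y') (drawnPoint t z') (drawnPoint t y) (drawnPoint t z) =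
      true := by
  decide +kernel

/-- The primitive sixth root of unity `exp (π i / 3)`. -/
noncomputable def sixthRoot : ℂ := Complex.exp ((Real.pi / 3 : ℝ) * Complex.I)

/-- The point of the disc with given coordinates in the drawings. -/
noncomputable def latticePoint (p : ℤ × ℤ) : ℂ := (p.1 + p.2 * sixthRoot) / 3

theorem sixthRoot_re : sixthRoot.re = 1 / 2 := by
  rw [sixthRoot, Complex.exp_ofReal_mul_I_re, Real.cos_pi_div_three]

theorem sixthRoot_im : sixthRoot.im = √3 / 2 := by
  rw [sixthRoot, Complex.exp_ofReal_mul_I_im, Real.sin_pi_div_three]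

theorem sixthRoot_sq : sixthRoot ^ 2 = sixthRoot - 1 := by
  have h3 : √3 * √3 = 3 := Real.mul_self_sqrt (by norm_num)
  apply Complex.ext
  · simp [sq, sixthRoot_re, sixthRoot_im]; linarith
  · simp [sq, sixthRoot_re, sixthRoot_im]; ring

theorem latticePoint_re (p : ℤ × ℤ) : (latticePoint p).re = (p.1 + p.2 / 2) / 3 := by
  simp [latticePoint, sixthRoot_re]
  ring

theorem latticePoint_im (p : ℤ × ℤ) : (latticePoint p).im = p.2 * (√3 / 2) / 3 := by
  simp [latticePoint, sixthRoot_im]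

theorem latticePoint_injective : Function.Injective latticePoint := by
  intro p q hpq
  have h1 := congrArg Complex.re hpq
  have h2 := congrArg Complex.im hpq
  rw [latticePoint_re, latticePoint_re] at h1
  rw [latticePoint_im, latticePoint_im] at h2
  have h3 : (0 : ℝ) < √3 := by positivity
  have h4 : (p.2 : ℝ) = q.2 := by
    apply mul_right_cancel₀ (b := √3 / 2) (by positivity)
    linarith
  have h5 : (p.1 : ℝ) = q.1 := by rw [h4] at h1; linarith
  exact Prod.ext (by exact_mod_cast h5) (by exact_mod_cast h4)

theorem norm_latticePoint_le {p : ℤ × ℤ} (h : p.1 ^ 2 + p.1 * p.2 + p.2 ^ 2 ≤ 9) :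
    ‖latticePoint p‖ ≤ 1 := by
  have h3 : √3 * √3 = 3 := Real.mul_self_sqrt (by norm_num)
  have hr : (p.1 : ℝ) ^ 2 + p.1 * p.2 + p.2 ^ 2 ≤ 9 := by exact_mod_cast h
  rw [← sq_le_one_iff₀ (norm_nonneg _), ← Complex.normSq_eq_norm_sq, Complex.normSq_apply,
    latticePoint_re, latticePoint_im]
  nlinarith

/-- The oriented area spanned by three points of the plane. -/
noncomputable def planeArea (p q r : ℂ) : ℝ :=
  (q.re - p.re) * (r.im - p.im) - (q.im - p.im) * (r.re - p.re)

theorem planeArea_latticePoint (p q r : ℤ × ℤ) :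
    planeArea (latticePoint p) (latticePoint q) (latticePoint r) =
      latticeArea p q r * (√3 / 18) := by
  simp only [planeArea, latticePoint_re, latticePoint_im, latticeArea]
  push_cast
  ring

theorem eq_end_of_meetsOnlyAtEnds {p q p' q' : ℤ × ℤ} (h : meetsOnlyAtEnds p q p' q' = true)
    {z : ℂ} (hz : z ∈ segment ℝ (latticePoint p) (latticePoint q))
    (hz' : z ∈ segment ℝ (latticePoint p') (latticePoint q')) :
    ∃ r, (r = p ∨ r = q) ∧ (r = p' ∨ r = q') ∧ z = latticePoint r := by
  have hpos : (0 : ℝ) < √3 / 18 := by positivity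
  have h0 : planeArea (latticePoint p) (latticePoint q) z = 0 := by
    obtain ⟨a, b, -, -, hab, rfl⟩ := hz
    obtain rfl : a = 1 - b := by linarith
    simp [planeArea]; ring
  obtain ⟨a, b, ha, hb, hab, rfl⟩ := hz'
  have h1 : a * latticeArea p q p' + b * latticeArea p q q' = 0 := by
    have e : planeArea (latticePoint p) (latticePoint q)
        (a • latticePoint p' + b • latticePoint q') =
        a * planeArea (latticePoint p) (latticePoint q) (latticePoint p') +
        b * planeArea (latticePoint p) (latticePoint q) (latticePoint q') := by
      obtain rfl : a = 1 - b := by linarith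
      simp [planeArea]; ring
    rw [e, planeArea_latticePoint, planeArea_latticePoint] at h0
    have : (a * latticeArea p q p' + b * latticeArea p q q') * (√3 / 18) = 0 := by linarith
    exact (mul_eq_zero.1 this).resolve_right hpos.ne'
  rw [meetsOnlyAtEnds, decide_eq_true_eq] at h
  rcases h with h | ⟨hp, h⟩ | ⟨hq, h⟩
  · exfalso
    have h' : (0 : ℝ) < latticeArea p q p' * latticeArea p q q' := by exact_mod_cast h
    generalize (latticeArea p q p' : ℝ) = x at h' h1
    generalize (latticeArea p q q' : ℝ) = y at h' h1
    have h2 : a * x ^ 2 + b * (x * y) = 0 := by linear_combination x * h1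
    have hx : 0 < x ^ 2 := by
      have : x ≠ 0 := by rintro rfl; simp at h'
      positivity
    have hmin := mul_le_mul_of_nonneg_left (min_le_left (x ^ 2) (x * y)) ha
    have hmin' := mul_le_mul_of_nonneg_left (min_le_right (x ^ 2) (x * y)) hb
    have := lt_min hx h'
    rw [← one_mul (min _ _), ← hab, add_mul] at this
    linarith
  · have hx : latticeArea p q p' = 0 := by rcases hp with rfl | rfl <;> simp [latticeArea]; ring
    rw [hx, Int.cast_zero, mul_zero, zero_add] at h1
    have hb0 : b = 0 := (mul_eq_zero.1 h1).resolve_right (by exact_mod_cast h)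
    obtain rfl : a = 1 := by linarith
    exact ⟨p', hp, Or.inl rfl, by simp [hb0]⟩
  · have hx : latticeArea p q q' = 0 := by rcases hq with rfl | rfl <;> simp [latticeArea]; ring
    rw [hx, Int.cast_zero, mul_zero, add_zero] at h1
    have ha0 : a = 0 := (mul_eq_zero.1 h1).resolve_right (by exact_mod_cast h)
    obtain rfl : b = 1 := by linarith
    exact ⟨q', hq, Or.inr rfl, by simp [ha0]⟩

theorem sixthRoot_pow (m : Fin 6) : latticePoint (3 * hexagon m) = sixthRoot ^ (m : ℕ) := by
  have h2 := sixthRoot_sq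
  have h3 : sixthRoot ^ 3 = -1 := by linear_combination (sixthRoot + 1) * h2
  fin_cases m <;> simp [latticePoint, hexagon]
  · linear_combination -h2
  · linear_combination -h3
  · linear_combination -sixthRoot * h3
  · linear_combination -sixthRoot ^ 2 * h3 + h2

/-- The tree is drawn with straight edges. A vertex on an arc is a common point of this arc and of an
arc at the vertex, so it is an end of the former. -/
theorem IsPresentation.embedsInDisc {Γ : PencilTree} {t : Fin 14} {e : Equiv.Perm (Fin 4)}
    (h : IsPresentation Γ (treeStar t) (treePar t) e) :
    EmbedsInDisc Γ.graph fun m : Fin 6 => (Sum.inl m : Fin 6 ⊕ Fin 4) := by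
  let pt : Fin 6 ⊕ Fin 4 → ℤ × ℤ := fun y => drawnPoint t (Sum.map id e y)
  have hmap : Function.Injective (Sum.map id e : Fin 6 ⊕ Fin 4 → Fin 6 ⊕ Fin 4) :=
    Function.injective_id.sumMap e.injective
  have hpt : Function.Injective pt := (drawnPoint_injective t).comp hmap
  let pos : Fin 6 ⊕ Fin 4 → ℂ := fun y => latticePoint (pt y)
  have hpos : Function.Injective pos := latticePoint_injective.comp hpt
  have hnorm : ∀ y, ‖pos y‖ ≤ 1 := fun y => norm_latticePoint_le (drawnPoint_norm t _)
  have hmeet : ∀ d d' : Γ.graph.Dart, d.edge ≠ d'.edge →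
      ∀ z ∈ segment ℝ (pos d.fst) (pos d.snd) ∩ segment ℝ (pos d'.fst) (pos d'.snd),
      ∃ v, v ∈ d.edge ∧ v ∈ d'.edge ∧ z = pos v := by
    rintro ⟨⟨y, z⟩, hd⟩ ⟨⟨y', z'⟩, hd'⟩ hne x ⟨hx, hx'⟩
    have hs : ¬ (Sum.map id e y = Sum.map id e y' ∧ Sum.map id e z = Sum.map id e z') := fun he =>
      hne (by rw [SimpleGraph.Dart.edge_mk, SimpleGraph.Dart.edge_mk, hmap he.1, hmap he.2])
    have hs' : ¬ (Sum.map id e y = Sum.map id e z' ∧ Sum.map id e z = Sum.map id e y') := fun he =>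
      hne (by
        rw [SimpleGraph.Dart.edge_mk, SimpleGraph.Dart.edge_mk, hmap he.1, hmap he.2, Sym2.eq_swap])
    obtain ⟨r, hr, hr', hxr⟩ : ∃ r, (r = pt y ∨ r = pt z) ∧ (r = pt y' ∨ r = pt z') ∧
        x = latticePoint r := by
      rcases drawnPoint_meetsOnlyAtEnds t _ _ ((h _ _).1 hd) _ _ ((h _ _).1 hd') hs hs' with hm | hm
      · exact eq_end_of_meetsOnlyAtEnds hm hx hx'
      · obtain ⟨r, h1, h2, h3⟩ := eq_end_of_meetsOnlyAtEnds hm hx' hx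
        exact ⟨r, h2, h1, h3⟩
    have hback : ∀ y z, (r = pt y ∨ r = pt z) → ∃ v, v ∈ s(y, z) ∧ r = pt v := by
      rintro y z (rfl | rfl)
      · exact ⟨y, Sym2.mem_mk_left _ _, rfl⟩
      · exact ⟨z, Sym2.mem_mk_right _ _, rfl⟩
    obtain ⟨v, hv, hrv⟩ := hback y z hr
    obtain ⟨v', hv', hrv'⟩ := hback y' z' hr'
    obtain rfl := hpt (hrv.symm.trans hrv')
    exact ⟨v, hv, hv', by rw [hxr, hrv]⟩
  have hdeg : ∀ v, ∃ w, Γ.graph.Adj v w := by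
    intro v
    have : Nontrivial (Fin 6 ⊕ Fin 4) := ⟨Sum.inl 0, Sum.inr 0, by simp⟩
    exact Γ.isTree.connected.preconnected.exists_adj_of_nontrivial v
  refine ⟨pos, fun d => Path.segment _ _, hpos, hnorm, ?_, ?_, ?_, ?_, ?_,
    fun m => m * (Real.pi / 3), ?_, ?_, ?_⟩
  · intro d
    exact Path.segment_injective_of_ne fun he => d.adj.ne (hpos he)
  · intro d s
    have : Path.segment (pos d.fst) (pos d.snd) s ∈ segment ℝ (pos d.fst) (pos d.snd) := by
      rw [← Path.range_segment]; exact ⟨s, rfl⟩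
    have hball := (convex_closedBall (0 : ℂ) 1).segment_subset
      (mem_closedBall_zero_iff.2 (hnorm d.fst)) (mem_closedBall_zero_iff.2 (hnorm d.snd)) this
    exact mem_closedBall_zero_iff.1 hball
  · intro d
    rw [Path.range_segment, Path.range_segment]
    exact segment_symm ℝ _ _
  · intro d v hv
    rw [Path.range_segment] at hv
    by_contra hvd
    obtain ⟨w, hw⟩ := hdeg v
    let d' : Γ.graph.Dart := ⟨(v, w), hw⟩
    obtain ⟨u, hu, -, hvu⟩ := hmeet d d' (fun he => hvd (he ▸ Sym2.mem_mk_left _ _)) (pos v)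
      ⟨hv, left_mem_segment ℝ _ _⟩
    exact hvd (hpos hvu ▸ hu)
  · intro d d' hne z hz
    rw [Path.range_segment, Path.range_segment] at hz
    exact hmeet d d' hne z hz
  · intro i j hij
    have : (i : ℝ) < j := by exact_mod_cast hij
    have := Real.pi_pos
    simp only
    nlinarith
  · intro i j
    have h1 : ((i : ℕ) : ℝ) ≤ 5 := by exact_mod_cast Nat.le_of_lt_succ i.2
    have h2 : (0 : ℝ) ≤ (j : ℕ) := Nat.cast_nonneg _
    have := Real.pi_pos
    nlinarith
  · intro m
    change latticePoint (3 * hexagon m) = _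
    rw [sixthRoot_pow, sixthRoot, ← Complex.exp_nat_mul]
    congr 1
    push_cast
    ring

/-! ### The trees of pencils are planar -/

/-- The `0/1`-vector of a set of leaves. -/
def indicatorVec (A : Fin 6 → Bool) (m : Fin 6) : ℝ := if A m then 1 else 0

/-- A primitive vector which is a positive multiple of a `0/1`-vector equals it. -/
theorem IsPrimitiveVector.mk_eq_of_smul {u : Fin 6 → ℤ} (hu : IsPrimitiveVector u)
    {A : Fin 6 → Bool} {c : ℝ} (hc : 0 < c)
    (h : TropProj.mk (n := 5) (fun i => (u i : ℝ)) = c • TropProj.mk (indicatorVec A)) :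
    TropProj.mk (n := 5) (fun i => (u i : ℝ)) = TropProj.mk (indicatorVec A) := by
  rw [← TropProj.mk_smul, TropProj.mk_eq_mk] at h
  obtain ⟨k, hk⟩ := h
  have hdiff : ∀ i j, (u i : ℝ) - u j = c * (indicatorVec A i - indicatorVec A j) := by
    intro i j
    rw [hk i, hk j]
    simp only [Pi.smul_apply, smul_eq_mul]
    ring
  suffices hc1 : c = 1 by
    refine TropProj.mk_eq_mk.2 ⟨k, fun m => ?_⟩
    rw [hk m, hc1, one_smul]
  by_cases hij : ∃ i j, A i = true ∧ A j = false
  · obtain ⟨i, j, hi, hj⟩ := hij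
    have hd := hdiff i j
    simp only [indicatorVec, hi, hj] at hd
    have hunit := hu (u i - u j) fun a b => by
      have hab := hdiff a b
      have : (u a - u b : ℤ) = (u i - u j) * ((if A a then 1 else 0) - if A b then 1 else 0) := by
        have : ((u a - u b : ℤ) : ℝ) =
            (((u i - u j) * ((if A a then 1 else 0) - if A b then 1 else 0) : ℤ) : ℝ) := by
          push_cast
          rw [hab, hd]
          simp [indicatorVec]
        exact_mod_cast this
      exact ⟨_, this⟩
    have hpos : (0 : ℝ) < ((u i - u j : ℤ) : ℝ) := by push_cast; rw [hd]; simpa using hc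
    rcases Int.isUnit_iff.1 hunit with h1 | h1
    · have : ((u i - u j : ℤ) : ℝ) = 1 := by rw [h1]; norm_num
      push_cast at this
      rw [hd] at this
      simpa using this
    · rw [h1] at hpos; norm_num at hpos
  · exfalso
    push Not at hij
    have hconst : ∀ i j, indicatorVec A i = indicatorVec A j := by
      intro i j
      have h1 := hij i j
      have h2 := hij j i
      cases hi : A i <;> cases hj : A j <;> simp_all [indicatorVec]
    have := hu 0 fun i j => by
      have h0 := hdiff i j
      rw [hconst i j, sub_self, mul_zero] at h0
      have : (u i - u j : ℤ) = 0 := by exact_mod_cast h0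
      rw [this]
    simp at this

section Directions

variable {star : Bool} {par : Fin 6 → Fin 4} {q : Fin 4 → TropProj 5}
  {U : Fin 4 → Fin 4 → Fin 6 → ℤ}

/-- If the direction of an inner edge is known at one end, it is known at the other end. Primitivity
enters here: it makes the two integer vectors opposite, and not just opposite multiples. -/
theorem edge_of_balanced (h2 : ∀ v w, innerAdj star v w = true → IsPrimitiveVector (U v w) ∧
      ∃ ℓ : ℝ, 0 < ℓ ∧ q w = q v + ℓ • TropProj.mk (fun i => (U v w i : ℝ)))
    {v w : Fin 4} (hvw : innerAdj star v w = true) (hwv : innerAdj star w v = true)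
    {A : Fin 6 → Bool}
    (hA : TropProj.mk (indicatorVec A) + TropProj.mk (fun i => (U w v i : ℝ)) = 0) :
    (∃ ℓ : ℝ, 0 < ℓ ∧ q w = q v + ℓ • TropProj.mk (indicatorVec A)) ∧
      TropProj.mk (fun i => (U v w i : ℝ)) = TropProj.mk (indicatorVec A) := by
  obtain ⟨-, ℓ, hℓ, h⟩ := h2 w v hwv
  obtain ⟨hprim, ℓ', hℓ', h'⟩ := h2 v w hvw
  rw [← neg_eq_iff_add_eq_zero] at hA
  rw [← hA] at h
  have hq : q w = q v + ℓ • TropProj.mk (indicatorVec A) := by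
    rw [h]; simp
  refine ⟨⟨ℓ, hℓ, hq⟩, hprim.mk_eq_of_smul (c := ℓ / ℓ') (by positivity) ?_⟩
  rw [hq, add_right_inj] at h'
  rw [div_eq_inv_mul, mul_smul, h', inv_smul_smul₀ hℓ'.ne']

/-- The inner edges of a tropical line have the direction of the `0/1`-vector of the leaves on one
side. -/
theorem exists_edge_direction
    (h2 : ∀ v w, innerAdj star v w = true → IsPrimitiveVector (U v w) ∧
      ∃ ℓ : ℝ, 0 < ℓ ∧ q w = q v + ℓ • TropProj.mk (fun i => (U v w i : ℝ)))
    (h3 : ∀ v, TropProj.mk (indicatorVec fun m => decide (par m = v)) +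
      ∑ w with innerAdj star v w = true, TropProj.mk (fun i => (U v w i : ℝ)) = 0)
    (D : Fin 3) : ∃ v w, innerAdj star v w = true ∧
      ∃ ℓ : ℝ, 0 < ℓ ∧ q w = q v + ℓ • TropProj.mk (indicatorVec fun m =>
        splitBit star D (par m)) := by
  -- at an end of the graph of inner edges only one direction is unknown
  have hend : ∀ v w, innerAdj star v w = true → innerAdj star w v = true →
      (Finset.univ.filter fun y => innerAdj star w y = true) = {v} →
      (∃ ℓ : ℝ, 0 < ℓ ∧ q w = q v + ℓ • TropProj.mk (indicatorVec fun m => decide (par m = w))) ∧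
      TropProj.mk (fun i => (U v w i : ℝ)) =
        TropProj.mk (indicatorVec fun m => decide (par m = w)) := by
    intro v w hvw hwv hf
    refine edge_of_balanced h2 hvw hwv ?_
    have := h3 w
    rwa [hf, Finset.sum_singleton] at this
  have hcol : ∀ w, (∀ x, splitBit star D x = decide (x = w)) →
      (fun m => splitBit star D (par m)) = fun m => decide (par m = w) :=
    fun w hw => funext fun m => hw (par m)
  cases star
  · obtain rfl | rfl | rfl : D = 0 ∨ D = 1 ∨ D = 2 := by clear hcol; revert D; decide
    · refine ⟨1, 0, rfl, ?_⟩
      rw [hcol 0 (by decide)]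
      exact (hend 1 0 rfl rfl (by decide)).1
    · refine ⟨2, 1, rfl, ?_⟩
      refine (edge_of_balanced h2 rfl rfl ?_).1
      have h := h3 1
      rw [show (Finset.univ.filter fun y => innerAdj false 1 y = true) = {0, 2} by decide,
        Finset.sum_pair (by decide), (hend 1 0 rfl rfl (by decide)).2, ← add_assoc,
        ← TropProj.mk_add] at h
      rw [← h]
      congr 2
      funext m
      have key : ∀ x : Fin 4, (if splitBit false 1 x = true then (1 : ℝ) else 0) =
          (if decide (x = 1) = true then 1 else 0) + if decide (x = 0) = true then 1 else 0 := by
        intro x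
        fin_cases x <;> simp [splitBit]
      exact key (par m)
    · refine ⟨2, 3, rfl, ?_⟩
      rw [hcol 3 (by decide)]
      exact (hend 2 3 rfl rfl (by decide)).1
  · have hstar : ∀ D : Fin 3, innerAdj true 3 D.castSucc = true ∧
        innerAdj true D.castSucc 3 = true ∧
        (Finset.univ.filter fun y => innerAdj true D.castSucc y = true) = {3} := by
      decide
    obtain ⟨h31, h13, hf⟩ := hstar D
    refine ⟨3, D.castSucc, h31, ?_⟩
    rw [hcol D.castSucc (fun x => by simp [splitBit])]
    exact (hend 3 D.castSucc h31 h13 hf).1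

end Directions

/-- If two points of the pencil differ by a multiple of a `0/1`-vector, then at their midpoint every
term of a conic at which the minimum is attained has a companion on the same side. -/
theorem exists_tight_same_side {C : Fin 4 → Fin 6 → ℝ} {b : Fin 6 → ℝ} {A : Fin 6 → Bool} {ℓ : ℝ}
    (hℓ : 0 < ℓ) (h0 : InPencil C b) (h1 : InPencil C fun m => b m + ℓ * indicatorVec A m)
    (r : Fin 4) (m : Fin 6) (hm : Tight C (fun m => b m + ℓ / 2 * indicatorVec A m) r m) :
    ∃ m', m' ≠ m ∧ Tight C (fun m => b m + ℓ / 2 * indicatorVec A m) r m' ∧ A m' = A m := by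
  have hind : ∀ k, (A k = true ∧ indicatorVec A k = 1) ∨ (A k = false ∧ indicatorVec A k = 0) := by
    intro k
    cases hk : A k <;> simp [indicatorVec, hk]
  simp only [Tight] at hm ⊢
  rcases hind m with ⟨hA, em⟩ | ⟨hA, em⟩ <;> simp only [em] at hm
  · -- moving back along the vector favours the terms inside `A`
    obtain ⟨m', hne, ht⟩ := (inPencil_iff.1 h0) r m fun k => by
      rcases hind k with ⟨-, ek⟩ | ⟨-, ek⟩ <;> have := hm k <;> rw [ek] at this <;> linarith
    have htm := ht m
    rcases hind m' with ⟨hA', em'⟩ | ⟨-, em'⟩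
    · exact ⟨m', hne, fun k => by rw [em']; linarith [hm k], hA'.trans hA.symm⟩
    · have := hm m'
      rw [em'] at this
      linarith
  · obtain ⟨m', hne, ht⟩ := (inPencil_iff.1 h1) r m fun k => by
      simp only [em]
      rcases hind k with ⟨-, ek⟩ | ⟨-, ek⟩ <;> have := hm k <;> rw [ek] at this ⊢ <;> linarith
    have htm := ht m
    simp only [em] at htm
    rcases hind m' with ⟨-, em'⟩ | ⟨hA', em'⟩
    · have := hm m'
      rw [em'] at this htm
      linarith
    · rw [em'] at htm
      exact ⟨m', hne, fun k => by rw [em']; linarith [hm k], hA'.trans hA.symm⟩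

/-- Colouring the monomials by the sides of an inner edge of the pencil, the midpoint of this edge
satisfies the assumption of `noncrossing_of_colouring`. -/
theorem IsPresentation.noncrossing_of_realizable {Γ : PencilTree} {star : Bool}
    {par : Fin 6 → Fin 4} {e : Equiv.Perm (Fin 4)} (h : IsPresentation Γ star par e)
    (hr : RealizableByPencil Γ) : Noncrossing star par := by
  obtain ⟨P, hP, p, u, h1, h2, h3, -, -, h6⟩ := hr
  choose x hx using fun i => TropProj.mk_surjective (P i)
  obtain rfl : (fun i => TropProj.mk (x i)) = P := funext hx
  have hC := genericMatrix_of_genericPoints hP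
  have hadj : ∀ v w, Γ.graph.Adj (Sum.inr (e.symm v)) (Sum.inr (e.symm w)) ↔
      innerAdj star v w = true := by
    intro v w; rw [h]; simp [nodeAdj]
  have hleaf : ∀ v m, Γ.graph.Adj (Sum.inr (e.symm v)) (Sum.inl m) ↔ par m = v := by
    intro v m; rw [h]; simp [nodeAdj]
  intro D i j hij k hjk l hkl ⟨hik, hjl, hne⟩
  obtain ⟨v, w, hvw, ℓ, hℓ, hq⟩ := exists_edge_direction (star := star) (par := par)
    (q := fun v => p (e.symm v)) (U := fun v w => u (e.symm v) (Sum.inr (e.symm w)))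
    (fun v w hvw => h2 _ _ ((hadj v w).2 hvw)) (fun v => by
      classical
      rw [← h3 (e.symm v), Finset.sum_filter (s := Finset.univ) (p := fun y : Fin 6 ⊕ Fin 4 => _),
        Fintype.sum_sum_type]
      congr 1
      · rw [← Finset.sum_filter]
        rw [Finset.sum_congr rfl fun m hm => by
          rw [h1 _ m (by simpa using hm)], ← TropProj.mk_sum]
        congr 1
        funext m
        simp [indicatorVec, Finset.sum_apply, Pi.single_apply, hleaf]
      · rw [Finset.sum_filter]
        refine Eq.trans ?_ (e.symm.sum_comp _)
        exact Finset.sum_congr rfl fun w _ => if_congr (hadj v w).symm rfl rfl) D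
  have hmem : ∀ y, y = p (e.symm v) ∨ y = p (e.symm w) →
      y ∈ conicPencil fun i => TropProj.mk (x i) := by
    intro y hy
    rw [h6]
    refine ⟨Sum.inr (e.symm v), Sum.inr (e.symm w), (hadj v w).2 hvw, ?_⟩
    rcases hy with rfl | rfl
    · exact left_mem_segment ℝ _ _
    · exact right_mem_segment ℝ _ _
  obtain ⟨b, hb⟩ := TropProj.mk_surjective (p (e.symm v))
  have hb0 := hmem _ (Or.inl hb)
  have hb1 := hmem _ (Or.inr rfl)
  rw [mk_mem_conicPencil] at hb0
  rw [hq, ← hb, ← TropProj.mk_smul, ← TropProj.mk_add, mk_mem_conicPencil] at hb1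
  exact noncrossing_of_colouring hC (exists_tight_same_side hℓ hb0 hb1) hij hjk hkl hik hjl hne

theorem mainTheorem1 :
    (∀ P : Fin 4 → TropProj 2, GenericPoints P →
      ∃ Γ : PencilTree, IsTropicalLineOfType Γ (conicPencil P)) ∧
    (∀ Γ : PencilTree, RealizableByPencil Γ ↔
      EmbedsInDisc Γ.graph (fun m : Fin 6 => (Sum.inl m : Fin 6 ⊕ Fin 4))) := by
  refine ⟨fun P hP => ?_, fun Γ => ?_⟩
  · obtain ⟨t, ht⟩ := exists_isTropicalLineOfType P hP
    exact ⟨planarTree t, ht⟩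
  · obtain ⟨star, par, e, h, htri⟩ := Γ.exists_presentation
    constructor
    · intro hr
      obtain ⟨t, e', h'⟩ := h.exists_planar htri (h.noncrossing_of_realizable hr)
      exact h'.embedsInDisc
    · intro hd
      obtain ⟨t, e', h'⟩ := h.exists_planar htri (h.noncrossing hd)
      obtain ⟨P, hP, hL⟩ := planarTree_realizable t
      exact ⟨P, hP, h'.isTropicalLineOfType hL⟩
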